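/- There is a single real-RAM program (integer variables and arrays for counters and addresses with unit-cost addition, subtraction and comparison; real variables and arrays with unit-cost addition, subtraction, multiplication, division and comparison; unit-cost queries of the input distances; no conversion of reals to integers; only natural-number constants) which runs in worst-case time $O(n^3\log^2 n)$ and solves the following problem for every metric space $(X,d)$ and every finite set $S\subseteq X$ of $n$ sites, presented in any order. A weighted star $H$ with leaf set $S$ is the graph whose vertices are the sites in $S$ and one further vertex, the center $h$, and whose edges are exactly the pairs $\{h,v\}$ with $v\in S$, each carrying a real weight $c_v$. Let $d_H(x,y)$ be the length of a shortest (simple) path from $x$ to $y$ in $H$. Call $H$ admissible if $d_H(x,y)\ge d(x,y)$ for all $x,y\in S$, and $d_H(x,y)=d_H(y,x)$ and $d_H(x,z)\le d_H(x,y)+d_H(y,z)$ for all vertices $x,y,z$ of $H$, including the center. The dilation of $H$ is $$\Delta_H=\max_{u,v\in S,\ u\ne v}\frac{d_H(u,v)}{d(u,v)}$$ (and $\Delta_H=0$ if $n\le 1$). Given $n$ and the distances between the sites, the program outputs the edge weights $(c_v)_{v\in S}$ of an admissible weighted star $H$ with leaf set $S$ such that $\Delta_H\le\Delta_{H'}$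 for every admissible weighted star $H'$ with leaf set $S$. -/

import Mathlib

/-! ### Weighted graphs, stars and dilation -/

/-- An undirected graph with real edge weights. Only the values of `weight` on the
edges of `graph` matter. -/
structure WeightedGraph (V : Type*) where
  graph : SimpleGraph V
  weight : Sym2 V → ℝ

namespace WeightedGraph

/-- The length of a walk: the sum of the weights of its edges. -/
def length {V : Type*} (G : WeightedGraph V) {x y : V} (p : G.graph.Walk x y) : ℝ :=
  (p.edges.map G.weight).sum

/-- The length of a shortest path from `x` to `y`. (In a finite connected graph this is a minimum
over a finite nonempty set.) -/
noncomputable def pathDist {V : Type*} (G : WeightedGraph V) (x y : V) : ℝ :=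
  ⨅ p : G.graph.Path x y, G.length p.1

end WeightedGraph

/-- The weighted star with leaf set `V`: its vertices are the leaves `some v` and one further vertex
`none`, the center; its edges join the center to every other vertex, and the edge between the center
and the leaf `v` has weight `c v`. Every weighted star with leaf set `V` is of this form. -/
def weightedStar {V : Type*} (c : V → ℝ) : WeightedGraph (Option V) where
  graph := SimpleGraph.starGraph none
  weight := Sym2.lift ⟨fun a b => a.elim 0 c + b.elim 0 c, fun _ _ => add_comm _ _⟩

/-- The dilation of a graph whose vertices include the sites `V`: the largest ratio, over pairs of
distinct sites, between the distance in the graph and the distance in the metric space. (It is `0`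
if there are fewer than two sites.) -/
noncomputable def dilation {V W : Type*} [MetricSpace V] (G : WeightedGraph W) (site : V → W) : ℝ :=
  ⨆ p : {p : V × V // p.1 ≠ p.2},
    G.pathDist (site p.1.1) (site p.1.2) / dist p.1.1 p.1.2

/-- The requirements on a star: distances between leaves are at least the input distances, and the
distances between all vertices (the center included) are symmetric and obey the triangle
inequality. -/
def IsAdmissibleStar {V : Type*} [MetricSpace V] (c : V → ℝ) : Prop :=
  (∀ x y : V, dist x y ≤ (weightedStar c).pathDist (some x) (some y)) ∧
  (∀ x y : Option V, (weightedStar c).pathDist x y = (weightedStar c).pathDist y x) ∧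
  (∀ x y z : Option V, (weightedStar c).pathDist x z ≤
    (weightedStar c).pathDist x y + (weightedStar c).pathDist y z)

/-- An admissible star whose dilation is smallest among all admissible stars. -/
def IsOptimalStar {V : Type*} [MetricSpace V] (c : V → ℝ) : Prop :=
  IsAdmissibleStar c ∧
  ∀ c' : V → ℝ, IsAdmissibleStar c' →
    dilation (weightedStar c) some ≤ dilation (weightedStar c') some

/-! ### The real RAM

A program works with integer variables and arrays (used for counters and addresses) and with real
variables and arrays. It may add, subtract and compare integers, it may add, subtract, multiply,
divide and compare reals, and it may query the input distance between two sites. Each of these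
operations, and each access to a variable or to an array cell, takes one unit of time. A real
number is never converted into an integer, and the only constants are natural numbers. -/

namespace RealRAM

/-- Integer expressions. Variables and arrays are named by natural numbers. -/
inductive IntExp : Type
  | lit (k : ℕ)
  | var (x : ℕ)
  | get (a : ℕ) (i : IntExp)
  | add (e f : IntExp)
  | sub (e f : IntExp)

/-- Real expressions; `query i j` asks for the input distance between the sites `i` and `j`. -/
inductive RealExp : Type
  | lit (k : ℕ)
  | var (x : ℕ)
  | get (a : ℕ) (i : IntExp)
  | query (i j : IntExp)
  | add (e f : RealExp)
  | sub (e f : RealExp)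
  | mul (e f : RealExp)
  | div (e f : RealExp)

/-- Tests. -/
inductive Test : Type
  | intLE (e f : IntExp)
  | realLE (e f : RealExp)
  | not (b : Test)
  | and (b b' : Test)

/-- Programs. -/
inductive Program : Type
  | skip
  | setInt (x : ℕ) (e : IntExp)
  | putInt (a : ℕ) (i e : IntExp)
  | setReal (x : ℕ) (e : RealExp)
  | putReal (a : ℕ) (i : IntExp) (e : RealExp)
  | seq (p q : Program)
  | ite (b : Test) (p q : Program)
  | loop (b : Test) (p : Program)

/-- A memory state: the contents of the variables and of the cells of the arrays. -/
structure State where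
  intVar : ℕ → ℕ
  realVar : ℕ → ℝ
  intArr : ℕ → ℕ → ℕ
  realArr : ℕ → ℕ → ℝ

/-- The value of an integer expression (subtraction is truncated at `0`). -/
def IntExp.eval (s : State) : IntExp → ℕ
  | .lit k => k
  | .var x => s.intVar x
  | .get a i => s.intArr a (i.eval s)
  | .add e f => e.eval s + f.eval s
  | .sub e f => e.eval s - f.eval s

/-- The time needed to evaluate an integer expression. -/
def IntExp.cost : IntExp → ℕ
  | .lit _ => 1
  | .var _ => 1
  | .get _ i => i.cost + 1
  | .add e f => e.cost + f.cost + 1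
  | .sub e f => e.cost + f.cost + 1

/-- The value of a real expression on the input `d` (a quotient by `0` is `0`). -/
noncomputable def RealExp.eval (d : ℕ → ℕ → ℝ) (s : State) : RealExp → ℝ
  | .lit k => (k : ℝ)
  | .var x => s.realVar x
  | .get a i => s.realArr a (i.eval s)
  | .query i j => d (i.eval s) (j.eval s)
  | .add e f => e.eval d s + f.eval d s
  | .sub e f => e.eval d s - f.eval d s
  | .mul e f => e.eval d s * f.eval d s
  | .div e f => e.eval d s / f.eval d s

/-- The time needed to evaluate a real expression. -/
def RealExp.cost : RealExp → ℕ
  | .lit _ => 1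
  | .var _ => 1
  | .get _ i => i.cost + 1
  | .query i j => i.cost + j.cost + 1
  | .add e f => e.cost + f.cost + 1
  | .sub e f => e.cost + f.cost + 1
  | .mul e f => e.cost + f.cost + 1
  | .div e f => e.cost + f.cost + 1

/-- The outcome of a test. -/
def Test.Holds (d : ℕ → ℕ → ℝ) (s : State) : Test → Prop
  | .intLE e f => e.eval s ≤ f.eval s
  | .realLE e f => e.eval d s ≤ f.eval d s
  | .not b => ¬ b.Holds d s
  | .and b b' => b.Holds d s ∧ b'.Holds d s

/-- The time needed to carry out a test. -/
def Test.cost : Test → ℕ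
  | .intLE e f => e.cost + f.cost + 1
  | .realLE e f => e.cost + f.cost + 1
  | .not b => b.cost + 1
  | .and b b' => b.cost + b'.cost + 1

/-- `f` with the value at `x` replaced by `v`. -/
def update {α : Type} (f : ℕ → α) (x : ℕ) (v : α) : ℕ → α :=
  fun y => if y = x then v else f y

/-- `Runs d p s s' t`: on the input `d`, the program `p` started in the state `s` halts in the
state `s'` after exactly `t` units of time. -/
inductive Runs (d : ℕ → ℕ → ℝ) : Program → State → State → ℕ → Prop
  | skip (s : State) : Runs d .skip s s 1
  | setInt (s : State) (x : ℕ) (e : IntExp) :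
      Runs d (.setInt x e) s { s with intVar := update s.intVar x (e.eval s) } (e.cost + 1)
  | putInt (s : State) (a : ℕ) (i e : IntExp) :
      Runs d (.putInt a i e) s
        { s with intArr := update s.intArr a (update (s.intArr a) (i.eval s) (e.eval s)) }
        (i.cost + e.cost + 1)
  | setReal (s : State) (x : ℕ) (e : RealExp) :
      Runs d (.setReal x e) s { s with realVar := update s.realVar x (e.eval d s) } (e.cost + 1)
  | putReal (s : State) (a : ℕ) (i : IntExp) (e : RealExp) :
      Runs d (.putReal a i e) s
        { s with realArr := update s.realArr a (update (s.realArr a) (i.eval s) (e.eval d s)) }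
        (i.cost + e.cost + 1)
  | seq {p q : Program} {s s' s'' : State} {t t' : ℕ} :
      Runs d p s s' t → Runs d q s' s'' t' → Runs d (.seq p q) s s'' (t + t')
  | iteTrue {b : Test} {p q : Program} {s s' : State} {t : ℕ} :
      b.Holds d s → Runs d p s s' t → Runs d (.ite b p q) s s' (b.cost + 1 + t)
  | iteFalse {b : Test} {p q : Program} {s s' : State} {t : ℕ} :
      ¬ b.Holds d s → Runs d q s s' t → Runs d (.ite b p q) s s' (b.cost + 1 + t)
  | loopTrue {b : Test} {p : Program} {s s' s'' : State} {t t' : ℕ} :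
      b.Holds d s → Runs d p s s' t → Runs d (.loop b p) s' s'' t' →
      Runs d (.loop b p) s s'' (b.cost + 1 + t + t')
  | loopFalse {b : Test} {p : Program} {s : State} :
      ¬ b.Holds d s → Runs d (.loop b p) s s (b.cost + 1)

/-- The initial state: the integer variable `0` holds the number `n` of sites, everything else
is `0`. -/
def initial (n : ℕ) : State where
  intVar := update (fun _ => 0) 0 n
  realVar := fun _ => 0
  intArr := fun _ _ => 0
  realArr := fun _ _ => 0

/-- The input of a program: the distance matrix of `n` points listed as `p 0, …, p (n - 1)`, extended
by `0` to other indices. -/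
noncomputable def distMatrix {X : Type*} [MetricSpace X] {n : ℕ} (p : Fin n → X) (i j : ℕ) : ℝ :=
  if h : i < n ∧ j < n then dist (p ⟨i, h.1⟩) (p ⟨j, h.2⟩) else 0

end RealRAM

/-!
# Optimal stars on a real RAM

A star with weights `c` is admissible iff `c ≥ 0` and `d u v ≤ c u + c v` for `u ≠ v`, and its
dilation is at most `t` iff `c u + c v ≤ t * d u v` for `u ≠ v`. Call `t` feasible if some `c`
satisfies both. The program finds the least feasible `t`, and then weights for it.

*Feasibility of a fixed `t`.* It is equivalent to allow different weights `x u` and `z v` in the two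
roles, `d u v ≤ x u + z v` for all `u, v` and `x u + z v ≤ t * d u v` for `u ≠ v`, since
`(x + z) / 2` then solves the original system. Elimination of `z` leaves constraints
`x w ≤ x u + arc u w`, which are solvable iff the complete digraph with the arc lengths `arc` has no
negative cycle. The algorithm of Floyd and Warshall decides this in time `O(n ^ 3)` and yields
potentials `x` (`feasible_iff_arcClosure`, `isStarWeight_starOfArcClosure`).

*The least feasible `t`.* It is found by parametric search in the style of Megiddo. A negative cycle
also shows up on the diagonal after `⌈log₂ n⌉` squarings of the matrix `arc` with respect to `min`
and `+` (`feasible_iff_squared`). The program carries out these squarings for the unknown optimum: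
it keeps an interval whose lower end is infeasible and whose upper end is feasible, inside of which
the entries of the current matrix are known linear functions of `t`. Each entry of the next matrix is
the minimum of `n` linear functions, and the interval is shrunk until a single one of them attains
it. After the last squaring the upper end of the interval is the optimum
(`not_feasible_of_linear`).

*Shrinking the interval.* One squaring involves `n ^ 2` groups of `n` lines. In a round of prune and
search, the lines of each group are paired up, a median of the crossings of these pairs is tested for
feasibility, and the interval is cut off there. At least half of the pairs then have no crossing
inside the interval and lose one of their lines. So the number of lines in excess of one per group
drops by a quarter (`IsEnvelope.length_prune_le`), and `O(log n)` rounds suffice. The tests take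
`O(n ^ 3 * log n)` time per squaring. The median is found by merge sort; as the number of crossings
decreases geometrically, sorting takes `O(n ^ 3 * log n)` time per squaring as well. With
`O(log n)` squarings, this is `O(n ^ 3 * log ^ 2 n)` altogether.

The programs are verified with total-correctness triples (`Halts`) that include a bound for the
running time. What a program does not assign to stays the same (`Runs.unchanged`), and whether it
assigns to a variable or an array is decided by evaluating a Boolean function.
-/

/-! ### Admissible stars as systems of linear inequalities -/

section Star

variable {V : Type*}

theorem WeightedGraph.pathDist_eq_of_forall {V : Type*} {G : WeightedGraph V} {x y : V} {r : ℝ}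
    (p : G.graph.Path x y) (h : ∀ p : G.graph.Walk x y, p.IsPath → G.length p = r) :
    G.pathDist x y = r := by
  have : Nonempty (G.graph.Path x y) := ⟨p⟩
  unfold WeightedGraph.pathDist
  rw [iInf_congr fun p : G.graph.Path x y => h p.1 p.2, ciInf_const]

theorem WeightedGraph.pathDist_self {V : Type*} (G : WeightedGraph V) (x : V) :
    G.pathDist x x = 0 := by
  refine G.pathDist_eq_of_forall SimpleGraph.Path.nil fun p hp => ?_
  cases p with
  | nil => simp [WeightedGraph.length]
  | cons h q => simp at hp

theorem WeightedGraph.length_nil {V : Type*} (G : WeightedGraph V) (x : V) :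
    G.length (.nil : G.graph.Walk x x) = 0 := by
  simp [WeightedGraph.length]

theorem WeightedGraph.length_cons {V : Type*} (G : WeightedGraph V) {x y z : V}
    (h : G.graph.Adj x y) (p : G.graph.Walk y z) :
    G.length (.cons h p) = G.weight s(x, y) + G.length p := by
  simp [WeightedGraph.length]

theorem weightedStar_adj_center (c : V → ℝ) (v : V) :
    (weightedStar c).graph.Adj none (some v) := by
  simp [weightedStar]

/-- A path in a star that starts at the center consists of a single edge: it could go on only
through the center. -/
theorem weightedStar_length_from_center (c : V → ℝ) (v : V)
    (p : (weightedStar c).graph.Walk none (some v)) (hp : p.IsPath) :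
    (weightedStar c).length p = c v := by
  cases p with
  | cons h q =>
    rename_i w
    have hw : w ≠ none := fun e => by subst e; exact (weightedStar c).graph.loopless.irrefl _ h
    obtain ⟨w, rfl⟩ := Option.ne_none_iff_exists'.1 hw
    cases q with
    | nil =>
      rw [WeightedGraph.length_cons, WeightedGraph.length_nil]
      simp [weightedStar]
    | cons h' r =>
      rename_i x
      have hx : x = none := by
        have := h'
        simp [weightedStar] at this
        exact this.2
      subst hx
      simp [SimpleGraph.Walk.cons_isPath_iff] at hp

theorem weightedStar_pathDist_center (c : V → ℝ) (v : V) :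
    (weightedStar c).pathDist none (some v) = c v :=
  WeightedGraph.pathDist_eq_of_forall (.singleton (weightedStar_adj_center c v))
    (weightedStar_length_from_center c v)

theorem weightedStar_pathDist_comm (c : V → ℝ) (x y : Option V) :
    (weightedStar c).pathDist x y = (weightedStar c).pathDist y x := by
  unfold WeightedGraph.pathDist
  refine Equiv.iInf_congr
    ⟨fun p => p.reverse, fun p => p.reverse, fun p => ?_, fun p => ?_⟩ fun p => ?_
  · ext; simp [SimpleGraph.Path.reverse]
  · ext; simp [SimpleGraph.Path.reverse]
  · simp [WeightedGraph.length, SimpleGraph.Path.reverse]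

theorem weightedStar_pathDist_leaves (c : V → ℝ) {u v : V} (huv : u ≠ v) :
    (weightedStar c).pathDist (some u) (some v) = c u + c v := by
  have hu := (weightedStar_adj_center c u).symm
  have hv := weightedStar_adj_center c v
  refine WeightedGraph.pathDist_eq_of_forall
    ⟨.cons hu (.cons hv .nil), by simp [SimpleGraph.Walk.cons_isPath_iff, huv]⟩ fun p hp => ?_
  cases p with
  | nil => exact absurd rfl huv
  | cons h q =>
    rename_i w
    have hw : w = none := by
      have := h
      simp [weightedStar] at this
      exact this.2
    subst hw
    have := weightedStar_length_from_center c v q (SimpleGraph.Walk.IsPath.of_cons hp)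
    rw [WeightedGraph.length_cons, this]
    simp [weightedStar]

variable [MetricSpace V]

theorem isAdmissibleStar_iff (c : V → ℝ) :
    IsAdmissibleStar c ↔ (∀ v, 0 ≤ c v) ∧ ∀ u v, u ≠ v → dist u v ≤ c u + c v := by
  have leaf := fun (u v : V) (h : u ≠ v) => weightedStar_pathDist_leaves c h
  have ctr := weightedStar_pathDist_center c
  have ctr' : ∀ v, (weightedStar c).pathDist (some v) none = c v := fun v => by
    rw [weightedStar_pathDist_comm, ctr]
  have slf := (weightedStar c).pathDist_self
  constructor
  · rintro ⟨h1, -, h3⟩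
    refine ⟨fun v => ?_, fun u v huv => ?_⟩
    · have := h3 none (some v) none
      rw [slf, ctr, ctr'] at this
      linarith
    · simpa [leaf u v huv] using h1 u v
  · rintro ⟨h0, h1⟩
    refine ⟨fun x y => ?_, weightedStar_pathDist_comm c, ?_⟩
    · by_cases hxy : x = y
      · subst hxy; simp [slf]
      · rw [leaf x y hxy]; exact h1 x y hxy
    · rintro (_ | x) (_ | y) (_ | z)
      · simp [slf]
      · simp [slf]
      · simp only [slf, ctr, ctr']; linarith [h0 y]
      · rcases eq_or_ne y z with rfl | h
        · simp [slf]
        · simp only [ctr, leaf y z h]; linarith [h0 y]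
      · simp [slf]
      · rcases eq_or_ne x z with rfl | h
        · simp only [slf, ctr, ctr']; linarith [h0 x]
        · simp only [ctr, ctr', leaf x z h]; linarith [h0 x]
      · rcases eq_or_ne x y with rfl | h
        · simp [slf]
        · simp only [ctr', leaf x y h]; linarith [h0 y]
      · rcases eq_or_ne x z with rfl | hxz
        · rw [slf, weightedStar_pathDist_comm c (some y)]
          rcases eq_or_ne x y with rfl | hxy
          · simp [slf]
          · rw [leaf x y hxy]; linarith [h0 x, h0 y]
        rcases eq_or_ne x y with rfl | hxy
        · simp [slf]
        rcases eq_or_ne y z with rfl | hyz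
        · simp [slf]
        · rw [leaf x y hxy, leaf x z hxz, leaf y z hyz]; linarith [h0 y]

theorem dilation_weightedStar_le [Finite V] (c : V → ℝ) (t : ℝ) (ht : 0 ≤ t)
    (h : ∀ u v, u ≠ v → c u + c v ≤ t * dist u v) : dilation (weightedStar c) some ≤ t := by
  refine Real.iSup_le (fun p => ?_) ht
  rw [weightedStar_pathDist_leaves c p.2, div_le_iff₀ (dist_pos.2 p.2)]
  exact h _ _ p.2

theorem le_dilation_weightedStar [Finite V] (c : V → ℝ) {u v : V} (huv : u ≠ v) :
    c u + c v ≤ dilation (weightedStar c) some * dist u v := by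
  rw [← div_le_iff₀ (dist_pos.2 huv), ← weightedStar_pathDist_leaves c huv]
  exact le_ciSup (f := fun p : {p : V × V // p.1 ≠ p.2} =>
    (weightedStar c).pathDist (some p.1.1) (some p.1.2) / dist p.1.1 p.1.2)
    (Set.finite_range _).bddAbove ⟨(u, v), huv⟩

theorem dilation_weightedStar_of_subsingleton [Subsingleton V] (c : V → ℝ) :
    dilation (weightedStar c) some = 0 := by
  have : IsEmpty {p : V × V // p.1 ≠ p.2} := ⟨fun p => p.2 (Subsingleton.elim _ _)⟩
  exact Real.iSup_of_isEmpty _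

end Star

/-! ### Feasible dilations as a shortest path problem -/

section ShortestPaths

/-- On the indices below `n`, the matrix `d` is symmetric, zero on the diagonal and
positive elsewhere. -/
structure IsDistMatrix (d : ℕ → ℕ → ℝ) (n : ℕ) : Prop where
  diag : ∀ i < n, d i i = 0
  symm : ∀ i < n, ∀ j < n, d i j = d j i
  pos : ∀ i < n, ∀ j < n, i ≠ j → 0 < d i j

/-- `c` gives the edge weights of an admissible star whose dilation is at most `t`. -/
def IsStarWeight (d : ℕ → ℕ → ℝ) (n : ℕ) (t : ℝ) (c : ℕ → ℝ) : Prop :=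
  (∀ u < n, 0 ≤ c u) ∧
    ∀ u < n, ∀ v < n, u ≠ v → d u v ≤ c u + c v ∧ c u + c v ≤ t * d u v

/-- Some admissible star has dilation at most `t`. -/
def Feasible (d : ℕ → ℕ → ℝ) (n : ℕ) (t : ℝ) : Prop :=
  ∃ c, IsStarWeight d n t c

/-- The minimum of `r` and `f 0, …, f (n - 1)`. -/
noncomputable def minFrom (r : ℝ) (f : ℕ → ℝ) : ℕ → ℝ
  | 0 => r
  | k + 1 => min (minFrom r f k) (f k)

theorem minFrom_le_left (r : ℝ) (f : ℕ → ℝ) (n : ℕ) : minFrom r f n ≤ r := by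
  induction n with
  | zero => exact le_rfl
  | succ n ih => exact (min_le_left _ _).trans ih

theorem minFrom_le (r : ℝ) (f : ℕ → ℝ) {n k : ℕ} (hk : k < n) : minFrom r f n ≤ f k := by
  induction n with
  | zero => omega
  | succ n ih =>
    rcases Nat.lt_succ_iff_lt_or_eq.1 hk with h | rfl
    · exact (min_le_left _ _).trans (ih h)
    · exact min_le_right _ _

theorem minFrom_eq (r : ℝ) (f : ℕ → ℝ) (n : ℕ) :
    minFrom r f n = r ∨ ∃ k < n, minFrom r f n = f k := by
  induction n with
  | zero => exact .inl rfl
  | succ n ih =>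
    simp only [minFrom]
    rcases min_choice (minFrom r f n) (f n) with h | h
    · rw [h]
      exact ih.imp_right fun ⟨k, hk, e⟩ => ⟨k, by omega, e⟩
    · exact .inr ⟨n, by omega, h⟩

theorem continuous_minFrom {r : ℝ → ℝ} {f : ℝ → ℕ → ℝ} (hr : Continuous r)
    (hf : ∀ k, Continuous fun t => f t k) (n : ℕ) :
    Continuous fun t => minFrom (r t) (f t) n := by
  induction n with
  | zero => exact hr
  | succ n ih => exact ih.min (hf n)

/-- The bound that the constraints `x u + z v ≥ d u v` and `x w + z v ≤ t * d w v` (for `v ≠ w`)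
put on `x w - x u`. The site `v = w` gives no such bound; there, the bound of `v = u` is repeated,
which is `0` if `u = w`. -/
noncomputable def arcVia (d : ℕ → ℕ → ℝ) (t : ℝ) (u w v : ℕ) : ℝ :=
  if v = w then t * d w u else t * d w v - d v u

/-- The least of the upper bounds `arcVia` on `x w - x u`. -/
noncomputable def arc (d : ℕ → ℕ → ℝ) (n : ℕ) (t : ℝ) (u w : ℕ) : ℝ :=
  minFrom (t * d w u) (arcVia d t u w) n

variable {d : ℕ → ℕ → ℝ} {n : ℕ} {t : ℝ}

theorem arc_eq {u w : ℕ} (hw : w < n) : ∃ v < n, arc d n t u w = arcVia d t u w v := by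
  rcases minFrom_eq (t * d w u) (arcVia d t u w) n with h | h
  · exact ⟨w, hw, by rw [arc, h, arcVia, if_pos rfl]⟩
  · exact h

theorem arc_le {u w v : ℕ} (hv : v < n) (hvw : v ≠ w) : arc d n t u w ≤ t * d w v - d v u := by
  have := minFrom_le (t * d w u) (arcVia d t u w) hv
  rwa [arcVia, if_neg hvw] at this

theorem arc_self_le (hd : IsDistMatrix d n) {u : ℕ} (hu : u < n) : arc d n t u u ≤ 0 := by
  have := minFrom_le_left (t * d u u) (arcVia d t u u) n
  rw [hd.diag u hu, mul_zero] at this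
  simpa [arc, hd.diag u hu] using this

/-- Star weights are potentials for the arc lengths `arc`, so these have no negative cycle. -/
theorem IsStarWeight.sub_le_arc (hd : IsDistMatrix d n) {c : ℕ → ℝ} (hc : IsStarWeight d n t c)
    {u w : ℕ} (hu : u < n) (hw : w < n) : c w - c u ≤ arc d n t u w := by
  have low : ∀ u < n, ∀ v < n, d u v ≤ c u + c v := by
    intro u hu v hv
    by_cases h : u = v
    · subst h; rw [hd.diag u hu]; linarith [hc.1 u hu]
    · exact (hc.2 u hu v hv h).1
  obtain ⟨v, hv, e⟩ := arc_eq (d := d) (t := t) (u := u) hw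
  rw [e, arcVia]
  split_ifs with h
  · subst h
    by_cases huv : u = v
    · subst huv; rw [hd.diag u hu]; simp
    · have := (hc.2 v hv u hu (Ne.symm huv)).2
      have := hc.1 u hu
      linarith
  · have h1 := (hc.2 w hw v hv (Ne.symm h)).2
    have h2 := low v hv u hu
    linarith

/-- The weights read off potentials `x` whose differences obey the bounds `arc`. -/
theorem isStarWeight_of_potential (hd : IsDistMatrix d n) {x z : ℕ → ℝ}
    (hx : ∀ u < n, ∀ w < n, x w ≤ x u + arc d n t u w)
    (hz : ∀ v < n, ∀ u < n, d u v - x u ≤ z v)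
    (hz' : ∀ v < n, ∃ u < n, z v = d u v - x u) :
    IsStarWeight d n t (fun v => (x v + z v) / 2) := by
  have up : ∀ u < n, ∀ v < n, u ≠ v → x u + z v ≤ t * d u v := by
    intro u hu v hv huv
    obtain ⟨w, hw, e⟩ := hz' v hv
    have h1 := hx w hw u hu
    have h2 := arc_le (d := d) (t := t) (u := w) hv (Ne.symm huv)
    rw [hd.symm v hv w hw] at h2
    linarith
  refine ⟨fun u hu => ?_, fun u hu v hv huv => ⟨?_, ?_⟩⟩
  · have := hz u hu u hu
    rw [hd.diag u hu] at this
    simp only; linarith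
  · have h1 := hz u hu v hv
    have h2 := hz v hv u hu
    rw [hd.symm v hv u hu] at h1
    simp only; linarith
  · have h1 := up u hu v hv huv
    have h2 := up v hv u hu (Ne.symm huv)
    rw [hd.symm v hv u hu] at h2
    simp only; linarith

theorem Feasible.mono (hd : IsDistMatrix d n) {t' : ℝ} (h : Feasible d n t) (htt : t ≤ t') :
    Feasible d n t' := by
  obtain ⟨c, h0, h1⟩ := h
  refine ⟨c, h0, fun u hu v hv huv => ⟨(h1 u hu v hv huv).1, (h1 u hu v hv huv).2.trans ?_⟩⟩
  exact mul_le_mul_of_nonneg_right htt (hd.pos u hu v hv huv).le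

theorem not_feasible_zero (hd : IsDistMatrix d n) (hn : 2 ≤ n) : ¬ Feasible d n 0 := by
  rintro ⟨c, -, h⟩
  have h1 := h 0 (by omega) 1 (by omega) (by omega)
  have := hd.pos 0 (by omega) 1 (by omega) (by omega)
  linarith [h1.1, h1.2]

/-! ### Walks and the algorithm of Floyd and Warshall -/

/-- `WalkWeight W n i j r`: some walk with at least one arc from `i` to `j` in the complete digraph
on the vertices below `n` with arc weights `W` has total weight `r`. -/
inductive WalkWeight (W : ℕ → ℕ → ℝ) (n : ℕ) : ℕ → ℕ → ℝ → Prop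
  | arc {i j : ℕ} : i < n → j < n → WalkWeight W n i j (W i j)
  | trans {i j k : ℕ} {a b : ℝ} :
      WalkWeight W n i j a → WalkWeight W n j k b → WalkWeight W n i k (a + b)

theorem WalkWeight.sub_le {W : ℕ → ℕ → ℝ} {x : ℕ → ℝ}
    (hx : ∀ u < n, ∀ w < n, x w - x u ≤ W u w) {i j : ℕ} {r : ℝ} (h : WalkWeight W n i j r) :
    x j - x i ≤ r := by
  induction h with
  | arc hi hj => exact hx _ hi _ hj
  | trans _ _ ih1 ih2 => linarith

theorem WalkWeight.exists_seq {W : ℕ → ℕ → ℝ} {i j : ℕ} {r : ℝ} (h : WalkWeight W n i j r) :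
    ∃ (m : ℕ) (p : ℕ → ℕ), 0 < m ∧ p 0 = i ∧ p m = j ∧ (∀ x, p x < n) ∧
      ∑ x ∈ Finset.range m, W (p x) (p (x + 1)) = r := by
  induction h with
  | @arc i j hi hj =>
    refine ⟨1, fun x => if x = 0 then i else j, by omega, by simp, by simp, fun x => ?_, by simp⟩
    dsimp only; split_ifs <;> assumption
  | trans _ _ ih1 ih2 =>
    obtain ⟨m, p, hm, hp0, hpm, hpn, hp⟩ := ih1
    obtain ⟨l, q, hl, hq0, hql, hqn, hq⟩ := ih2
    refine ⟨m + l, fun x => if x < m then p x else q (x - m), by omega, ?_, ?_, ?_, ?_⟩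
    · simp [hm, hp0]
    · simp [hql]
    · intro x; dsimp only; split_ifs <;> simp [hpn, hqn]
    · rw [Finset.sum_range_add, ← hp, ← hq]
      congr 1
      · refine Finset.sum_congr rfl fun x hx => ?_
        have hx := Finset.mem_range.1 hx
        simp only [hx, if_true]
        split_ifs with h
        · rfl
        · have : x + 1 = m := by omega
          rw [this, hpm, ← hq0, Nat.sub_self]
      · refine Finset.sum_congr rfl fun x _ => ?_
        simp [show ¬ m + x + 1 < m by omega, show m + x + 1 - m = x + 1 by omega]

/-- A closed walk of negative weight contains one with at most `n` arcs: a longer one repeats a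
vertex, and one of the two closed walks it splits into is negative again. -/
theorem exists_short_negative_closed {W : ℕ → ℕ → ℝ} {m : ℕ} {p : ℕ → ℕ} (hp : p m = p 0)
    (hpn : ∀ x, p x < n) (hneg : ∑ x ∈ Finset.range m, W (p x) (p (x + 1)) < 0) :
    ∃ (m : ℕ) (p : ℕ → ℕ), m ≤ n ∧ p m = p 0 ∧ (∀ x, p x < n) ∧
      ∑ x ∈ Finset.range m, W (p x) (p (x + 1)) < 0 := by
  induction m using Nat.strong_induction_on generalizing p with
  | _ m ih =>
    rcases le_or_gt m n with hmn | hmn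
    · exact ⟨m, p, hmn, hp, hpn, hneg⟩
    obtain ⟨a, ha, b, hb, hab, e⟩ := Finset.exists_ne_map_eq_of_card_lt_of_maps_to
      (s := Finset.range m) (t := Finset.range n) (by simpa using hmn) (f := p)
      (fun x _ => by simpa using hpn x)
    rw [Finset.mem_range] at ha hb
    wlog hlt : a < b generalizing a b with H
    · exact H b hb a ha hab.symm e.symm (by omega)
    obtain ⟨l, rfl⟩ := Nat.exists_eq_add_of_lt hlt
    obtain ⟨k, rfl⟩ := Nat.exists_eq_add_of_lt hb
    have key : ∑ x ∈ Finset.range (l + 1), W (p (a + x)) (p (a + (x + 1))) +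
        ∑ x ∈ Finset.range (a + (k + 1)), W (if x ≤ a then p x else p (x + (l + 1)))
          (if x + 1 ≤ a then p (x + 1) else p (x + 1 + (l + 1))) < 0 := by
      have e1 : a + l + 1 + k + 1 = a + ((l + 1) + (k + 1)) := by ring
      rw [e1, Finset.sum_range_add, Finset.sum_range_add] at hneg
      rw [Finset.sum_range_add _ a (k + 1), add_left_comm]
      refine lt_of_eq_of_lt ?_ hneg
      congr 1
      · refine Finset.sum_congr rfl fun x hx => ?_
        have hx := Finset.mem_range.1 hx
        rw [if_pos hx.le, if_pos (by omega)]
      · congr 1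
        refine Finset.sum_congr rfl fun x hx => ?_
        rw [if_neg (by omega : ¬ a + x + 1 ≤ a)]
        congr 1
        · split_ifs with h
          · have : x = 0 := by omega
            subst this
            exact e
          · congr 1; omega
        · congr 1; omega
    rcases lt_or_ge (∑ x ∈ Finset.range (l + 1), W (p (a + x)) (p (a + (x + 1)))) 0 with h | h
    · exact ih (l + 1) (by omega) (p := fun x => p (a + x))
        (by simpa [add_assoc] using e.symm) (fun x => hpn _) h
    · refine ih (a + (k + 1)) (by omega) (p := fun x => if x ≤ a then p x else p (x + (l + 1)))
        ?_ (fun x => ?_) (by linarith)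
      · rw [if_neg (by omega), if_pos (by omega), ← hp]
        congr 1; omega
      · split_ifs <;> exact hpn _

/-- One step of the algorithm of Floyd and Warshall: allow `k` as an intermediate vertex. -/
noncomputable def floydStep (k : ℕ) (M : ℕ → ℕ → ℝ) (i j : ℕ) : ℝ :=
  min (M i j) (M i k + M k j)

/-- The matrix after the first `k` steps of the algorithm of Floyd and Warshall. -/
noncomputable def floyd (W : ℕ → ℕ → ℝ) : ℕ → ℕ → ℕ → ℝ
  | 0 => W
  | k + 1 => floydStep k (floyd W k)

theorem floyd_antitone (W : ℕ → ℕ → ℝ) {k l : ℕ} (h : k ≤ l) (i j : ℕ) :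
    floyd W l i j ≤ floyd W k i j := by
  induction l, h using Nat.le_induction with
  | base => exact le_rfl
  | succ l _ ih => exact (min_le_left _ _).trans ih

theorem walkWeight_floyd (W : ℕ → ℕ → ℝ) {k : ℕ} (hk : k ≤ n) {i j : ℕ} (hi : i < n)
    (hj : j < n) : WalkWeight W n i j (floyd W k i j) := by
  induction k generalizing i j with
  | zero => exact .arc hi hj
  | succ k ih =>
    simp only [floyd, floydStep]
    rcases min_choice (floyd W k i j) (floyd W k i k + floyd W k k j) with h | h <;> rw [h]
    · exact ih (by omega) hi hj
    · exact (ih (by omega) hi (by omega)).trans (ih (by omega) (by omega) hj)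

/-- Without negative entries on the diagonal, the matrix after `k` steps obeys the triangle
inequality for all intermediate vertices below `k`. This is preserved directly by each step, without
reference to paths. -/
theorem floyd_triangle {W : ℕ → ℕ → ℝ} {k : ℕ} (hk : k ≤ n)
    (hdiag : ∀ i < n, 0 ≤ floyd W k i i) {i j m : ℕ} (hm : m < k) :
    floyd W k i j ≤ floyd W k i m + floyd W k m j := by
  induction k generalizing i j m with
  | zero => omega
  | succ k ih =>
    have hdiag' : ∀ i < n, 0 ≤ floyd W k i i := fun i hi =>
      (hdiag i hi).trans (floyd_antitone W (Nat.le_succ k) i i)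
    have hkk := hdiag' k (by omega)
    have tri := fun (i j m : ℕ) (h : m < k) => ih (by omega) hdiag' (i := i) (j := j) h
    simp only [floyd, floydStep]
    rcases Nat.lt_succ_iff_lt_or_eq.1 hm with h | rfl
    · rcases min_choice (floyd W k i m) (floyd W k i k + floyd W k k m) with h1 | h1 <;>
      rcases min_choice (floyd W k m j) (floyd W k m k + floyd W k k j) with h2 | h2 <;>
      rw [h1, h2]
      · exact (min_le_left _ _).trans (tri i j m h)
      · exact (min_le_right _ _).trans (by linarith [tri i k m h])
      · exact (min_le_right _ _).trans (by linarith [tri k j m h])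
      · exact (min_le_right _ _).trans (by linarith [tri k k m h])
    · rw [min_eq_left (by linarith : floyd W m i m ≤ floyd W m i m + floyd W m m m),
        min_eq_left (by linarith : floyd W m m j ≤ floyd W m m m + floyd W m m j)]
      exact min_le_right _ _

/-- The matrix that the feasibility test computes. -/
noncomputable def arcClosure (d : ℕ → ℕ → ℝ) (n : ℕ) (t : ℝ) : ℕ → ℕ → ℝ :=
  floyd (arc d n t) n

/-- The edge weights `(x v + z v) / 2` for the potentials `x v` in row `0` of the closed matrix and
`z v`, the maximum of `d u v - x u` over `u`, which is written as the negative of a minimum. -/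
noncomputable def starOfArcClosure (d : ℕ → ℕ → ℝ) (n : ℕ) (t : ℝ) (v : ℕ) : ℝ :=
  (arcClosure d n t 0 v - minFrom (arcClosure d n t 0 0 - d 0 v)
    (fun u => arcClosure d n t 0 u - d u v) n) / 2

theorem isStarWeight_starOfArcClosure (hd : IsDistMatrix d n)
    (h : ∀ i < n, 0 ≤ arcClosure d n t i i) : IsStarWeight d n t (starOfArcClosure d n t) := by
  have := isStarWeight_of_potential (t := t) hd (x := arcClosure d n t 0)
    (z := fun v => - minFrom (arcClosure d n t 0 0 - d 0 v) (fun u => arcClosure d n t 0 u - d u v) n)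
    (fun u hu w hw => ?_) (fun v hv u hu => ?_) (fun v hv => ?_)
  · exact this
  · have h1 := floyd_triangle le_rfl h (i := 0) (j := w) hu
    have h2 := floyd_antitone (arc d n t) (Nat.zero_le n) u w
    exact h1.trans (add_le_add_right h2 _)
  · have := minFrom_le (arcClosure d n t 0 0 - d 0 v) (fun u => arcClosure d n t 0 u - d u v) hu
    linarith
  · rcases minFrom_eq (arcClosure d n t 0 0 - d 0 v) (fun u => arcClosure d n t 0 u - d u v) n with
      e | ⟨u, hu, e⟩
    · exact ⟨0, by omega, by simp only [e]; ring⟩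
    · exact ⟨u, hu, by simp only [e]; ring⟩

theorem Feasible.nonneg_of_walkWeight (hd : IsDistMatrix d n) (h : Feasible d n t) {i : ℕ} {r : ℝ}
    (hw : WalkWeight (arc d n t) n i i r) : 0 ≤ r := by
  obtain ⟨c, hc⟩ := h
  simpa using hw.sub_le fun u hu w hw => hc.sub_le_arc hd hu hw

theorem feasible_iff_arcClosure (hd : IsDistMatrix d n) :
    Feasible d n t ↔ ∀ i < n, 0 ≤ arcClosure d n t i i :=
  ⟨fun h _ hi => h.nonneg_of_walkWeight hd (walkWeight_floyd _ le_rfl hi hi),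
    fun h => ⟨_, isStarWeight_starOfArcClosure hd h⟩⟩

/-! ### Repeated squaring with a parameter -/

/-- The `k`-fold square of the matrix `arc`, in the sense of `min` and `+`. -/
noncomputable def squared (d : ℕ → ℕ → ℝ) (n : ℕ) (t : ℝ) : ℕ → ℕ → ℕ → ℝ
  | 0 => arc d n t
  | k + 1 => fun u w => minFrom (squared d n t k u u + squared d n t k u w)
      (fun v => squared d n t k u v + squared d n t k v w) n

theorem squared_succ_le (k : ℕ) {u w v : ℕ} (hv : v < n) :
    squared d n t (k + 1) u w ≤ squared d n t k u v + squared d n t k v w :=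
  minFrom_le _ (fun v => squared d n t k u v + squared d n t k v w) hv

theorem squared_succ_eq (k : ℕ) {u w : ℕ} (hu : u < n) :
    ∃ v < n, squared d n t (k + 1) u w = squared d n t k u v + squared d n t k v w :=
  (minFrom_eq _ (fun v => squared d n t k u v + squared d n t k v w) n).elim
    (fun h => ⟨u, hu, h⟩) id

theorem continuous_squared (k u w : ℕ) : Continuous fun t => squared d n t k u w := by
  induction k generalizing u w with
  | zero =>
    refine continuous_minFrom (by fun_prop) (fun v => ?_) n
    unfold arcVia
    split_ifs <;> fun_prop
  | succ k ih => exact continuous_minFrom ((ih _ _).add (ih _ _)) (fun v => (ih _ _).add (ih _ _)) n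

theorem walkWeight_squared (k : ℕ) {u w : ℕ} (hu : u < n) (hw : w < n) :
    WalkWeight (arc d n t) n u w (squared d n t k u w) := by
  induction k generalizing u w with
  | zero => exact .arc hu hw
  | succ k ih =>
    obtain ⟨v, hv, e⟩ := squared_succ_eq (d := d) (t := t) k (w := w) hu
    rw [e]
    exact (ih hu hv).trans (ih hv hw)

theorem squared_self_le (hd : IsDistMatrix d n) (k : ℕ) {u : ℕ} (hu : u < n) :
    squared d n t k u u ≤ 0 := by
  induction k with
  | zero => exact arc_self_le hd hu
  | succ k ih => linarith [squared_succ_le (d := d) (t := t) k (u := u) (w := u) hu]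

/-- The `k`-fold square is at most the weight of any walk with at most `2 ^ k` arcs. Shorter walks
are covered because the diagonal is not positive. -/
theorem squared_le_sum (hd : IsDistMatrix d n) (k : ℕ) {p : ℕ → ℕ} (hp : ∀ x, p x < n) {l : ℕ}
    (hl : l ≤ 2 ^ k) : squared d n t k (p 0) (p l) ≤
      ∑ x ∈ Finset.range l, arc d n t (p x) (p (x + 1)) := by
  induction k generalizing l p with
  | zero =>
    rcases Nat.le_one_iff_eq_zero_or_eq_one.1 (by simpa using hl) with rfl | rfl
    · simpa using squared_self_le hd 0 (hp 0)
    · simp [squared]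
  | succ k ih =>
    obtain ⟨a, b, rfl, ha, hb⟩ : ∃ a b, l = a + b ∧ a ≤ 2 ^ k ∧ b ≤ 2 ^ k :=
      ⟨min l (2 ^ k), l - min l (2 ^ k), by omega, by omega, by rw [pow_succ] at hl; omega⟩
    have h1 := ih hp ha
    have h2 := ih (p := fun x => p (a + x)) (fun x => hp _) hb
    rw [Finset.sum_range_add]
    exact (squared_succ_le k (hp a)).trans (add_le_add h1 h2)

/-- If `t` is infeasible, then the closure has a negative entry on its diagonal, hence there is a
closed walk of negative weight, hence one with at most `n ≤ 2 ^ k` arcs. -/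
theorem feasible_iff_squared (hd : IsDistMatrix d n) {k : ℕ} (hk : n ≤ 2 ^ k) :
    Feasible d n t ↔ ∀ i < n, squared d n t k i i = 0 := by
  refine ⟨fun h i hi => le_antisymm (squared_self_le hd k hi)
    (h.nonneg_of_walkWeight hd (walkWeight_squared k hi hi)), fun h => ?_⟩
  rw [feasible_iff_arcClosure hd]
  intro i hi
  by_contra! hneg
  obtain ⟨m, p, -, hp0, hpm, hpn, hsum⟩ :=
    (walkWeight_floyd (arc d n t) le_rfl hi hi).exists_seq
  obtain ⟨m, p, hm, hpm, hpn, hneg⟩ :=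
    exists_short_negative_closed (hpm.trans hp0.symm) hpn (hsum.trans_lt hneg)
  have := squared_le_sum (t := t) hd k hpn (hm.trans hk)
  rw [hpm, h _ (hpn 0)] at this
  linarith

/-- Parametric search ends with the optimum: if no breakpoint of the iterated squares is left between
an infeasible value `lo` and a feasible value `hi`, then `hi` is the least feasible value. For a
feasible value in between would make the diagonal, which is linear there, vanish on the whole
interval and, by continuity, at `lo`. -/
theorem not_feasible_of_linear (hd : IsDistMatrix d n) {k : ℕ} (hk : n ≤ 2 ^ k) {lo hi : ℝ}
    (hlo : ¬ Feasible d n lo)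
    (hlin : ∀ i < n, ∃ a b : ℝ, ∀ t ∈ Set.Ioo lo hi, squared d n t k i i = a + b * t)
    {t : ℝ} (ht : t < hi) : ¬ Feasible d n t := by
  intro hf
  have hlt : lo < t := by
    by_contra! h
    exact hlo (hf.mono hd h)
  apply hlo
  rw [feasible_iff_squared hd hk]
  intro i hi'
  obtain ⟨a, b, hab⟩ := hlin i hi'
  have h1 := (feasible_iff_squared hd hk).1 hf i hi'
  have h2 := (feasible_iff_squared hd hk).1
    (hf.mono hd (by linarith : t ≤ (t + hi) / 2)) i hi'
  rw [hab t ⟨hlt, ht⟩] at h1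
  rw [hab _ ⟨by linarith, by linarith⟩] at h2
  have hb : b = 0 := by
    have : b * ((t + hi) / 2 - t) = 0 := by linarith
    rcases mul_eq_zero.1 this with h | h
    · exact h
    · linarith
  have ha : a = 0 := by simpa [hb] using h1
  have hev : (fun t => squared d n t k i i) =ᶠ[nhdsWithin lo (Set.Ioi lo)] fun _ => 0 := by
    filter_upwards [Ioo_mem_nhdsGT (hlt.trans ht)] with s hs
    rw [hab s hs, ha, hb]; ring
  exact tendsto_nhds_unique
    ((continuous_squared k i i).continuousAt.tendsto.mono_left nhdsWithin_le_nhds)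
    ((Filter.tendsto_congr' hev).2 tendsto_const_nhds)

end ShortestPaths

/-- A feasible value: the star all of whose weights are the sum `s` of all distances has the ratio
`2 * s / d i j` at the pair `(i, j)`, and these ratios are summed up. (The diagonal contributes `0`,
since a quotient by `0` is `0`.) -/
noncomputable def trivialBound (d : ℕ → ℕ → ℝ) (n : ℕ) : ℝ :=
  ∑ i ∈ Finset.range n, ∑ j ∈ Finset.range n,
    2 * (∑ i ∈ Finset.range n, ∑ j ∈ Finset.range n, d i j) / d i j

theorem IsDistMatrix.nonneg {d : ℕ → ℕ → ℝ} {n : ℕ} (hd : IsDistMatrix d n) {i j : ℕ} (hi : i < n)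
    (hj : j < n) : 0 ≤ d i j := by
  by_cases h : i = j
  · subst h; rw [hd.diag i hi]
  · exact (hd.pos i hi j hj h).le

theorem le_sum_sum_range {f : ℕ → ℕ → ℝ} {n : ℕ} (hf : ∀ i < n, ∀ j < n, 0 ≤ f i j) {i j : ℕ}
    (hi : i < n) (hj : j < n) : f i j ≤ ∑ i ∈ Finset.range n, ∑ j ∈ Finset.range n, f i j := by
  have h1 : f i j ≤ ∑ j ∈ Finset.range n, f i j :=
    Finset.single_le_sum (f := fun j => f i j) (fun j hj => hf i hi j (Finset.mem_range.1 hj))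
      (Finset.mem_range.2 hj)
  exact h1.trans (Finset.single_le_sum (f := fun i => ∑ j ∈ Finset.range n, f i j)
    (fun i hi => Finset.sum_nonneg fun j hj => hf i (Finset.mem_range.1 hi) j
      (Finset.mem_range.1 hj)) (Finset.mem_range.2 hi))

theorem feasible_trivialBound {d : ℕ → ℕ → ℝ} {n : ℕ} (hd : IsDistMatrix d n) :
    Feasible d n (trivialBound d n) := by
  set s := ∑ i ∈ Finset.range n, ∑ j ∈ Finset.range n, d i j with hs
  have hle : ∀ i < n, ∀ j < n, d i j ≤ s := fun i hi j hj =>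
    le_sum_sum_range (fun i hi j hj => hd.nonneg hi hj) hi hj
  have h0 : ∀ i < n, 0 ≤ s := fun i hi => (hd.nonneg hi hi).trans (hle i hi i hi)
  refine ⟨fun _ => s, h0, fun u hu v hv huv => ⟨?_, ?_⟩⟩
  · linarith [hle u hu v hv, h0 u hu]
  · have hp := hd.pos u hu v hv huv
    rw [← div_le_iff₀ hp, ← two_mul]
    exact le_sum_sum_range (f := fun i j => 2 * s / d i j)
      (fun i hi j hj => div_nonneg (by linarith [h0 i hi]) (hd.nonneg hi hj)) hu hv

/-! ### Lower envelopes of lines by prune and search -/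

/-- The graph of a linear function, one of the candidates for the minimum in its group. -/
structure Line where
  grp : ℕ
  icept : ℝ
  slope : ℝ

namespace Line

/-- The value at `t` of a linear function. -/
noncomputable def val (x : Line) (t : ℝ) : ℝ := x.icept + x.slope * t

/-- The place where two lines cross (and `0` if they are parallel). -/
noncomputable def crossing (x y : Line) : ℝ := (y.icept - x.icept) / (x.slope - y.slope)

/-- Two lines do not change their order where they do not cross. -/
theorem val_le_val {x y : Line} {lo hi : ℝ} (h : crossing x y ≤ lo ∨ hi ≤ crossing x y) {s t : ℝ}
    (hs : s ∈ Set.Ioo lo hi) (ht : t ∈ Set.Ioo lo hi) (hle : x.val s ≤ y.val s) :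
    x.val t ≤ y.val t := by
  by_contra! hlt
  unfold val at hle hlt
  have hne : x.slope - y.slope ≠ 0 := by
    intro h0
    have : x.slope = y.slope := by linarith
    rw [this] at hle hlt
    linarith
  have hc : crossing x y * (x.slope - y.slope) = y.icept - x.icept := div_mul_cancel₀ _ hne
  set c := crossing x y
  have h1 : (x.slope - y.slope) * (s - c) ≤ 0 := by linarith
  have h2 : 0 < (x.slope - y.slope) * (t - c) := by linarith
  obtain ⟨hs1, hs2⟩ := hs
  obtain ⟨ht1, ht2⟩ := ht
  rcases h with h | h
  · have := (mul_pos_iff_of_pos_right (by linarith)).1 h2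
    have := mul_pos this (by linarith : 0 < s - c)
    linarith
  · have h3 : 0 < (y.slope - x.slope) * (c - t) := by linarith
    have := (mul_pos_iff_of_pos_right (by linarith)).1 h3
    have := mul_pos this (by linarith : 0 < c - s)
    linarith

open scoped Classical in
/-- What is left of a pair of lines in the same group: if they do not cross between `lo` and `hi`,
then only the one that is lower there. -/
noncomputable def survivors (lo hi : ℝ) (x y : Line) : List Line :=
  if crossing x y ≤ lo ∨ hi ≤ crossing x y then
    if x.val ((lo + hi) / 2) ≤ y.val ((lo + hi) / 2) then [x] else [y]
  else [x, y]

/-- The crossings of disjoint pairs of consecutive lines of the same group, chosen greedily. -/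
noncomputable def crossings : List Line → List ℝ
  | [] => []
  | [_] => []
  | x :: y :: l => if x.grp = y.grp then crossing x y :: crossings l else crossings (y :: l)

/-- The list without the lines that lose against their partner. The pairs are those
of `crossings`. -/
noncomputable def prune (lo hi : ℝ) : List Line → List Line
  | [] => []
  | [x] => [x]
  | x :: y :: l => if x.grp = y.grp then survivors lo hi x y ++ prune lo hi l
      else x :: prune lo hi (y :: l)

theorem survivors_sublist (lo hi : ℝ) (x y : Line) : (survivors lo hi x y).Sublist [x, y] := by
  unfold survivors
  split_ifs <;> simp

theorem prune_sublist (lo hi : ℝ) (l : List Line) : (prune lo hi l).Sublist l := by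
  fun_induction prune lo hi l with
  | case1 => simp
  | case2 => simp
  | case3 x y l h ih => exact (survivors_sublist lo hi x y).append ih
  | case4 x y l h ih => exact ih.cons_cons x

/-- Each line of a pair lies above a survivor of the pair throughout the interval. -/
theorem exists_mem_survivors {lo hi : ℝ} {x y z : Line} (h : x.grp = y.grp) (hz : z ∈ [x, y])
    {t : ℝ} (ht : t ∈ Set.Ioo lo hi) :
    ∃ w ∈ survivors lo hi x y, w.grp = z.grp ∧ w.val t ≤ z.val t := by
  have hm : (lo + hi) / 2 ∈ Set.Ioo lo hi := by
    have := ht.1.trans ht.2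
    constructor <;> linarith
  unfold survivors
  split_ifs with h1 h2
  · have := val_le_val h1 hm ht h2
    simp only [List.mem_cons, List.not_mem_nil, or_false] at hz
    rcases hz with rfl | rfl
    · exact ⟨z, by simp, rfl, le_rfl⟩
    · exact ⟨x, by simp, h, this⟩
  · have h1' : crossing y x ≤ lo ∨ hi ≤ crossing y x := by
      have : crossing y x = crossing x y := by
        unfold crossing
        rw [← neg_sub, ← neg_sub x.slope, neg_div_neg_eq]
      rwa [this]
    have := val_le_val h1' hm ht (by linarith)
    simp only [List.mem_cons, List.not_mem_nil, or_false] at hz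
    rcases hz with rfl | rfl
    · exact ⟨y, by simp, h.symm, this⟩
    · exact ⟨z, by simp, rfl, le_rfl⟩
  · exact ⟨z, hz, rfl, le_rfl⟩

theorem exists_mem_prune {lo hi t : ℝ} (ht : t ∈ Set.Ioo lo hi) {l : List Line} {z : Line}
    (hz : z ∈ l) : ∃ w ∈ prune lo hi l, w.grp = z.grp ∧ w.val t ≤ z.val t := by
  fun_induction prune lo hi l with
  | case1 => simp at hz
  | case2 x => exact ⟨z, hz, rfl, le_rfl⟩
  | case3 x y l h ih =>
    have hz : z ∈ [x, y] ∨ z ∈ l := by simpa [or_assoc] using hz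
    rcases hz with hz | hz
    · obtain ⟨w, hw, e⟩ := exists_mem_survivors h hz ht
      exact ⟨w, List.mem_append_left _ hw, e⟩
    · obtain ⟨w, hw, e⟩ := ih hz
      exact ⟨w, List.mem_append_right _ hw, e⟩
  | case4 x y l h ih =>
    rcases List.mem_cons.1 hz with rfl | hz
    · exact ⟨z, by simp, rfl, le_rfl⟩
    · obtain ⟨w, hw, e⟩ := ih hz
      exact ⟨w, List.mem_cons_of_mem _ hw, e⟩

open scoped Classical in
theorem length_prune (lo hi : ℝ) (l : List Line) :
    (prune lo hi l).length + (crossings l).countP (fun c => c ≤ lo ∨ hi ≤ c) = l.length := by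
  fun_induction prune lo hi l with
  | case1 => simp [crossings]
  | case2 => simp [crossings]
  | case3 x y l h ih =>
    simp only [crossings, if_pos h, List.length_append, List.countP_cons, List.length_cons]
    unfold survivors
    by_cases h1 : crossing x y ≤ lo ∨ hi ≤ crossing x y
    · simp only [h1, decide_true, if_true]
      split_ifs <;> simp only [List.length_cons, List.length_nil] <;> omega
    · simp only [h1, decide_false, Bool.false_eq_true, if_false, List.length_cons,
        List.length_nil]
      omega
  | case4 x y l h ih =>
    simp only [crossings, if_neg h, List.length_cons] at ih ⊢
    omega

/-- The greedy choice of pairs leaves at most one line of each group unpaired. -/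
theorem length_le_crossings {a G : ℕ} {l : List Line} (hs : l.Pairwise (fun x y => x.grp ≤ y.grp))
    (hl : ∀ x ∈ l, a ≤ x.grp ∧ x.grp < G) : l.length ≤ 2 * (crossings l).length + (G - a) := by
  fun_induction crossings l generalizing a with
  | case1 => simp
  | case2 x =>
    have := hl x (by simp)
    simp; omega
  | case3 x y l h ih =>
    have := ih (hs.tail.tail) (fun z hz => hl z (by simp [hz]))
    simp only [List.length_cons]; omega
  | case4 x y l h ih =>
    have hx := hl x (by simp)
    have hy : x.grp < y.grp := by
      have := (List.pairwise_cons.1 hs).1 y (by simp)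
      omega
    have := ih (a := x.grp + 1) hs.tail (fun z hz => ⟨?_, (hl z (by simp at hz; simp [hz])).2⟩)
    · simp only [List.length_cons] at this ⊢; omega
    · rcases List.mem_cons.1 hz with rfl | hz
      · exact hy
      · have := (List.pairwise_cons.1 hs.tail).1 z hz
        omega

end Line

open Line

/-- The lines in `l` are sorted by their groups, and between `lo` and `hi` the minimum over
each group `g` is the function `F g`. -/
structure IsEnvelope (F : ℕ → ℝ → ℝ) (G : ℕ) (lo hi : ℝ) (l : List Line) : Prop where
  sorted : l.Pairwise (fun x y => x.grp ≤ y.grp)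
  grp_lt : ∀ x ∈ l, x.grp < G
  le_val : ∀ x ∈ l, ∀ t ∈ Set.Ioo lo hi, F x.grp t ≤ x.val t
  attained : ∀ g < G, ∀ t ∈ Set.Ioo lo hi, ∃ x ∈ l, x.grp = g ∧ x.val t = F g t

namespace IsEnvelope

variable {F : ℕ → ℝ → ℝ} {G : ℕ} {lo hi : ℝ} {l : List Line}

theorem prune (h : IsEnvelope F G lo hi l) {lo' hi' : ℝ} (hlo : lo ≤ lo') (hhi : hi' ≤ hi) :
    IsEnvelope F G lo' hi' (prune lo' hi' l) := by
  have hsub : ∀ t ∈ Set.Ioo lo' hi', t ∈ Set.Ioo lo hi := fun t ht =>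
    ⟨hlo.trans_lt ht.1, ht.2.trans_le hhi⟩
  have hmem := fun x (hx : x ∈ Line.prune lo' hi' l) => (prune_sublist lo' hi' l).subset hx
  refine ⟨h.sorted.sublist (prune_sublist _ _ _), fun x hx => h.grp_lt x (hmem x hx),
    fun x hx t ht => h.le_val x (hmem x hx) t (hsub t ht), fun g hg t ht => ?_⟩
  obtain ⟨x, hx, hxg, hxt⟩ := h.attained g hg t (hsub t ht)
  obtain ⟨w, hw, hwg, hwt⟩ := exists_mem_prune ht hx
  refine ⟨w, hw, hwg.trans hxg, le_antisymm (hwt.trans hxt.le) ?_⟩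
  have := h.le_val w (hmem w hw) t (hsub t ht)
  rwa [hwg, hxg] at this

theorem range_subset (h : IsEnvelope F G lo hi l) (hlt : lo < hi) :
    List.range G ⊆ l.map Line.grp := by
  intro g hg
  obtain ⟨x, hx, e, -⟩ := h.attained g (List.mem_range.1 hg) ((lo + hi) / 2)
    ⟨by linarith, by linarith⟩
  exact List.mem_map.2 ⟨x, hx, e⟩

theorem le_length (h : IsEnvelope F G lo hi l) (hlt : lo < hi) : G ≤ l.length := by
  simpa using (List.nodup_range.subperm (h.range_subset hlt)).length_le

open scoped Classical in
/-- If `m` is a median of the crossings and the interval lies on one side of `m`, then a quarter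
of the superfluous lines is discarded. -/
theorem length_prune_le (h : IsEnvelope F G lo hi l) (hlt : lo < hi) {m lo' hi' : ℝ}
    (h1 : (crossings l).length ≤ 2 * (crossings l).countP (fun c => c ≤ m))
    (h2 : (crossings l).length ≤ 2 * (crossings l).countP (fun c => m ≤ c))
    (hm : m ≤ lo' ∨ hi' ≤ m) :
    4 * ((Line.prune lo' hi' l).length - G) ≤ 3 * (l.length - G) := by
  have e := length_prune lo' hi' l
  have hG := h.le_length hlt
  have hP := length_le_crossings (a := 0) h.sorted (fun x hx => ⟨by omega, h.grp_lt x hx⟩)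
  have hc : (crossings l).length ≤
      2 * (crossings l).countP (fun c => decide (c ≤ lo' ∨ hi' ≤ c)) := by
    rcases hm with hm | hm
    · refine h1.trans (Nat.mul_le_mul_left _ (List.countP_mono_left fun c _ hc => ?_))
      simp only [decide_eq_true_eq] at hc ⊢
      exact .inl (hc.trans hm)
    · refine h2.trans (Nat.mul_le_mul_left _ (List.countP_mono_left fun c _ hc => ?_))
      simp only [decide_eq_true_eq] at hc ⊢
      exact .inr (hm.trans hc)
  omega

/-- If there is only one line per group, then the lines are sorted by their index, and each is
the minimum over its group. -/
theorem eq_of_length (h : IsEnvelope F G lo hi l) (hlt : lo < hi) (hG : l.length = G) {g : ℕ}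
    (hg : g < l.length) : ∀ t ∈ Set.Ioo lo hi, F g t = (l[g]).val t := by
  have hperm := (List.nodup_range.subperm (h.range_subset hlt)).perm_of_length_le (by simp [hG])
  have heq : List.range G = l.map Line.grp := by
    refine hperm.eq_of_pairwise (le := (· ≤ ·)) (fun a b _ _ h1 h2 => le_antisymm h1 h2) ?_ ?_
    · exact List.pairwise_le_range
    · exact List.pairwise_map.2 h.sorted
  have hgrp : ∀ (i : ℕ) (hi : i < l.length), (l[i]).grp = i := by
    intro i hi
    have : (l.map Line.grp)[i]'(by simpa using hi) = (List.range G)[i]'(by simpa [← hG]) := by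
      simp [heq]
    simpa using this
  intro t ht
  obtain ⟨x, hx, e, ev⟩ := h.attained g (hG ▸ hg) t ht
  obtain ⟨i, hi, rfl⟩ := List.getElem_of_mem hx
  rw [hgrp i hi] at e
  subst e
  exact ev.symm

end IsEnvelope

open scoped Classical in
/-- The middle element of a sorted sequence is a median. -/
theorem median_of_sorted {l : List ℝ} {P h : ℕ} {a : ℕ → ℝ}
    (hl : List.Perm l ((List.range P).map a)) (ha : ∀ x y, x ≤ y → y < P → a x ≤ a y)
    (hh : 2 * h ≤ P) (hh' : P ≤ 2 * h + 1) (hP : 0 < P) :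
    l.length ≤ 2 * l.countP (fun c => c ≤ a h) ∧ l.length ≤ 2 * l.countP (fun c => a h ≤ c) := by
  have hlen : l.length = P := by simpa using hl.length_eq
  rw [hl.countP_eq, hl.countP_eq, List.countP_map, List.countP_map, hlen]
  obtain ⟨k, hk⟩ : ∃ k, P = h + k := ⟨P - h, by omega⟩
  -- The first `h + 1` elements are at most `a h`, and those from index `h` on are at least `a h`.
  constructor
  · obtain ⟨k, hk⟩ : ∃ k, P = (h + 1) + k := ⟨P - h - 1, by omega⟩
    have : (List.range (h + 1)).countP ((fun c => decide (c ≤ a h)) ∘ a) = h + 1 := by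
      rw [List.countP_eq_length.2, List.length_range]
      intro x hx
      simpa using ha x h (by simpa [Nat.lt_succ_iff] using hx) (by omega)
    rw [hk, List.range_add, List.countP_append, this]
    omega
  · have : ((List.range k).map (h + ·)).countP ((fun c => decide (a h ≤ c)) ∘ a) = k := by
      rw [List.countP_eq_length.2, List.length_map, List.length_range]
      intro x hx
      obtain ⟨y, hy, rfl⟩ := List.mem_map.1 hx
      have := List.mem_range.1 hy
      simpa using ha h (h + y) (by omega) (by omega)
    rw [hk, List.range_add, List.countP_append, this]
    omega

/-! ### A program logic for the real RAM -/

namespace RealRAM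

namespace State

/-- Assignment to an integer variable. -/
def setI (s : State) (x v : ℕ) : State := { s with intVar := update s.intVar x v }

/-- Assignment to a cell of an integer array. -/
def putI (s : State) (a i v : ℕ) : State :=
  { s with intArr := update s.intArr a (update (s.intArr a) i v) }

/-- Assignment to a real variable. -/
def setR (s : State) (x : ℕ) (v : ℝ) : State := { s with realVar := update s.realVar x v }

/-- Assignment to a cell of a real array. -/
def putR (s : State) (a i : ℕ) (v : ℝ) : State :=
  { s with realArr := update s.realArr a (update (s.realArr a) i v) }

variable (s : State) (x y a b i j v : ℕ) (r : ℝ)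

@[simp] theorem setI_intVar_self : (s.setI x v).intVar x = v := by simp [setI, update]
@[simp] theorem setI_intVar_of_ne (h : y ≠ x) : (s.setI x v).intVar y = s.intVar y := by
  simp [setI, update, h]
@[simp] theorem setI_realVar : (s.setI x v).realVar = s.realVar := rfl
@[simp] theorem setI_intArr : (s.setI x v).intArr = s.intArr := rfl
@[simp] theorem setI_realArr : (s.setI x v).realArr = s.realArr := rfl

@[simp] theorem putI_intVar : (s.putI a i v).intVar = s.intVar := rfl
@[simp] theorem putI_realVar : (s.putI a i v).realVar = s.realVar := rfl
@[simp] theorem putI_intArr_self :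
    (s.putI a i v).intArr a j = if j = i then v else s.intArr a j := by
  simp [putI, update]
@[simp] theorem putI_intArr_of_ne (h : b ≠ a) : (s.putI a i v).intArr b = s.intArr b := by
  simp [putI, update, h]
@[simp] theorem putI_realArr : (s.putI a i v).realArr = s.realArr := rfl

@[simp] theorem setR_intVar : (s.setR x r).intVar = s.intVar := rfl
@[simp] theorem setR_realVar_self : (s.setR x r).realVar x = r := by simp [setR, update]
@[simp] theorem setR_realVar_of_ne (h : y ≠ x) : (s.setR x r).realVar y = s.realVar y := by
  simp [setR, update, h]
@[simp] theorem setR_intArr : (s.setR x r).intArr = s.intArr := rfl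
@[simp] theorem setR_realArr : (s.setR x r).realArr = s.realArr := rfl

@[simp] theorem putR_intVar : (s.putR a i r).intVar = s.intVar := rfl
@[simp] theorem putR_realVar : (s.putR a i r).realVar = s.realVar := rfl
@[simp] theorem putR_intArr : (s.putR a i r).intArr = s.intArr := rfl
@[simp] theorem putR_realArr_self :
    (s.putR a i r).realArr a j = if j = i then r else s.realArr a j := by
  simp [putR, update]
@[simp] theorem putR_realArr_of_ne (h : b ≠ a) : (s.putR a i r).realArr b = s.realArr b := by
  simp [putR, update, h]

end State

infixr:60 " ;; " => Program.seq

namespace Program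

/-- Whether a program contains an assignment to the integer variable `x`. -/
def writesIntVar (x : ℕ) : Program → Bool
  | setInt y _ => x == y
  | seq p q => p.writesIntVar x || q.writesIntVar x
  | ite _ p q => p.writesIntVar x || q.writesIntVar x
  | loop _ p => p.writesIntVar x
  | _ => false

/-- Whether a program contains an assignment to the real variable `x`. -/
def writesRealVar (x : ℕ) : Program → Bool
  | setReal y _ => x == y
  | seq p q => p.writesRealVar x || q.writesRealVar x
  | ite _ p q => p.writesRealVar x || q.writesRealVar x
  | loop _ p => p.writesRealVar x
  | _ => false

/-- Whether a program contains an assignment to a cell of the integer array `a`. -/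
def writesIntArr (a : ℕ) : Program → Bool
  | putInt b _ _ => a == b
  | seq p q => p.writesIntArr a || q.writesIntArr a
  | ite _ p q => p.writesIntArr a || q.writesIntArr a
  | loop _ p => p.writesIntArr a
  | _ => false

/-- Whether a program contains an assignment to a cell of the real array `a`. -/
def writesRealArr (a : ℕ) : Program → Bool
  | putReal b _ _ => a == b
  | seq p q => p.writesRealArr a || q.writesRealArr a
  | ite _ p q => p.writesRealArr a || q.writesRealArr a
  | loop _ p => p.writesRealArr a
  | _ => false

/-- Whether a program contains no loop. -/
def loopFree : Program → Bool
  | seq p q => p.loopFree && q.loopFree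
  | ite _ p q => p.loopFree && q.loopFree
  | loop _ _ => false
  | _ => true

/-- An upper bound for the running time of a program without loops. -/
def maxCost : Program → ℕ
  | skip => 1
  | setInt _ e => e.cost + 1
  | putInt _ i e => i.cost + e.cost + 1
  | setReal _ e => e.cost + 1
  | putReal _ i e => i.cost + e.cost + 1
  | seq p q => p.maxCost + q.maxCost
  | ite b p q => b.cost + 1 + max p.maxCost q.maxCost
  | loop _ _ => 0

open scoped Classical in
/-- The final state of a program without loops. -/
noncomputable def exec (d : ℕ → ℕ → ℝ) : Program → State → State
  | skip, s => s
  | setInt x e, s => s.setI x (e.eval s)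
  | putInt a i e, s => s.putI a (i.eval s) (e.eval s)
  | setReal x e, s => s.setR x (e.eval d s)
  | putReal a i e, s => s.putR a (i.eval s) (e.eval d s)
  | seq p q, s => q.exec d (p.exec d s)
  | ite b p q, s => if b.Holds d s then p.exec d s else q.exec d s
  | loop _ _, s => s

end Program

/-- The states `s` and `s'` agree on everything to which `p` makes no assignment. -/
structure Unchanged (p : Program) (s s' : State) : Prop where
  intVar : ∀ x, p.writesIntVar x = false → s'.intVar x = s.intVar x
  realVar : ∀ x, p.writesRealVar x = false → s'.realVar x = s.realVar x
  intArr : ∀ a, p.writesIntArr a = false → s'.intArr a = s.intArr a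
  realArr : ∀ a, p.writesRealArr a = false → s'.realArr a = s.realArr a

namespace Unchanged

theorem refl (p : Program) (s : State) : Unchanged p s s :=
  ⟨fun _ _ => rfl, fun _ _ => rfl, fun _ _ => rfl, fun _ _ => rfl⟩

theorem trans {p : Program} {s s' s'' : State} (h : Unchanged p s s') (h' : Unchanged p s' s'') :
    Unchanged p s s'' :=
  ⟨fun x hx => (h'.intVar x hx).trans (h.intVar x hx),
    fun x hx => (h'.realVar x hx).trans (h.realVar x hx),
    fun x hx => (h'.intArr x hx).trans (h.intArr x hx),
    fun x hx => (h'.realArr x hx).trans (h.realArr x hx)⟩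

theorem mono {p q : Program} {s s' : State} (h : Unchanged p s s')
    (h1 : ∀ x, q.writesIntVar x = false → p.writesIntVar x = false)
    (h2 : ∀ x, q.writesRealVar x = false → p.writesRealVar x = false)
    (h3 : ∀ x, q.writesIntArr x = false → p.writesIntArr x = false)
    (h4 : ∀ x, q.writesRealArr x = false → p.writesRealArr x = false) : Unchanged q s s' :=
  ⟨fun x hx => h.intVar x (h1 x hx), fun x hx => h.realVar x (h2 x hx),
    fun x hx => h.intArr x (h3 x hx), fun x hx => h.realArr x (h4 x hx)⟩

theorem seq {p q : Program} {s s' s'' : State} (h : Unchanged p s s') (h' : Unchanged q s' s'') :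
    Unchanged (p ;; q) s s'' := by
  refine (h.mono ?_ ?_ ?_ ?_).trans (h'.mono ?_ ?_ ?_ ?_) <;>
    simp +contextual [Program.writesIntVar, Program.writesRealVar, Program.writesIntArr,
      Program.writesRealArr]

end Unchanged

theorem Runs.unchanged {d : ℕ → ℕ → ℝ} {p : Program} {s s' : State} {t : ℕ}
    (h : Runs d p s s' t) : Unchanged p s s' := by
  induction h with
  | skip s => exact .refl _ _
  | setInt s x e =>
    refine ⟨fun y hy => ?_, fun _ _ => rfl, fun _ _ => rfl, fun _ _ => rfl⟩
    simp only [Program.writesIntVar, beq_eq_false_iff_ne] at hy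
    simp [update, hy]
  | putInt s a i e =>
    refine ⟨fun _ _ => rfl, fun _ _ => rfl, fun y hy => ?_, fun _ _ => rfl⟩
    simp only [Program.writesIntArr, beq_eq_false_iff_ne] at hy
    simp [update, hy]
  | setReal s x e =>
    refine ⟨fun _ _ => rfl, fun y hy => ?_, fun _ _ => rfl, fun _ _ => rfl⟩
    simp only [Program.writesRealVar, beq_eq_false_iff_ne] at hy
    simp [update, hy]
  | putReal s a i e =>
    refine ⟨fun _ _ => rfl, fun _ _ => rfl, fun _ _ => rfl, fun y hy => ?_⟩
    simp only [Program.writesRealArr, beq_eq_false_iff_ne] at hy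
    simp [update, hy]
  | seq _ _ ih1 ih2 => exact ih1.seq ih2
  | iteTrue _ _ ih =>
    refine ih.mono ?_ ?_ ?_ ?_ <;>
      simp +contextual [Program.writesIntVar, Program.writesRealVar, Program.writesIntArr,
        Program.writesRealArr]
  | iteFalse _ _ ih =>
    refine ih.mono ?_ ?_ ?_ ?_ <;>
      simp +contextual [Program.writesIntVar, Program.writesRealVar, Program.writesIntArr,
        Program.writesRealArr]
  | loopTrue _ _ _ ih1 ih2 =>
    exact Unchanged.trans
      (ih1.mono (q := .loop _ _) (fun _ h => h) (fun _ h => h) (fun _ h => h) (fun _ h => h)) ih2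
  | loopFalse _ => exact .refl _ _

/-- On the input `d`, the program `p` started in the state `s` halts within `B` units of time in a
state that satisfies `Q`. -/
def Halts (d : ℕ → ℕ → ℝ) (p : Program) (s : State) (B : ℕ) (Q : State → Prop) : Prop :=
  ∃ s' t, Runs d p s s' t ∧ t ≤ B ∧ Q s'

/-- The program `for x := 0 to y - 1 do p`, for integer variables `x` and `y`. -/
def forLoop (x y : ℕ) (p : Program) : Program :=
  .setInt x (.lit 0) ;;
  .loop (.not (.intLE (.var y) (.var x))) (p ;; .setInt x (.add (.var x) (.lit 1)))

namespace Halts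

variable {d : ℕ → ℕ → ℝ} {p q : Program} {s : State} {B B' : ℕ} {Q R : State → Prop}

theorem mono (h : Halts d p s B R) (hB : B ≤ B') (hQ : ∀ s', R s' → Unchanged p s s' → Q s') :
    Halts d p s B' Q := by
  obtain ⟨s', t, hr, ht, hR⟩ := h
  exact ⟨s', t, hr, ht.trans hB, hQ s' hR hr.unchanged⟩

theorem seq (h : Halts d p s B R)
    (h' : ∀ s', R s' → Unchanged p s s' → Halts d q s' B' Q) :
    Halts d (p ;; q) s (B + B') Q := by
  obtain ⟨s', t, hr, ht, hR⟩ := h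
  obtain ⟨s'', t', hr', ht', hQ⟩ := h' s' hR hr.unchanged
  exact ⟨s'', t + t', .seq hr hr', add_le_add ht ht', hQ⟩

theorem ite {b : Test} (h1 : b.Holds d s → Halts d p s B Q) (h2 : ¬ b.Holds d s → Halts d q s B Q) :
    Halts d (.ite b p q) s (b.cost + 1 + B) Q := by
  by_cases hb : b.Holds d s
  · obtain ⟨s', t, hr, ht, hQ⟩ := h1 hb
    exact ⟨s', _, .iteTrue hb hr, by omega, hQ⟩
  · obtain ⟨s', t, hr, ht, hQ⟩ := h2 hb
    exact ⟨s', _, .iteFalse hb hr, by omega, hQ⟩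

theorem exec_self (hp : p.loopFree = true) : Halts d p s p.maxCost (fun s' => s' = p.exec d s) := by
  induction p generalizing s with
  | skip => exact ⟨_, _, .skip s, le_rfl, rfl⟩
  | setInt x e => exact ⟨_, _, .setInt s x e, le_rfl, rfl⟩
  | putInt a i e => exact ⟨_, _, .putInt s a i e, le_rfl, rfl⟩
  | setReal x e => exact ⟨_, _, .setReal s x e, le_rfl, rfl⟩
  | putReal a i e => exact ⟨_, _, .putReal s a i e, le_rfl, rfl⟩
  | seq p q ih1 ih2 =>
    simp only [Program.loopFree, Bool.and_eq_true] at hp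
    refine (ih1 hp.1).seq fun s' hs' _ => ?_
    subst hs'
    exact ih2 hp.2
  | ite b p q ih1 ih2 =>
    simp only [Program.loopFree, Bool.and_eq_true] at hp
    refine .ite (fun hb => ?_) (fun hb => ?_)
    · exact (ih1 hp.1).mono (le_max_left _ _) fun s' hs' _ => by simp [Program.exec, hb, hs']
    · exact (ih2 hp.2).mono (le_max_right _ _) fun s' hs' _ => by simp [Program.exec, hb, hs']
  | loop b p => simp [Program.loopFree] at hp

theorem exec (hp : p.loopFree = true) (hB : p.maxCost ≤ B) (hQ : Q (p.exec d s)) :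
    Halts d p s B Q :=
  (exec_self hp).mono hB fun _ hs' _ => hs' ▸ hQ

/-- A loop with the invariant `Inv`; the potential `Φ` bounds the remaining running time. -/
theorem loop {b : Test} (Inv : State → Prop) (Φ : State → ℕ) (hs : Inv s)
    (hstep : ∀ s', Unchanged (.loop b p) s s' → Inv s' → b.Holds d s' →
      ∃ B, Halts d p s' B (fun s'' => Inv s'' ∧ B + b.cost + 1 + Φ s'' ≤ Φ s'))
    (hend : ∀ s', Inv s' → ¬ b.Holds d s' → b.cost + 1 ≤ Φ s') :
    Halts d (.loop b p) s (Φ s) (fun s' => Inv s' ∧ ¬ b.Holds d s') := by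
  suffices H : ∀ m s', Φ s' = m → Unchanged (.loop b p) s s' → Inv s' →
      Halts d (.loop b p) s' (Φ s') (fun s' => Inv s' ∧ ¬ b.Holds d s') from
    H _ s rfl (.refl _ _) hs
  intro m
  induction m using Nat.strong_induction_on with
  | _ m ih =>
    intro s' hm hu hi
    by_cases hb : b.Holds d s'
    · obtain ⟨B, s1, t, hr, ht, hi1, hΦ⟩ := hstep s' hu hi hb
      have hu1 : Unchanged (.loop b p) s' s1 :=
        hr.unchanged.mono (fun _ h => h) (fun _ h => h) (fun _ h => h) (fun _ h => h)
      obtain ⟨s2, t', hr', ht', hQ⟩ := ih (Φ s1) (by omega) s1 rfl (hu.trans hu1) hi1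
      exact ⟨s2, _, .loopTrue hb hr hr', by omega, hQ⟩
    · exact ⟨s', _, .loopFalse hb, hend s' hi hb, hi, hb⟩

/-- A counting loop with the invariant `Inv`; the potential `Φ` bounds the remaining
running time. -/
theorem forLoop_potential {x y N : ℕ} (hy : s.intVar y = N) (hpx : p.writesIntVar x = false)
    (hpy : p.writesIntVar y = false) (hxy : y ≠ x) (Inv : ℕ → State → Prop) (Φ : ℕ → State → ℕ)
    (h0 : Inv 0 (s.setI x 0))
    (hstep : ∀ k < N, ∀ s', Unchanged (forLoop x y p) s s' → s'.intVar x = k → Inv k s' →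
      ∃ B, Halts d p s' B (fun s'' => Inv (k + 1) (s''.setI x (k + 1)) ∧
        B + 9 + Φ (k + 1) (s''.setI x (k + 1)) ≤ Φ k s'))
    (hend : ∀ s', 5 ≤ Φ N s') :
    Halts d (forLoop x y p) s (2 + Φ 0 (s.setI x 0)) (fun s' => Inv N s' ∧ s'.intVar x = N) := by
  refine Halts.seq (R := fun s' => s' = s.setI x 0) (exec rfl le_rfl rfl) fun s1 hs1 hu1 => ?_
  subst hs1
  have hb : ∀ s', Test.Holds d s' (.not (.intLE (.var y) (.var x))) ↔ s'.intVar x < s'.intVar y :=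
    fun s' => by simp [Test.Holds, IntExp.eval]
  refine (Halts.loop (fun s' => Inv (s'.intVar x) s' ∧ s'.intVar x ≤ N ∧ s'.intVar y = N)
    (fun s' => Φ (s'.intVar x) s') ?_ ?_ ?_).mono (by simp) ?_
  · exact ⟨by simpa using h0, by simp, by simp [hxy, hy]⟩
  · rintro s' hu ⟨hi, hx, hy'⟩ hlt
    rw [hb] at hlt
    obtain ⟨B, hB⟩ := hstep _ (by omega) s' (hu1.seq hu) rfl hi
    refine ⟨B + 4, hB.seq fun s2 ⟨h1, h2⟩ hu2 => ?_⟩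
    refine exec rfl le_rfl ?_
    have e := hu2.intVar x hpx
    have e' := hu2.intVar y hpy
    simp only [Program.exec, IntExp.eval, State.setI_intVar_self, Test.cost, IntExp.cost, e]
    refine ⟨⟨h1, by omega, ?_⟩, ?_⟩
    · rw [State.setI_intVar_of_ne _ _ _ _ hxy]; omega
    · omega
  · rintro s' ⟨hi, hx, hy'⟩ hlt
    rw [hb] at hlt
    have : s'.intVar x = N := by omega
    rw [this]
    exact hend s'
  · rintro s' ⟨⟨hi, hx, hy'⟩, hlt⟩ -
    rw [hb] at hlt
    have : s'.intVar x = N := by omega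
    rw [this] at hi
    exact ⟨hi, this⟩

theorem forLoop {x y N : ℕ} (hy : s.intVar y = N) (hpx : p.writesIntVar x = false)
    (hpy : p.writesIntVar y = false) (hxy : y ≠ x) (Inv : ℕ → State → Prop)
    (h0 : Inv 0 (s.setI x 0))
    (hstep : ∀ k < N, ∀ s', Unchanged (forLoop x y p) s s' → s'.intVar x = k → Inv k s' →
      Halts d p s' B (fun s'' => Inv (k + 1) (s''.setI x (k + 1)))) :
    Halts d (forLoop x y p) s (N * (B + 9) + 7) (fun s' => Inv N s' ∧ s'.intVar x = N) := by
  refine (forLoop_potential hy hpx hpy hxy Inv (fun k _ => (N - k) * (B + 9) + 5) h0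
    (fun k hk s' hu hx hi => ⟨B, (hstep k hk s' hu hx hi).mono le_rfl fun s'' h _ => ⟨h, ?_⟩⟩)
    (fun _ => by simp)).mono (by simp; omega) fun s' h _ => h
  obtain ⟨m, rfl⟩ := Nat.exists_eq_add_of_lt hk
  rw [show k + m + 1 - (k + 1) = m by omega, show k + m + 1 - k = m + 1 by omega]
  ring_nf
  omega

end Halts

/-! ### Matrices in arrays, minima in loops

The programs share their memory as follows. The integer variables `0` to `4` hold `n`, `n * n`,
`⌈log₂ n⌉` and its multiples by `3` and `8`; variable `5` holds the outcome of a feasibility test,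
`6` the number of lines and `7` the number of crossings; the others are counters and addresses. The
real variables `0` and `1` hold the ends of the interval that contains the optimum, variable `2` the
value to be tested. The real array `0` is for the output, `1` and `2` hold the coefficients of the
matrix of linear functions, `3` the matrix of the feasibility test, `5` and `6` the coefficients of
the lines, `7` their crossings; `4` and `8` are auxiliary. The integer array `0` holds the multiples
of `n`, and `1` the groups of the lines.
-/

/-- The constants that the programs rely on: the integer variables `0` and `1` hold `n` and `n * n`,
and the integer array `0` holds the first addresses of the rows of an `n × n` matrix that is stored
row by row. -/
structure Env (n : ℕ) (s : State) : Prop where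
  size : s.intVar 0 = n
  sq : s.intVar 1 = n * n
  row : ∀ i < n, s.intArr 0 i = i * n

theorem Env.of_unchanged {n : ℕ} {p : Program} {s s' : State} (h : Env n s) (hu : Unchanged p s s')
    (h0 : p.writesIntVar 0 = false) (h1 : p.writesIntVar 1 = false)
    (h2 : p.writesIntArr 0 = false) : Env n s' :=
  ⟨(hu.intVar 0 h0).trans h.size, (hu.intVar 1 h1).trans h.sq,
    fun i hi => (congrFun (hu.intArr 0 h2) i).trans (h.row i hi)⟩

/-- The address of the entry whose row and column are held by the variables `x` and `y`. -/
def cellAddr (x y : ℕ) : IntExp := .add (.get 0 (.var x)) (.var y)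

theorem eval_cellAddr {n : ℕ} {s : State} (h : Env n s) {x y : ℕ} (hx : s.intVar x < n) :
    (cellAddr x y).eval s = s.intVar x * n + s.intVar y := by
  simp [cellAddr, IntExp.eval, h.row _ hx]

theorem cell_inj {n i j k l : ℕ} (hj : j < n) (hl : l < n) (h : i * n + j = k * n + l) :
    i = k ∧ j = l := by
  have hn : 0 < n := by omega
  have h2 := congrArg (· % n) h
  simp only [Nat.mul_add_mod_self_right, Nat.mod_eq_of_lt hj, Nat.mod_eq_of_lt hl] at h2
  subst h2
  exact ⟨Nat.eq_of_mul_eq_mul_right hn (by omega), rfl⟩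

/-- For all `x, y < n`, run `p` and put the real variable `3` into the cell `(x, y)`
of the array `a`. -/
def fillMatrix (a x y : ℕ) (p : Program) : Program :=
  forLoop x 0 (forLoop y 0 (p ;; .putReal a (cellAddr x y) (.var 3)))

/-- Replace the real variable `3` by its minimum with the real variable `4`. -/
def minStep : Program := .ite (.realLE (.var 3) (.var 4)) .skip (.setReal 3 (.var 4))

/-- The real variable `3` becomes its minimum with the values that `p` puts into the
real variable `4` for `x = 0, …, n - 1`. -/
def minLoop (x : ℕ) (p : Program) : Program := forLoop x 0 (p ;; minStep)

variable {d : ℕ → ℕ → ℝ} {n B : ℕ} {s : State}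

/-- If `p` computes `G i j` in the real variable `3` whenever `x` and `y` hold `i` and `j`, then
`fillMatrix` stores the matrix `G`. -/
theorem Halts.fillMatrix {a x y : ℕ} {p : Program} {G : ℕ → ℕ → ℝ} (h : Env n s)
    (hxy : x ≠ y) (hx0 : x ≠ 0) (hy0 : y ≠ 0) (hx1 : x ≠ 1) (hy1 : y ≠ 1)
    (hpx : p.writesIntVar x = false) (hpy : p.writesIntVar y = false)
    (hp0 : p.writesIntVar 0 = false) (hp1 : p.writesIntVar 1 = false)
    (hpr : p.writesIntArr 0 = false) (hpa : p.writesRealArr a = false)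
    (hp : ∀ i < n, ∀ j < n, ∀ s', Unchanged (fillMatrix a x y p) s s' → s'.intVar x = i →
      s'.intVar y = j → Halts d p s' B fun s'' => s''.realVar 3 = G i j) :
    Halts d (fillMatrix a x y p) s (n * (n * (B + 15) + 16) + 7)
      (fun s' => ∀ i < n, ∀ j < n, s'.realArr a (i * n + j) = G i j) := by
  refine (Halts.forLoop (B := n * (B + 6 + 9) + 7) h.size ?_ ?_ hx0.symm
    (fun k s' => ∀ i < k, ∀ j < n, s'.realArr a (i * n + j) = G i j) (by simp) ?_).mono
    le_rfl fun s' h _ => h.1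
  · simp [RealRAM.forLoop, Program.writesIntVar, hpx, hxy]
  · simp [RealRAM.forLoop, Program.writesIntVar, hp0, hy0.symm]
  intro k hk s' hu hx hI
  have h' : Env n s' := h.of_unchanged hu
    (by simp [RealRAM.forLoop, Program.writesIntVar, hp0, hy0.symm, hx0.symm])
    (by simp [RealRAM.forLoop, Program.writesIntVar, hp1, hy1.symm, hx1.symm])
    (by simp [RealRAM.forLoop, Program.writesIntArr, hpr])
  refine (Halts.forLoop (B := B + 6) h'.size ?_ ?_ hy0.symm
    (fun l s' => ∀ i < n, ∀ j < n, i < k ∨ i = k ∧ j < l → s'.realArr a (i * n + j) = G i j)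
    (fun i hi j hj hij => ?_) ?_).mono
    le_rfl fun s' h _ i hi j hj => ?_
  · simp [Program.writesIntVar, hpy]
  · simp [Program.writesIntVar, hp0]
  · simpa using hI i (by omega) j hj
  · intro l hl s1 hu1 hy hI1
    have hx1 : s1.intVar x = k := by
      rw [hu1.intVar x (by simp [RealRAM.forLoop, Program.writesIntVar, hpx, hxy]), hx]
    have h1 : Env n s1 := h'.of_unchanged hu1
      (by simp [RealRAM.forLoop, Program.writesIntVar, hp0, hy0.symm])
      (by simp [RealRAM.forLoop, Program.writesIntVar, hp1, hy1.symm])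
      (by simp [RealRAM.forLoop, Program.writesIntArr, hpr])
    have hu2 : Unchanged (RealRAM.fillMatrix a x y p) s s1 := by
      refine hu.trans (hu1.mono ?_ ?_ ?_ ?_) <;>
        simp +contextual [RealRAM.forLoop, Program.writesIntVar,
          Program.writesRealVar, Program.writesIntArr, Program.writesRealArr]
    refine (hp k hk l hl s1 hu2 hx1 hy).seq fun s2 hr hu3 => ?_
    refine Halts.exec rfl le_rfl ?_
    have h2 : Env n s2 := h1.of_unchanged hu3 hp0 hp1 hpr
    have hx2 := (hu3.intVar x hpx).trans hx1
    have hy2 := (hu3.intVar y hpy).trans hy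
    have ha2 := hu3.realArr a hpa
    simp only [Program.exec, eval_cellAddr h2 (hx2.trans_lt hk), hx2, hy2, RealExp.eval, hr]
    intro i hi j hj hij
    simp only [State.setI_realArr, State.putR_realArr_self]
    split_ifs with he
    · obtain ⟨rfl, rfl⟩ := cell_inj hj hl he
      rfl
    · rw [ha2]
      refine hI1 i hi j hj ?_
      rcases hij with hij | ⟨rfl, hij⟩
      · exact .inl hij
      · refine .inr ⟨rfl, lt_of_le_of_ne (Nat.lt_succ_iff.1 hij) fun e => he (by rw [e])⟩
  · simp only [State.setI_realArr]
    exact h.1 i (by omega) j hj (by omega)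

theorem Halts.minLoop {x : ℕ} {p : Program} {r : ℝ} {f : ℕ → ℝ} (h : Env n s)
    (hr : s.realVar 3 = r) (hx0 : x ≠ 0)
    (hpx : p.writesIntVar x = false) (hp0 : p.writesIntVar 0 = false)
    (hp3 : p.writesRealVar 3 = false)
    (hp : ∀ k < n, ∀ s', Unchanged (minLoop x p) s s' → s'.intVar x = k →
      Halts d p s' B fun s'' => s''.realVar 4 = f k) :
    Halts d (minLoop x p) s (n * (B + 15) + 7) (fun s' => s'.realVar 3 = minFrom r f n) := by
  refine (Halts.forLoop (B := B + 6) h.size ?_ ?_ hx0.symm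
    (fun k s' => s'.realVar 3 = minFrom r f k) (by simpa [minFrom] using hr) ?_).mono
    le_rfl fun s' h _ => h.1
  · simp [Program.writesIntVar, minStep, hpx]
  · simp [Program.writesIntVar, minStep, hp0]
  intro k hk s' hu hx hI
  refine (hp k hk s' hu hx).seq fun s1 h4 hu1 => Halts.exec rfl le_rfl ?_
  have h3 := (hu1.realVar 3 hp3).trans hI
  simp only [minStep, Program.exec, Test.Holds, RealExp.eval, h3, h4, minFrom, min_def]
  split_ifs with h <;> simp [h3]

/-- Copy the matrix in the array `a` to the array `b`. -/
def copyMatrix (a b x : ℕ) : Program := forLoop x 1 (.putReal b (.var x) (.get a (.var x)))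

theorem Halts.copyMatrix {a b x : ℕ} (h : Env n s) (hab : a ≠ b) (hx : x ≠ 1) :
    Halts d (copyMatrix a b x) s (n * n * 13 + 7)
      (fun s' => ∀ i < n * n, s'.realArr b i = s.realArr a i) := by
  refine (Halts.forLoop (B := 4) h.sq rfl rfl hx.symm
    (fun k s' => ∀ i < k, s'.realArr b i = s.realArr a i) (by simp) ?_).mono
    le_rfl fun s' h _ => h.1
  intro k hk s' hu hx hI
  refine Halts.exec rfl le_rfl ?_
  have ha := hu.realArr a (by simp [RealRAM.forLoop, Program.writesRealArr, hab])
  intro i hi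
  simp only [Program.exec, IntExp.eval, RealExp.eval, State.setI_realArr, State.putR_realArr_self,
    hx, ha]
  split_ifs with h
  · rw [h]
  · exact hI i (by omega)

/-! ### The feasibility test -/

/-- The test whether the variables `x` and `y` are equal. -/
def eqTest (x y : ℕ) : Test := .and (.intLE (.var x) (.var y)) (.intLE (.var y) (.var x))

/-- Put the matrix `arc` for the value of the real variable `2` into the array `3`. -/
def arcProgram : Program :=
  fillMatrix 3 10 11
    (.setReal 3 (.mul (.var 2) (.query (.var 11) (.var 10))) ;;
      minLoop 12 (.ite (eqTest 12 11)
        (.setReal 4 (.mul (.var 2) (.query (.var 11) (.var 10))))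
        (.setReal 4 (.sub (.mul (.var 2) (.query (.var 11) (.var 12)))
          (.query (.var 12) (.var 10))))))

/-- One step of the algorithm of Floyd and Warshall on the matrix in the array `3`; the variable
`14` holds the new intermediate vertex. -/
def floydStepProgram : Program :=
  fillMatrix 4 10 11
    (.setReal 3 (.get 3 (cellAddr 10 11)) ;;
      .setReal 4 (.add (.get 3 (cellAddr 10 14)) (.get 3 (cellAddr 14 11))) ;; minStep) ;;
  copyMatrix 4 3 13

/-- Compute `arcClosure` for the value of the real variable `2` in the array `3`, and put `1` or `0`
into the variable `5` according to whether that value is feasible. -/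
def testProgram : Program :=
  arcProgram ;; forLoop 14 0 floydStepProgram ;; .setInt 5 (.lit 1) ;;
  forLoop 10 0 (.ite (.realLE (.lit 0) (.get 3 (cellAddr 10 10))) .skip (.setInt 5 (.lit 0)))

/-- The running time of `testProgram`. -/
def testCost (n : ℕ) : ℕ :=
  (n * (n * (6 + (n * 33 + 7) + 15) + 16) + 7) +
    ((n * ((n * (n * 39 + 16) + 7) + (n * n * 13 + 7) + 9) + 7) + (2 + (n * 19 + 7)))

theorem halts_arcProgram (h : Env n s) :
    Halts d arcProgram s (n * (n * (6 + (n * 33 + 7) + 15) + 16) + 7)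
      (fun s' => ∀ i < n, ∀ j < n, s'.realArr 3 (i * n + j) = arc d n (s.realVar 2) i j) := by
  refine Halts.fillMatrix h (by decide) (by decide) (by decide) (by decide) (by decide) rfl rfl rfl
    rfl rfl rfl fun u hu w hw s' hun h10 h11 => ?_
  have h' : Env n s' := h.of_unchanged hun rfl rfl rfl
  have h2 : s'.realVar 2 = s.realVar 2 := hun.realVar 2 rfl
  refine (Halts.exec (B := 6) (Q := fun s1 => s1.realVar 3 = s.realVar 2 * d w u) rfl
    (by decide) ?_).seq fun s1 h3 hu1 => ?_
  · simp [Program.exec, RealExp.eval, IntExp.eval, h10, h11, h2]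
  refine (Halts.minLoop (B := 18) (h'.of_unchanged hu1 rfl rfl rfl) h3 (by decide) rfl rfl rfl ?_)
  intro v hv s2 hu2 h12
  refine Halts.exec rfl (by decide) ?_
  have e10 : s2.intVar 10 = u := ((hu2.intVar 10 rfl).trans (hu1.intVar 10 rfl)).trans h10
  have e11 : s2.intVar 11 = w := ((hu2.intVar 11 rfl).trans (hu1.intVar 11 rfl)).trans h11
  have e2 : s2.realVar 2 = s.realVar 2 :=
    ((hu2.realVar 2 rfl).trans (hu1.realVar 2 rfl)).trans h2
  simp only [Program.exec, eqTest, Test.Holds, IntExp.eval, RealExp.eval, e10, e11, e2, h12,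
    ← le_antisymm_iff, arcVia]
  split_ifs <;> simp

theorem halts_floydStepProgram (h : Env n s) {k : ℕ} (hk : k < n) (h14 : s.intVar 14 = k)
    {M : ℕ → ℕ → ℝ} (hM : ∀ i < n, ∀ j < n, s.realArr 3 (i * n + j) = M i j) :
    Halts d floydStepProgram s ((n * (n * 39 + 16) + 7) + (n * n * 13 + 7))
      (fun s' => ∀ i < n, ∀ j < n, s'.realArr 3 (i * n + j) = floydStep k M i j) := by
  refine Halts.seq (R := fun s' => ∀ i < n, ∀ j < n, s'.realArr 4 (i * n + j) = floydStep k M i j)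
    (Halts.fillMatrix (B := 24) h (by decide) (by decide) (by decide) (by decide) (by decide)
      rfl rfl rfl rfl rfl rfl fun i hi j hj s' hu h10 h11 => ?_) fun s' hs' hu => ?_
  · refine Halts.exec rfl (by decide) ?_
    have h' : Env n s' := h.of_unchanged hu rfl rfl rfl
    have e14 : s'.intVar 14 = k := (hu.intVar 14 rfl).trans h14
    have e3 : s'.realArr 3 = s.realArr 3 := hu.realArr 3 rfl
    have r1 := h'.row i hi
    have r2 := h'.row k hk
    simp only [minStep, Program.exec, Test.Holds, IntExp.eval, RealExp.eval, cellAddr, h10, h11,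
      State.setR_intVar, State.setR_intArr, State.setR_realArr, State.setR_realVar_self,
      State.setR_realVar_of_ne _ 4 3 _ (by decide), e14, e3, r1, r2, hM i hi j hj, hM i hi k hk,
      hM k hk j hj, floydStep, min_def]
    split_ifs <;> simp
  · refine (Halts.copyMatrix (h.of_unchanged hu rfl rfl rfl) (by decide) (by decide)).mono le_rfl
      fun s1 h1 _ i hi j hj => ?_
    rw [h1 _ (by nlinarith), hs' i hi j hj]

theorem halts_testProgram (h : Env n s) :
    Halts d testProgram s (testCost n) (fun s' =>
      (∀ i < n, ∀ j < n, s'.realArr 3 (i * n + j) = arcClosure d n (s.realVar 2) i j) ∧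
      (s'.intVar 5 = 1 ↔ ∀ i < n, 0 ≤ arcClosure d n (s.realVar 2) i i)) := by
  refine (halts_arcProgram h).seq fun s1 hW hu1 => ?_
  have h1 : Env n s1 := h.of_unchanged hu1 rfl rfl rfl
  refine Halts.seq (Halts.forLoop h1.size rfl rfl (by decide)
    (fun k s' => ∀ i < n, ∀ j < n, s'.realArr 3 (i * n + j) =
      floyd (arc d n (s.realVar 2)) k i j) (by simpa [floyd] using hW) ?_) fun s2 hF hu2 => ?_
  · intro k hk s' hu h14 hI
    exact (halts_floydStepProgram (h1.of_unchanged hu rfl rfl rfl) hk h14 hI).mono le_rfl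
      fun s'' h _ => h
  replace hF := hF.1
  have h2 : Env n s2 := h1.of_unchanged hu2 rfl rfl rfl
  refine Halts.seq (R := fun s' => s' = s2.setI 5 1) (Halts.exec rfl le_rfl rfl) fun s3 e hu3 => ?_
  subst e
  refine (Halts.forLoop (B := 10) (p := .ite (.realLE (.lit 0) (.get 3 (cellAddr 10 10))) .skip
    (.setInt 5 (.lit 0))) (by simpa using h2.size) rfl rfl (by decide)
    (fun k s' => s'.intVar 5 = 1 ↔ ∀ i < k, 0 ≤ arcClosure d n (s.realVar 2) i i)
    (by simp) ?_).mono le_rfl fun s' hs' hu => ⟨fun i hi j hj => ?_, hs'.1⟩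
  · intro k hk s' hu h10 hI
    refine Halts.exec rfl (by decide) ?_
    have r1 : s'.intArr 0 k = k * n := by
      rw [hu.intArr 0 rfl]; exact h2.row k hk
    have e3 : s'.realArr 3 = s2.realArr 3 := hu.realArr 3 rfl
    have hkk : s2.realArr 3 (k * n + k) = arcClosure d n (s.realVar 2) k k := hF k hk k hk
    simp only [Program.exec, Test.Holds, IntExp.eval, RealExp.eval, cellAddr, h10, r1, e3, hkk,
      Nat.cast_zero, Nat.forall_lt_succ_right]
    split_ifs with hpos
    · simp [hI, hpos]
    · simp [hpos]
  · rw [hu.realArr 3 rfl]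
    exact hF i hi j hj

/-! ### Reading off the star -/

/-- Put the edge weights `starOfArcClosure` into the array `0`. -/
def starProgram : Program :=
  .setInt 15 (.lit 0) ;;
  forLoop 10 0
    (.setReal 3 (.sub (.get 3 (cellAddr 15 15)) (.query (.var 15) (.var 10))) ;;
      minLoop 11 (.setReal 4 (.sub (.get 3 (cellAddr 15 11)) (.query (.var 11) (.var 10)))) ;;
      .putReal 0 (.var 10) (.div (.sub (.get 3 (cellAddr 15 10)) (.var 3)) (.lit 2)))

theorem halts_starProgram (h : Env n s) (hn : 0 < n) {t : ℝ}
    (hs : ∀ i < n, ∀ j < n, s.realArr 3 (i * n + j) = arcClosure d n t i j) :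
    Halts d starProgram s (2 + (n * ((10 + ((n * 25 + 7) + 11)) + 9) + 7))
      (fun s' => ∀ v < n, s'.realArr 0 v = starOfArcClosure d n t v) := by
  refine Halts.seq (R := fun s' => s' = s.setI 15 0) (Halts.exec rfl le_rfl rfl) fun s1 e hu1 => ?_
  subst e
  have h1 : Env n (s.setI 15 0) := h.of_unchanged hu1 rfl rfl rfl
  refine (Halts.forLoop h1.size rfl rfl (by decide)
    (fun k s' => ∀ v < k, s'.realArr 0 v = starOfArcClosure d n t v)
    (by simp) ?_).mono le_rfl fun s' h _ => h.1
  intro v hv s' hu h10 hI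
  have h' : Env n s' := h1.of_unchanged hu rfl rfl rfl
  have e15 : s'.intVar 15 = 0 := by rw [hu.intVar 15 rfl]; simp
  have e3 : s'.realArr 3 = s.realArr 3 := hu.realArr 3 rfl
  have r0 : s'.intArr 0 0 = 0 := by simpa using h'.row 0 hn
  have hs0 : ∀ j < n, s.realArr 3 j = arcClosure d n t 0 j := fun j hj => by
    simpa using hs 0 hn j hj
  refine Halts.seq (R := fun s' => s'.realVar 3 = arcClosure d n t 0 0 - d 0 v)
    (Halts.exec rfl (by decide) ?_) fun s2 hr hu2 => ?_
  · simp [Program.exec, IntExp.eval, RealExp.eval, cellAddr, h10, e15, e3, r0, hs0 0 hn]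
  refine Halts.seq (Halts.minLoop (B := 10) (h'.of_unchanged hu2 rfl rfl rfl) hr (by decide) rfl rfl
    rfl (f := fun u => arcClosure d n t 0 u - d u v) ?_) fun s3 hm hu3 => ?_
  · intro u hu s3 hu3 h11
    refine Halts.exec rfl (by decide) ?_
    have f10 : s3.intVar 10 = v := ((hu3.intVar 10 rfl).trans (hu2.intVar 10 rfl)).trans h10
    have f15 : s3.intVar 15 = 0 := ((hu3.intVar 15 rfl).trans (hu2.intVar 15 rfl)).trans e15
    have f3 : s3.realArr 3 = s.realArr 3 :=
      ((hu3.realArr 3 rfl).trans (hu2.realArr 3 rfl)).trans e3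
    have f0 : s3.intArr 0 = s'.intArr 0 := (hu3.intArr 0 rfl).trans (hu2.intArr 0 rfl)
    simp [Program.exec, IntExp.eval, RealExp.eval, cellAddr, f10, f15, f3, f0, r0, h11, hs0 u hu]
  · refine Halts.exec rfl (by decide) ?_
    have f10 : s3.intVar 10 = v := ((hu3.intVar 10 rfl).trans (hu2.intVar 10 rfl)).trans h10
    have f15 : s3.intVar 15 = 0 := ((hu3.intVar 15 rfl).trans (hu2.intVar 15 rfl)).trans e15
    have f3 : s3.realArr 3 = s.realArr 3 :=
      ((hu3.realArr 3 rfl).trans (hu2.realArr 3 rfl)).trans e3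
    have f0 : s3.intArr 0 = s'.intArr 0 := (hu3.intArr 0 rfl).trans (hu2.intArr 0 rfl)
    have g0 : s3.realArr 0 = s'.realArr 0 := (hu3.realArr 0 rfl).trans (hu2.realArr 0 rfl)
    intro w hw
    simp only [Program.exec, IntExp.eval, RealExp.eval, cellAddr, f10, f15, f3, f0, r0, hm, zero_add,
      hs0 v hv, State.setI_realArr, State.putR_realArr_self, g0]
    split_ifs with hwv
    · subst hwv; simp [starOfArcClosure]
    · exact hI w (by omega)

/-! ### Merge sort -/

/-- The sequence `a` is increasing on each of the blocks of length `w` of the indices below `m`. -/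
def SortedBlocks (w m : ℕ) (a : ℕ → ℝ) : Prop :=
  ∀ x y, x ≤ y → y < m → x / w = y / w → a x ≤ a y

/-- The state of merging the blocks `[lo, iEnd)` and `[mid, jEnd)` of `a` into `b`: the entries of
`b` from `lo` to `k` are those of `a` from `lo` to `i` and from `mid` to `j`. That `b` is a
rearrangement of these is expressed by sums over arbitrary functions. -/
structure MergeInv (a b : ℕ → ℝ) (lo mid iEnd jEnd i j k : ℕ) : Prop where
  le_i : lo ≤ i
  i_le : i ≤ iEnd
  le_j : mid ≤ j
  j_le : j ≤ jEnd ∨ j = mid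
  k_eq : k + mid = i + j
  sums : ∀ f : ℝ → ℕ, ∑ x ∈ Finset.Ico lo k, f (b x) =
    ∑ x ∈ Finset.Ico lo i, f (a x) + ∑ x ∈ Finset.Ico mid j, f (a x)
  sorted : ∀ x y, lo ≤ x → x ≤ y → y < k → b x ≤ b y
  le_left : ∀ x y, lo ≤ x → x < k → i ≤ y → y < iEnd → b x ≤ a y
  le_right : ∀ x y, lo ≤ x → x < k → j ≤ y → y < jEnd → b x ≤ a y

namespace MergeInv

variable {a b b' : ℕ → ℝ} {lo mid iEnd jEnd i j k : ℕ}

theorem init (a b : ℕ → ℝ) {lo mid iEnd : ℕ} (jEnd : ℕ) (h : lo ≤ iEnd) :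
    MergeInv a b lo mid iEnd jEnd lo mid lo where
  le_i := le_rfl
  i_le := h
  le_j := le_rfl
  j_le := .inr rfl
  k_eq := rfl
  sums := by simp
  sorted := by intros; omega
  le_left := by intros; omega
  le_right := by intros; omega

theorem left (h : MergeInv a b lo mid iEnd jEnd i j k) (hi : i < iEnd)
    (ha : ∀ x y, lo ≤ x → x ≤ y → y < iEnd → a x ≤ a y)
    (ha' : ∀ x y, mid ≤ x → x ≤ y → y < jEnd → a x ≤ a y)
    (hle : j < jEnd → a i ≤ a j) (hk : b' k = a i) (hb : ∀ x, x ≠ k → b' x = b x) :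
    MergeInv a b' lo mid iEnd jEnd (i + 1) j (k + 1) := by
  obtain ⟨le_i, i_le, le_j, j_le, k_eq, sums, sorted, le_left, le_right⟩ := h
  have hlk : lo ≤ k := by omega
  refine ⟨by omega, by omega, le_j, j_le, by omega, fun f => ?_, fun x y hx hxy hy => ?_,
    fun x y hx hxk hy hy' => ?_, fun x y hx hxk hy hy' => ?_⟩
  · rw [Finset.sum_Ico_succ_top hlk, Finset.sum_Ico_succ_top le_i, hk, add_right_comm, ← sums f]
    congr 1
    refine Finset.sum_congr rfl fun x hx => ?_
    rw [hb x (by have := Finset.mem_Ico.1 hx; omega)]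
  · rcases Nat.lt_succ_iff_lt_or_eq.1 hy with hy | rfl
    · rw [hb x (by omega), hb y (by omega)]
      exact sorted x y hx hxy hy
    · rw [hk]
      rcases hxy.lt_or_eq with hxy | rfl
      · rw [hb x (by omega)]
        exact le_left x i hx hxy le_rfl hi
      · rw [hk]
  · rcases Nat.lt_succ_iff_lt_or_eq.1 hxk with hxk | rfl
    · rw [hb x (by omega)]
      exact le_left x y hx hxk (by omega) hy'
    · rw [hk]
      exact ha i y le_i (by omega) hy'
  · rcases Nat.lt_succ_iff_lt_or_eq.1 hxk with hxk | rfl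
    · rw [hb x (by omega)]
      exact le_right x y hx hxk hy hy'
    · rw [hk]
      exact (hle (by omega)).trans (ha' j y le_j hy hy')

theorem right (h : MergeInv a b lo mid iEnd jEnd i j k) (hj : j < jEnd)
    (ha : ∀ x y, lo ≤ x → x ≤ y → y < iEnd → a x ≤ a y)
    (ha' : ∀ x y, mid ≤ x → x ≤ y → y < jEnd → a x ≤ a y)
    (hle : i < iEnd → a j ≤ a i) (hk : b' k = a j) (hb : ∀ x, x ≠ k → b' x = b x) :
    MergeInv a b' lo mid iEnd jEnd i (j + 1) (k + 1) := by
  obtain ⟨le_i, i_le, le_j, j_le, k_eq, sums, sorted, le_left, le_right⟩ := h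
  have hlk : lo ≤ k := by omega
  refine ⟨le_i, i_le, by omega, .inl (by omega), by omega, fun f => ?_, fun x y hx hxy hy => ?_,
    fun x y hx hxk hy hy' => ?_, fun x y hx hxk hy hy' => ?_⟩
  · rw [Finset.sum_Ico_succ_top hlk, Finset.sum_Ico_succ_top le_j, hk, ← add_assoc, ← sums f]
    congr 1
    refine Finset.sum_congr rfl fun x hx => ?_
    rw [hb x (by have := Finset.mem_Ico.1 hx; omega)]
  · rcases Nat.lt_succ_iff_lt_or_eq.1 hy with hy | rfl
    · rw [hb x (by omega), hb y (by omega)]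
      exact sorted x y hx hxy hy
    · rw [hk]
      rcases hxy.lt_or_eq with hxy | rfl
      · rw [hb x (by omega)]
        exact le_right x j hx hxy le_rfl hj
      · rw [hk]
  · rcases Nat.lt_succ_iff_lt_or_eq.1 hxk with hxk | rfl
    · rw [hb x (by omega)]
      exact le_left x y hx hxk hy hy'
    · rw [hk]
      exact (hle (by omega)).trans (ha i y le_i hy hy')
  · rcases Nat.lt_succ_iff_lt_or_eq.1 hxk with hxk | rfl
    · rw [hb x (by omega)]
      exact le_right x y hx hxk (by omega) hy'
    · rw [hk]
      exact ha' j y le_j (by omega) hy'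

end MergeInv

/-- The test whether the variable `x` is less than the variable `y`. -/
def ltTest (x y : ℕ) : Test := .not (.intLE (.var y) (.var x))

/-- One step of merging: move the smaller one of the entries at the addresses in the variables `22`
and `23` from the array `7` to the array `8`. -/
def mergeStep : Program :=
  .ite (.and (ltTest 22 25)
      (.not (.and (ltTest 23 26) (.not (.realLE (.get 7 (.var 22)) (.get 7 (.var 23)))))))
    (.putReal 8 (.var 24) (.get 7 (.var 22)) ;; .setInt 22 (.add (.var 22) (.lit 1)))
    (.putReal 8 (.var 24) (.get 7 (.var 23)) ;; .setInt 23 (.add (.var 23) (.lit 1))) ;;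
  .setInt 24 (.add (.var 24) (.lit 1))

/-- The minimum of the variables `x` and `7` becomes the value of `x`. -/
def clampProgram (x : ℕ) : Program := .ite (.intLE (.var 7) (.var x)) (.setInt x (.var 7)) .skip

/-- Merge two blocks whose length is held by the variable `20`. The first one starts at the address
in the variable `21`; the blocks end at the latest at the address in the variable `7`. -/
def mergeBlocks : Program :=
  (.setInt 22 (.var 21) ;; .setInt 23 (.add (.var 21) (.var 20)) ;; .setInt 24 (.var 21) ;;
    .setInt 25 (.var 23) ;; .setInt 26 (.add (.var 23) (.var 20)) ;;
    clampProgram 25 ;; clampProgram 26) ;;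
  .loop (ltTest 24 26) mergeStep

/-- Merge all pairs of neighboring blocks of the array `7`, with the result in the array `8`. -/
def mergePass : Program :=
  .setInt 21 (.lit 0) ;;
  .loop (ltTest 21 7) (mergeBlocks ;; .setInt 21 (.add (.add (.var 21) (.var 20)) (.var 20)))

/-- Sort the first entries of the array `7`; their number is held by the variable `7`, and at most
`2` to the power of the variable `3`. -/
def sortProgram : Program :=
  .setInt 20 (.lit 1) ;;
  forLoop 27 3 (mergePass ;; forLoop 24 7 (.putReal 7 (.var 24) (.get 8 (.var 24))) ;;
    .setInt 20 (.add (.var 20) (.var 20)))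

variable {d : ℕ → ℕ → ℝ} {s : State}

theorem holds_ltTest {x y : ℕ} : (ltTest x y).Holds d s ↔ s.intVar x < s.intVar y := by
  simp [ltTest, Test.Holds, IntExp.eval]

theorem halts_mergeBlocks {P w q : ℕ} (hP : s.intVar 7 = P) (hw : s.intVar 20 = w) (hw0 : 0 < w)
    (hq : s.intVar 21 = q) (hqP : q < P)
    (h1 : ∀ x y, q ≤ x → x ≤ y → y < min (q + w) P → s.realArr 7 x ≤ s.realArr 7 y)
    (h2 : ∀ x y, q + w ≤ x → x ≤ y → y < min (q + w + w) P → s.realArr 7 x ≤ s.realArr 7 y) :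
    Halts d mergeBlocks s (30 + ((min (q + w + w) P - q) * 40 + 5)) (fun s' =>
      (∀ x y, q ≤ x → x ≤ y → y < min (q + w + w) P → s'.realArr 8 x ≤ s'.realArr 8 y) ∧
      (∀ f : ℝ → ℕ, ∑ x ∈ Finset.Ico q (min (q + w + w) P), f (s'.realArr 8 x) =
        ∑ x ∈ Finset.Ico q (min (q + w + w) P), f (s.realArr 7 x)) ∧
      ∀ x < q, s'.realArr 8 x = s.realArr 8 x) := by
  refine Halts.seq (R := fun s' => s'.intVar 22 = q ∧ s'.intVar 23 = q + w ∧ s'.intVar 24 = q ∧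
    s'.intVar 25 = min (q + w) P ∧ s'.intVar 26 = min (q + w + w) P)
    (Halts.exec rfl (by decide) ?_) ?_
  · simp only [Program.exec, clampProgram, Test.Holds, IntExp.eval, hP, hw, hq, ne_eq,
      Nat.reduceEqDiff, not_false_eq_true, State.setI_intVar_self,
      State.setI_intVar_of_ne]
    split_ifs <;> simp [hP] at * <;> omega
  rintro s1 ⟨e22, e23, e24, e25, e26⟩ hu1
  have ea : s1.realArr 7 = s.realArr 7 := hu1.realArr 7 rfl
  have eb : s1.realArr 8 = s.realArr 8 := hu1.realArr 8 rfl
  refine (Halts.loop (fun s' => MergeInv (s.realArr 7) (s'.realArr 8) q (q + w) (min (q + w) P)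
      (min (q + w + w) P) (s'.intVar 22) (s'.intVar 23) (s'.intVar 24) ∧
      ∀ x < q, s'.realArr 8 x = s.realArr 8 x)
    (fun s' => (min (q + w + w) P - s'.intVar 24) * 40 + 5) ?_ ?_ ?_).mono ?_ ?_
  · rw [e22, e23, e24, eb]
    exact ⟨.init _ _ _ (by omega), fun _ _ => rfl⟩
  · rintro s2 hu2 ⟨hI, hlow⟩ hlt
    have f25 : s2.intVar 25 = min (q + w) P := (hu2.intVar 25 rfl).trans e25
    have f26 : s2.intVar 26 = min (q + w + w) P := (hu2.intVar 26 rfl).trans e26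
    have fa : s2.realArr 7 = s.realArr 7 := (hu2.realArr 7 rfl).trans ea
    rw [holds_ltTest, f26] at hlt
    have hk := hI.k_eq
    have hi := hI.le_i
    have hj := hI.le_j
    have hi' := hI.i_le
    have hj' := hI.j_le
    refine ⟨34, Halts.exec rfl (by decide) ?_⟩
    simp only [mergeStep, Program.exec, Test.Holds, holds_ltTest, RealExp.eval, IntExp.eval, f25, f26,
      fa]
    split_ifs with hc
    · simp only [ne_eq, Nat.reduceEqDiff, not_false_eq_true,
        State.setI_intVar_self, State.setI_intVar_of_ne, State.setI_realArr, State.putR_intVar]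
      refine ⟨⟨hI.left hc.1 h1 h2 (fun h => ?_) ?_ ?_, ?_⟩, ?_⟩
      · by_contra hn
        exact hc.2 ⟨h, hn⟩
      · simp
      · intro x hx
        simp [hx]
      · intro x hx
        rw [State.putR_realArr_self, if_neg (by omega)]
        exact hlow x hx
      · simp only [ltTest, Test.cost, IntExp.cost]; omega
    · have hjlt : s2.intVar 23 < min (q + w + w) P := by
        by_contra hn
        exact hc ⟨by omega, fun h => hn h.1⟩
      simp only [ne_eq, Nat.reduceEqDiff, not_false_eq_true,
        State.setI_intVar_self, State.setI_intVar_of_ne, State.setI_realArr, State.putR_intVar]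
      refine ⟨⟨hI.right hjlt h1 h2 (fun h => ?_) ?_ ?_, ?_⟩, ?_⟩
      · by_contra hn
        exact hc ⟨h, fun h' => h'.2 (by linarith)⟩
      · simp
      · intro x hx
        simp [hx]
      · intro x hx
        rw [State.putR_realArr_self, if_neg (by omega)]
        exact hlow x hx
      · simp only [ltTest, Test.cost, IntExp.cost]; omega
  · intro s2 _ _
    simp [ltTest, Test.cost, IntExp.cost]
  · rw [e24]
  · rintro s2 ⟨⟨hI, hlow⟩, hlt⟩ hu2
    have f26 : s2.intVar 26 = min (q + w + w) P := (hu2.intVar 26 rfl).trans e26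
    rw [holds_ltTest, f26] at hlt
    have hk := hI.k_eq
    have hi := hI.le_i
    have hj := hI.le_j
    have hi' := hI.i_le
    have hj' := hI.j_le
    have hk' : s2.intVar 24 = min (q + w + w) P := by omega
    refine ⟨fun x y hx hxy hy => hI.sorted x y hx hxy (by omega), fun f => ?_, hlow⟩
    rw [← hk', hI.sums f]
    rcases le_total (q + w) P with h | h
    · rw [show s2.intVar 22 = q + w by omega, show s2.intVar 23 = s2.intVar 24 by omega,
        Finset.sum_Ico_consecutive _ (by omega) (by omega)]
    · rw [show s2.intVar 22 = s2.intVar 24 by omega, show s2.intVar 23 = q + w by omega]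
      simp

theorem halts_mergePass {P w : ℕ} (hP : s.intVar 7 = P) (hw : s.intVar 20 = w) (hw0 : 0 < w)
    (h : SortedBlocks w P (s.realArr 7)) :
    Halts d mergePass s (P * 90 + 7) (fun s' => SortedBlocks (w + w) P (s'.realArr 8) ∧
      ∀ f : ℝ → ℕ, ∑ x ∈ Finset.range P, f (s'.realArr 8 x) =
        ∑ x ∈ Finset.range P, f (s.realArr 7 x)) := by
  refine (Halts.seq (B := 2) (B' := P * 90 + 5) (R := fun s' => s' = s.setI 21 0)
    (Halts.exec rfl le_rfl rfl) fun s1 e hu1 => ?_).mono (by omega) fun s' h _ => h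
  subst e
  -- Each block contains at least one entry, so the cost per block is charged to the entries.
  refine (Halts.loop (fun s' => ∃ m, s'.intVar 21 = m * (w + w) ∧
      SortedBlocks (w + w) (min (s'.intVar 21) P) (s'.realArr 8) ∧
      ∀ f : ℝ → ℕ, ∑ x ∈ Finset.range (min (s'.intVar 21) P), f (s'.realArr 8 x) =
        ∑ x ∈ Finset.range (min (s'.intVar 21) P), f (s.realArr 7 x))
    (fun s' => (P - s'.intVar 21) * 90 + 5) ?_ ?_ ?_).mono (by simp) ?_
  · refine ⟨0, by simp, ?_, by simp⟩
    intro x y _ hy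
    simp at hy
  · rintro s2 hu2 ⟨m, hm, hS, hsum⟩ hlt
    have f7 : s2.intVar 7 = P := by rw [hu2.intVar 7 rfl]; simpa using hP
    have f20 : s2.intVar 20 = w := by rw [hu2.intVar 20 rfl]; simpa using hw
    have fa : s2.realArr 7 = s.realArr 7 := hu2.realArr 7 rfl
    rw [holds_ltTest, f7] at hlt
    set q := s2.intVar 21 with hq
    have div_eq : ∀ x c, c * w ≤ x → x < c * w + w → x / w = c := fun x c h1 h2 =>
      Nat.div_eq_of_lt_le h1 (by rw [Nat.succ_mul]; exact h2)
    refine ⟨_, (halts_mergeBlocks f7 f20 hw0 rfl hlt ?_ ?_).seq fun s3 h3 hu3 =>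
      Halts.exec (B := 6) rfl (by decide) ?_⟩
    · intro x y hx hxy hy
      rw [fa]
      have e : q = (2 * m) * w := by rw [hm]; ring
      exact h x y hxy (by omega) ((div_eq x (2 * m) (by omega) (by omega)).trans
        (div_eq y (2 * m) (by omega) (by omega)).symm)
    · intro x y hx hxy hy
      rw [fa]
      have e : q + w = (2 * m + 1) * w := by rw [hm]; ring
      exact h x y hxy (by omega) ((div_eq x (2 * m + 1) (by omega) (by omega)).trans
        (div_eq y (2 * m + 1) (by omega) (by omega)).symm)
    · obtain ⟨h3, h4, h5⟩ := h3
      have g20 : s3.intVar 20 = w := (hu3.intVar 20 rfl).trans f20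
      have g21 : s3.intVar 21 = q := hu3.intVar 21 rfl
      simp only [Program.exec, IntExp.eval, g20, g21, State.setI_intVar_self, State.setI_realArr]
      rw [min_eq_left hlt.le] at hS hsum
      refine ⟨⟨m + 1, by rw [hm]; ring, ?_, ?_⟩, ?_⟩
      · intro x y hxy hy hd
        rcases lt_or_ge y q with hyq | hyq
        · rw [h5 x (by omega), h5 y hyq]
          exact hS x y hxy hyq hd
        · have e : y / (w + w) = m := Nat.div_eq_of_lt_le (by omega) (by rw [Nat.succ_mul]; omega)
          have := Nat.div_mul_le_self x (w + w)
          rw [hd, e, ← hm] at this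
          exact h3 x y this hxy hy
      · intro f
        have hle : q ≤ min (q + w + w) P := by omega
        rw [← Finset.sum_range_add_sum_Ico _ hle, ← Finset.sum_range_add_sum_Ico _ hle, h4 f, fa,
          ← hsum f]
        congr 1
        exact Finset.sum_congr rfl fun x hx => by rw [h5 x (Finset.mem_range.1 hx)]
      · simp only [ltTest, Test.cost, IntExp.cost]
        omega
  · intro s2 _ _
    simp [ltTest, Test.cost, IntExp.cost]
  · rintro s2 ⟨⟨m, hm, hS, hsum⟩, hlt⟩ hu2
    have f7 : s2.intVar 7 = P := by rw [hu2.intVar 7 rfl]; simpa using hP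
    rw [holds_ltTest, f7] at hlt
    rw [min_eq_right (by omega)] at hS hsum
    exact ⟨hS, hsum⟩

theorem halts_sortProgram {P K : ℕ} (hP : s.intVar 7 = P) (hK : s.intVar 3 = K)
    (hPK : P ≤ 2 ^ K) :
    Halts d sortProgram s (2 + (K * (P * 103 + 27) + 7)) (fun s' =>
      (∀ x y, x ≤ y → y < P → s'.realArr 7 x ≤ s'.realArr 7 y) ∧
      ∀ f : ℝ → ℕ, ∑ x ∈ Finset.range P, f (s'.realArr 7 x) =
        ∑ x ∈ Finset.range P, f (s.realArr 7 x)) := by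
  refine Halts.seq (R := fun s' => s' = s.setI 20 1) (Halts.exec rfl le_rfl rfl) fun s1 e hu1 => ?_
  subst e
  refine (Halts.forLoop (B := P * 103 + 18) (by simpa using hK) rfl rfl (by decide)
    (fun k s' => s'.intVar 20 = 2 ^ k ∧ SortedBlocks (2 ^ k) P (s'.realArr 7) ∧
      ∀ f : ℝ → ℕ, ∑ x ∈ Finset.range P, f (s'.realArr 7 x) =
        ∑ x ∈ Finset.range P, f (s.realArr 7 x)) ?_ ?_).mono (by ring_nf; omega) ?_
  · refine ⟨by simp, fun x y hxy hy hd => ?_, by simp⟩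
    have : x = y := by simpa using hd
    rw [this]
  · rintro k hk s2 hu2 - ⟨h20, hS, hsum⟩
    have f7 : s2.intVar 7 = P := by rw [hu2.intVar 7 rfl]; simpa using hP
    refine ((halts_mergePass f7 h20 (by positivity) hS).seq fun s3 h3 hu3 =>
      Halts.seq (Halts.forLoop (B := 4) ((hu3.intVar 7 rfl).trans f7) rfl rfl (by decide)
        (fun k s' => ∀ x < k, s'.realArr 7 x = s3.realArr 8 x) (by simp) ?_)
      fun s4 h4 hu4 => Halts.exec (B := 4) rfl le_rfl ?_).mono (by omega) fun _ h _ => h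
    · intro l hl s4 hu4 h24 hI
      refine Halts.exec rfl le_rfl ?_
      have e8 : s4.realArr 8 = s3.realArr 8 := hu4.realArr 8 rfl
      intro x hx
      simp only [Program.exec, IntExp.eval, RealExp.eval, State.setI_realArr,
        State.putR_realArr_self, h24, e8]
      split_ifs with h
      · rw [h]
      · exact hI x (by omega)
    · have e20 : s4.intVar 20 = 2 ^ k :=
        ((hu4.intVar 20 rfl).trans (hu3.intVar 20 rfl)).trans h20
      have h4 := h4.1
      simp only [Program.exec, IntExp.eval, e20, ne_eq, Nat.reduceEqDiff,
        not_false_eq_true, State.setI_intVar_self, State.setI_intVar_of_ne, State.setI_realArr]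
      refine ⟨by ring, fun x y hxy hy hd => ?_, fun f => ?_⟩
      · rw [h4 x (by omega), h4 y hy]
        rw [pow_succ, mul_two] at hd
        exact h3.1 x y hxy hy hd
      · rw [← hsum f, ← h3.2 f]
        exact Finset.sum_congr rfl fun x hx => by rw [h4 x (Finset.mem_range.1 hx)]
  · rintro s2 ⟨⟨-, hS, hsum⟩, -⟩ -
    refine ⟨fun x y hxy hy => hS x y hxy hy ?_, hsum⟩
    rw [Nat.div_eq_of_lt (by omega), Nat.div_eq_of_lt (by omega)]

/-! ### Lists of lines in arrays -/

/-- The line stored at the address `x`: the integer array `1` holds its group, the real arrays `5`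
and `6` hold its coefficients. -/
def State.line (s : State) (x : ℕ) : Line := ⟨s.intArr 1 x, s.realArr 5 x, s.realArr 6 x⟩

/-- The `m` lines stored from the address `b` on. -/
def State.lines (s : State) (b m : ℕ) : List Line := (List.range' b m).map s.line

theorem State.lines_succ (s : State) (b m : ℕ) :
    s.lines b (m + 1) = s.line b :: s.lines (b + 1) m := by
  simp [State.lines, List.range'_succ]

theorem State.lines_succ_last (s : State) (b m : ℕ) :
    s.lines b (m + 1) = s.lines b m ++ [s.line (b + m)] := by
  simp [State.lines, List.range'_concat]

@[simp] theorem State.length_lines (s : State) (b m : ℕ) : (s.lines b m).length = m := by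
  simp [State.lines]

theorem State.lines_congr {s s' : State} {b m : ℕ}
    (h : ∀ x, b ≤ x → x < b + m → s'.line x = s.line x) : s'.lines b m = s.lines b m := by
  refine List.map_congr_left fun x hx => ?_
  rw [List.mem_range'_1] at hx
  exact h x hx.1 hx.2

@[simp] theorem State.line_setI (s : State) (x v : ℕ) : (s.setI x v).line = s.line := rfl

@[simp] theorem State.lines_setI (s : State) (x v b m : ℕ) :
    (s.setI x v).lines b m = s.lines b m := rfl

theorem Unchanged.lines {p : Program} {s s' : State} (h : Unchanged p s s')
    (h1 : p.writesIntArr 1 = false) (h5 : p.writesRealArr 5 = false)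
    (h6 : p.writesRealArr 6 = false) : s'.line = s.line := by
  funext x
  simp only [State.line, h.intArr 1 h1, h.realArr 5 h5, h.realArr 6 h6]

/-- The test whether there are lines at the addresses `x` and `y = x + 1`, held by the variables
`30` and `31`, and whether they are in the same group. The variable `6` holds the number of lines. -/
def pairTest : Test :=
  .and (ltTest 31 6) (.and (.intLE (.get 1 (.var 30)) (.get 1 (.var 31)))
    (.intLE (.get 1 (.var 31)) (.get 1 (.var 30))))

/-- The crossing of the lines at the addresses held by the variables `30` and `31`. -/
def crossingExp : RealExp :=
  .div (.sub (.get 5 (.var 31)) (.get 5 (.var 30))) (.sub (.get 6 (.var 30)) (.get 6 (.var 31)))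

variable {d : ℕ → ℕ → ℝ} {s : State}

theorem holds_pairTest : pairTest.Holds d s ↔ s.intVar 31 < s.intVar 6 ∧
    (s.line (s.intVar 30)).grp = (s.line (s.intVar 31)).grp := by
  simp [pairTest, Test.Holds, holds_ltTest, IntExp.eval, State.line, le_antisymm_iff]

theorem eval_crossingExp :
    crossingExp.eval d s = (s.line (s.intVar 30)).crossing (s.line (s.intVar 31)) := by
  simp [crossingExp, RealExp.eval, IntExp.eval, State.line, Line.crossing]

/-- Put the list `Line.crossings` of the lines into the array `7`, and its length into
the variable `7`. -/
def crossingsProgram : Program :=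
  (.setInt 30 (.lit 0) ;; .setInt 7 (.lit 0)) ;;
  .loop (ltTest 30 6)
    (.setInt 31 (.add (.var 30) (.lit 1)) ;;
      .ite pairTest
        (.putReal 7 (.var 7) crossingExp ;; .setInt 7 (.add (.var 7) (.lit 1)) ;;
          .setInt 30 (.add (.var 31) (.lit 1)))
        (.setInt 30 (.var 31)))

theorem crossings_lines_pair {x m : ℕ} (h : (s.line x).grp = (s.line (x + 1)).grp) :
    Line.crossings (s.lines x (m + 2)) =
      (s.line x).crossing (s.line (x + 1)) :: Line.crossings (s.lines (x + 2) m) := by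
  rw [State.lines_succ, State.lines_succ, Line.crossings, if_pos h]

/-- An unpaired line has no partner, either because it is the last one or because the next one is in
another group. -/
theorem crossings_lines_single {x m : ℕ}
    (h : ¬ (0 < m ∧ (s.line x).grp = (s.line (x + 1)).grp)) :
    Line.crossings (s.lines x (m + 1)) = Line.crossings (s.lines (x + 1) m) := by
  cases m with
  | zero => simp [State.lines, Line.crossings]
  | succ m =>
    rw [State.lines_succ, State.lines_succ, Line.crossings, if_neg fun e => h ⟨by omega, e⟩]

theorem prune_lines_pair {lo hi : ℝ} {x m : ℕ} (h : (s.line x).grp = (s.line (x + 1)).grp) :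
    Line.prune lo hi (s.lines x (m + 2)) =
      Line.survivors lo hi (s.line x) (s.line (x + 1)) ++ Line.prune lo hi (s.lines (x + 2) m) := by
  rw [State.lines_succ, State.lines_succ, Line.prune, if_pos h]

theorem prune_lines_single {lo hi : ℝ} {x m : ℕ}
    (h : ¬ (0 < m ∧ (s.line x).grp = (s.line (x + 1)).grp)) :
    Line.prune lo hi (s.lines x (m + 1)) =
      s.line x :: Line.prune lo hi (s.lines (x + 1) m) := by
  cases m with
  | zero => simp [State.lines, Line.prune]
  | succ m =>
    rw [State.lines_succ, State.lines_succ, Line.prune, if_neg fun e => h ⟨by omega, e⟩]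

theorem halts_crossingsProgram {N : ℕ} (hN : s.intVar 6 = N) :
    Halts d crossingsProgram s (4 + (N * 60 + 5)) (fun s' =>
      (List.range (s'.intVar 7)).map (s'.realArr 7) = Line.crossings (s.lines 0 N) ∧
      s'.intVar 7 ≤ N) := by
  refine Halts.seq (R := fun s' => s' = (s.setI 30 0).setI 7 0)
    (Halts.exec rfl le_rfl rfl) fun s1 e hu1 => ?_
  subst e
  refine (Halts.loop (fun s' => s'.intVar 30 ≤ N ∧ s'.intVar 7 ≤ s'.intVar 30 ∧
      (List.range (s'.intVar 7)).map (s'.realArr 7) ++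
        Line.crossings (s.lines (s'.intVar 30) (N - s'.intVar 30)) =
      Line.crossings (s.lines 0 N))
    (fun s' => (N - s'.intVar 30) * 60 + 5) ?_ ?_ ?_).mono (by simp) ?_
  · simp
  · rintro s2 hu2 ⟨hle, h7, hI⟩ hlt
    have f6 : s2.intVar 6 = N := by rw [hu2.intVar 6 rfl]; simpa using hN
    have fl : s2.line = s.line := hu2.lines rfl rfl rfl
    rw [holds_ltTest, f6] at hlt
    obtain ⟨m, hm⟩ := Nat.exists_eq_add_of_lt hlt
    rw [show N - s2.intVar 30 = m + 1 by omega] at hI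
    refine ⟨50, (Halts.exec (B := 4) (Q := fun s' => s' = s2.setI 31 (s2.intVar 30 + 1)) rfl
      (by decide) rfl).seq (B' := 46) fun s3 e hu3 => Halts.exec rfl (by decide) ?_⟩
    subst e
    simp only [Program.exec, holds_pairTest, eval_crossingExp]
    simp only [ne_eq, Nat.reduceEqDiff, not_false_eq_true,
      State.setI_intVar_self, State.setI_intVar_of_ne, f6]
    have fl' : (s2.setI 31 (s2.intVar 30 + 1)).line = s.line := fl
    rw [fl']
    split_ifs with hc
    · obtain ⟨k, rfl⟩ := Nat.exists_eq_add_of_lt (show 0 < m by omega)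
      rw [show 0 + k + 1 + 1 = k + 2 by omega, crossings_lines_pair hc.2] at hI
      simp only [ne_eq, Nat.reduceEqDiff, not_false_eq_true,
        State.setI_intVar_self, State.setI_intVar_of_ne, State.setI_realArr, State.putR_intVar,
        IntExp.eval]
      refine ⟨⟨by omega, by omega, ?_⟩, ?_⟩
      · rw [show N - (s2.intVar 30 + 1 + 1) = k by omega, ← hI, List.range_succ, List.map_append,
          List.append_assoc]
        congr 1
        · refine List.map_congr_left fun x hx => ?_
          have := List.mem_range.1 hx
          rw [State.putR_realArr_self, if_neg (by omega), State.setI_realArr]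
        · simp
      · simp only [ltTest, Test.cost, IntExp.cost]
        omega
    · rw [crossings_lines_single (by rintro ⟨h1, h2⟩; exact hc ⟨by omega, h2⟩)] at hI
      simp only [ne_eq, Nat.reduceEqDiff, not_false_eq_true,
        State.setI_intVar_self, State.setI_intVar_of_ne, State.setI_realArr, IntExp.eval]
      refine ⟨⟨by omega, by omega, ?_⟩, ?_⟩
      · rw [show N - (s2.intVar 30 + 1) = m by omega, ← hI]
      · simp only [ltTest, Test.cost, IntExp.cost]
        omega
  · intro s2 _ _
    simp [ltTest, Test.cost, IntExp.cost]
  · rintro s2 ⟨⟨hle, h7, hI⟩, hlt⟩ hu2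
    have f6 : s2.intVar 6 = N := by rw [hu2.intVar 6 rfl]; simpa using hN
    rw [holds_ltTest, f6] at hlt
    rw [show N - s2.intVar 30 = 0 by omega] at hI
    refine ⟨?_, by omega⟩
    rw [← hI]
    simp [State.lines, Line.crossings]

/-- Copy the line at the address in the variable `x` to the address in the variable `32`, which is
then incremented. -/
def moveLine (x : ℕ) : Program :=
  .putInt 1 (.var 32) (.get 1 (.var x)) ;; .putReal 5 (.var 32) (.get 5 (.var x)) ;;
  .putReal 6 (.var 32) (.get 6 (.var x)) ;; .setInt 32 (.add (.var 32) (.lit 1))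

theorem exec_moveLine_line (x y : ℕ) : ((moveLine x).exec d s).line y =
    if y = s.intVar 32 then s.line (s.intVar x) else s.line y := by
  simp only [moveLine, Program.exec, IntExp.eval, RealExp.eval, State.line, State.setI_intArr,
    State.setI_realArr, State.putR_intArr, State.putR_intVar, State.putI_intVar, ne_eq,
    Nat.reduceEqDiff, not_false_eq_true, State.putR_realArr_self, State.putR_realArr_of_ne,
    State.putI_realArr, State.putI_intArr_self]
  split_ifs <;> rfl

theorem exec_moveLine_intVar (x y : ℕ) (hy : y ≠ 32) :
    ((moveLine x).exec d s).intVar y = s.intVar y := by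
  simp [moveLine, Program.exec, hy]

theorem exec_moveLine_intVar_self (x : ℕ) :
    ((moveLine x).exec d s).intVar 32 = s.intVar 32 + 1 := by
  simp [moveLine, Program.exec, IntExp.eval]

theorem exec_moveLine_realVar (x : ℕ) : ((moveLine x).exec d s).realVar = s.realVar := by
  simp [moveLine, Program.exec]

theorem exec_moveLine_lines (x : ℕ) : ((moveLine x).exec d s).lines 0 (s.intVar 32 + 1) =
    s.lines 0 (s.intVar 32) ++ [s.line (s.intVar x)] := by
  rw [State.lines_succ_last, zero_add, exec_moveLine_line, if_pos rfl]
  congr 1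
  refine State.lines_congr fun y _ hy => ?_
  rw [exec_moveLine_line, if_neg (by omega)]

/-- The value of the line at the address in the variable `x` at the real variable `5`. -/
def valExp (x : ℕ) : RealExp := .add (.get 5 (.var x)) (.mul (.get 6 (.var x)) (.var 5))

/-- Replace the list of lines by the list `Line.prune`, for the interval between the real variables
`0` and `1`. -/
def pruneProgram : Program :=
  (.setInt 30 (.lit 0) ;; .setInt 32 (.lit 0) ;;
    .setReal 5 (.div (.add (.var 0) (.var 1)) (.lit 2))) ;;
  .loop (ltTest 30 6)
    (.setInt 31 (.add (.var 30) (.lit 1)) ;;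
      .ite pairTest
        (.setReal 6 crossingExp ;;
          .ite (.and (.not (.realLE (.var 6) (.var 0))) (.not (.realLE (.var 1) (.var 6))))
            (moveLine 30 ;; moveLine 31)
            (.ite (.realLE (valExp 30) (valExp 31)) (moveLine 30) (moveLine 31)) ;;
          .setInt 30 (.add (.var 31) (.lit 1)))
        (moveLine 30 ;; .setInt 30 (.var 31))) ;;
  .setInt 6 (.var 32)

/-- The body of the loop of `pruneProgram` puts the survivors of a pair behind the lines
kept so far. -/
theorem exec_survivors (hlt : s.intVar 32 ≤ s.intVar 30) (h31 : s.intVar 31 = s.intVar 30 + 1)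
    (h5 : s.realVar 5 = (s.realVar 0 + s.realVar 1) / 2)
    (h6 : s.realVar 6 = (s.line (s.intVar 30)).crossing (s.line (s.intVar 31))) :
    ∃ s', s' = (Program.ite
      (.and (.not (.realLE (.var 6) (.var 0))) (.not (.realLE (.var 1) (.var 6))))
      (moveLine 30 ;; moveLine 31)
      (.ite (.realLE (valExp 30) (valExp 31)) (moveLine 30) (moveLine 31))).exec d s ∧
    s'.intVar 32 ≤ s.intVar 30 + 2 ∧ s'.intVar 31 = s.intVar 31 ∧
    (∀ y, s.intVar 30 + 2 ≤ y → s'.line y = s.line y) ∧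
    s'.lines 0 (s'.intVar 32) = s.lines 0 (s.intVar 32) ++
      Line.survivors (s.realVar 0) (s.realVar 1) (s.line (s.intVar 30))
        (s.line (s.intVar 31)) := by
  refine ⟨_, rfl, ?_⟩
  have hval : ∀ x, (valExp x).eval d s =
      (s.line (s.intVar x)).val ((s.realVar 0 + s.realVar 1) / 2) := fun x => by
    simp [valExp, RealExp.eval, IntExp.eval, State.line, Line.val, h5]
  have hres : (Test.and (.not (.realLE (.var 6) (.var 0))) (.not (.realLE (.var 1) (.var 6)))).Holds
      d s ↔ ¬ ((s.line (s.intVar 30)).crossing (s.line (s.intVar 31)) ≤ s.realVar 0 ∨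
        s.realVar 1 ≤ (s.line (s.intVar 30)).crossing (s.line (s.intVar 31))) := by
    simp [Test.Holds, RealExp.eval, h6]
  simp only [Program.exec, hres]
  unfold Line.survivors
  split_ifs with h1 h2 h3 h3
  · simp only [Test.Holds, hval] at h2
    refine ⟨by rw [exec_moveLine_intVar_self]; omega, exec_moveLine_intVar _ _ (by decide),
      fun y hy => by rw [exec_moveLine_line, if_neg (by omega)], ?_⟩
    rw [exec_moveLine_intVar_self, exec_moveLine_lines]
  · simp only [Test.Holds, hval] at h2
    exact absurd h2 h3
  · simp only [Test.Holds, hval] at h2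
    exact absurd h3 h2
  · refine ⟨by rw [exec_moveLine_intVar_self]; omega, exec_moveLine_intVar _ _ (by decide),
      fun y hy => by rw [exec_moveLine_line, if_neg (by omega)], ?_⟩
    rw [exec_moveLine_intVar_self, exec_moveLine_lines]
  · refine ⟨by rw [exec_moveLine_intVar_self, exec_moveLine_intVar_self]; omega, ?_,
      fun y hy => ?_, ?_⟩
    · rw [exec_moveLine_intVar _ _ (by decide), exec_moveLine_intVar _ _ (by decide)]
    · rw [exec_moveLine_line, exec_moveLine_intVar_self, if_neg (by omega), exec_moveLine_line,
        if_neg (by omega)]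
    · rw [exec_moveLine_intVar_self, exec_moveLine_lines, exec_moveLine_intVar_self,
        exec_moveLine_lines, exec_moveLine_intVar _ _ (by decide), exec_moveLine_line,
        if_neg (by omega), List.append_assoc]
      rfl

theorem halts_pruneProgram {N : ℕ} (hN : s.intVar 6 = N) :
    Halts d pruneProgram s (10 + ((N * 120 + 5) + 2)) (fun s' =>
      s'.lines 0 (s'.intVar 6) = Line.prune (s.realVar 0) (s.realVar 1) (s.lines 0 N)) := by
  refine Halts.seq (R := fun s' => s' = ((s.setI 30 0).setI 32 0).setR 5
    ((s.realVar 0 + s.realVar 1) / 2))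
    (Halts.exec rfl (by decide) (by simp [Program.exec, RealExp.eval, IntExp.eval]))
    fun s1 e hu1 => ?_
  have e30 : s1.intVar 30 = 0 := by simp [e]
  have e32 : s1.intVar 32 = 0 := by simp [e]
  have e5 : s1.realVar 5 = (s.realVar 0 + s.realVar 1) / 2 := by simp [e]
  have el : s1.line = s.line := hu1.lines rfl rfl rfl
  clear e
  refine Halts.seq (R := fun s' => s'.lines 0 (s'.intVar 32) =
    Line.prune (s.realVar 0) (s.realVar 1) (s.lines 0 N)) ((Halts.loop (fun s' =>
      s'.intVar 30 ≤ N ∧ s'.intVar 32 ≤ s'.intVar 30 ∧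
      (∀ y, s'.intVar 30 ≤ y → s'.line y = s.line y) ∧
      s'.realVar 5 = (s.realVar 0 + s.realVar 1) / 2 ∧
      s'.lines 0 (s'.intVar 32) ++ Line.prune (s.realVar 0) (s.realVar 1)
        (s.lines (s'.intVar 30) (N - s'.intVar 30)) =
      Line.prune (s.realVar 0) (s.realVar 1) (s.lines 0 N))
    (fun s' => (N - s'.intVar 30) * 120 + 5) ?_ ?_ ?_).mono (by simp [e30]) ?_)
    fun s2 h2 hu2 => Halts.exec rfl le_rfl ?_
  · rw [e30, e32]
    exact ⟨by omega, le_rfl, fun y _ => by rw [el], e5, rfl⟩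
  · rintro s2 hu2 ⟨hle, h32, hlines, h5, hI⟩ hlt
    have f6 : s2.intVar 6 = N := ((hu2.intVar 6 rfl).trans (hu1.intVar 6 rfl)).trans hN
    have f0 : s2.realVar 0 = s.realVar 0 := (hu2.realVar 0 rfl).trans (hu1.realVar 0 rfl)
    have f1 : s2.realVar 1 = s.realVar 1 := (hu2.realVar 1 rfl).trans (hu1.realVar 1 rfl)
    rw [holds_ltTest, f6] at hlt
    obtain ⟨m, hm⟩ := Nat.exists_eq_add_of_lt hlt
    rw [show N - s2.intVar 30 = m + 1 by omega] at hI
    refine ⟨110, (Halts.exec (B := 4) (Q := fun s' => s' = s2.setI 31 (s2.intVar 30 + 1)) rfl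
      (by decide) rfl).seq (B' := 106) fun s3 e hu3 => ?_⟩
    have g30 : s3.intVar 30 = s2.intVar 30 := hu3.intVar 30 rfl
    have g31 : s3.intVar 31 = s2.intVar 30 + 1 := by simp [e]
    have g32 : s3.intVar 32 = s2.intVar 32 := hu3.intVar 32 rfl
    have gl : s3.line = s2.line := hu3.lines rfl rfl rfl
    have gl' : s3.lines = s2.lines := by
      funext b m
      simp only [State.lines, gl]
    have g6 : s3.intVar 6 = N := (hu3.intVar 6 rfl).trans f6
    have g0 : s3.realVar 0 = s.realVar 0 := (hu3.realVar 0 rfl).trans f0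
    have g1 : s3.realVar 1 = s.realVar 1 := (hu3.realVar 1 rfl).trans f1
    have g5 := (hu3.realVar 5 rfl).trans h5
    have hx := hlines _ le_rfl
    have hy := hlines (s2.intVar 30 + 1) (by omega)
    clear e hu3
    refine (Halts.ite (B := 80) (fun hc => ?_) (fun hc => ?_)).mono (by decide) fun _ h _ => h <;>
      rw [holds_pairTest, g6, g30, g31, gl, hx, hy] at hc
    · obtain ⟨k, rfl⟩ := Nat.exists_eq_add_of_lt (show 0 < m by omega)
      rw [show 0 + k + 1 + 1 = k + 2 by omega, prune_lines_pair hc.2] at hI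
      refine ((Halts.exec (B := 12) (Q := fun s' => s' = s3.setR 6 (crossingExp.eval d s3)) rfl
        (by decide) rfl).seq (B' := 68) fun s4 e hu4 => ?_)
      have k30 : s4.intVar 30 = s2.intVar 30 := (hu4.intVar 30 rfl).trans g30
      have k31 : s4.intVar 31 = s2.intVar 30 + 1 := (hu4.intVar 31 rfl).trans g31
      have k32 : s4.intVar 32 = s2.intVar 32 := (hu4.intVar 32 rfl).trans g32
      have kl : s4.line = s2.line := (hu4.lines rfl rfl rfl).trans gl
      have kl' : s4.lines = s2.lines := by
        funext b m
        simp only [State.lines, kl]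
      have k0 : s4.realVar 0 = s.realVar 0 := (hu4.realVar 0 rfl).trans g0
      have k1 : s4.realVar 1 = s.realVar 1 := (hu4.realVar 1 rfl).trans g1
      have k5 := (hu4.realVar 5 rfl).trans g5
      have k6 : s4.realVar 6 = (s4.line (s4.intVar 30)).crossing (s4.line (s4.intVar 31)) := by
        rw [kl, k30, k31, e, State.setR_realVar_self, eval_crossingExp, gl, g30, g31]
      obtain ⟨s5, hs5, q32, q31, ql, qI⟩ := exec_survivors (d := d) (s := s4) (by omega) (by omega)
        (by rw [k5, k0, k1]) k6
      refine ((Halts.exec (B := 60) (Q := fun s' => s' = s5) rfl (by decide) hs5.symm).seq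
        (B' := 4) fun s6 e6 hu6 => ?_).mono (by omega) fun _ h _ => h
      subst e6
      refine Halts.exec rfl (by decide) ?_
      simp only [Program.exec, IntExp.eval, State.setI_intVar_self, State.setI_realVar, q31, k31, ne_eq,
        Nat.reduceEqDiff, not_false_eq_true, State.setI_intVar_of_ne]
      refine ⟨⟨by omega, by omega, fun y hy => ?_, ?_, ?_⟩, ?_⟩
      · have := ql y (by omega)
        rw [kl, hlines y (by omega)] at this
        exact this
      · rw [hu6.realVar 5 rfl]; exact k5
      · rw [show N - (s2.intVar 30 + 1 + 1) = k by omega, ← hI, ← List.append_assoc]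
        congr 1
        change s6.lines 0 (s6.intVar 32) = _
        rw [qI, kl', k32, k0, k1, kl, k30, k31, hx, hy]
      · simp only [ltTest, Test.cost, IntExp.cost]
        omega
    · rw [prune_lines_single (by rintro ⟨h1, h2⟩; exact hc ⟨by omega, h2⟩)] at hI
      refine Halts.exec rfl (by decide) ?_
      have hcomm : (moveLine 30 ;; Program.setInt 30 (.var 31)).exec d s3 =
        ((moveLine 30).exec d s3).setI 30 (s2.intVar 30 + 1) := by
        simp only [Program.exec, IntExp.eval]
        rw [exec_moveLine_intVar _ _ (by decide), g31]
      rw [hcomm]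
      simp only [State.setI_intVar_self, ne_eq, State.setI_realVar,
        Nat.reduceEqDiff, not_false_eq_true, State.setI_intVar_of_ne, exec_moveLine_intVar_self,
        exec_moveLine_realVar]
      refine ⟨⟨by omega, by omega, fun y hy => ?_, g5, ?_⟩, ?_⟩
      · change ((moveLine 30).exec d s3).line y = _
        rw [exec_moveLine_line, if_neg (by omega), gl, hlines y (by omega)]
      · rw [show N - (s2.intVar 30 + 1) = m by omega, ← hI]
        change ((moveLine 30).exec d s3).lines 0 (s3.intVar 32 + 1) ++ _ = _
        rw [exec_moveLine_lines, gl', gl, g30, g32, hx]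
        simp
      · simp only [ltTest, Test.cost, IntExp.cost]
        omega
  · intro s2 _ _
    simp [ltTest, Test.cost, IntExp.cost]
  · rintro s2 ⟨⟨hle, h32, hlines, h5, hI⟩, hlt⟩ hu2
    have f6 : s2.intVar 6 = N := ((hu2.intVar 6 rfl).trans (hu1.intVar 6 rfl)).trans hN
    rw [holds_ltTest, f6] at hlt
    rw [show N - s2.intVar 30 = 0 by omega] at hI
    rw [← hI]
    simp [State.lines, Line.prune]
  · simp only [Program.exec, IntExp.eval, State.setI_intVar_self]
    exact h2

/-! ### Searching for the optimum among the crossings -/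

/-- One round of prune and search: test the median of the crossings, shrink the interval between the
real variables `0` and `1` accordingly, and prune the lines. -/
def roundProgram : Program :=
  crossingsProgram ;; sortProgram ;; .setInt 33 (.lit 0) ;;
  .loop (.not (.intLE (.var 7) (.add (.add (.var 33) (.var 33)) (.lit 1))))
    (.setInt 33 (.add (.var 33) (.lit 1))) ;;
  .setReal 2 (.get 7 (.var 33)) ;; testProgram ;;
  .ite (.and (.intLE (.lit 1) (.var 5)) (.intLE (.var 5) (.lit 1)))
    (.ite (.realLE (.var 1) (.var 2)) .skip (.setReal 1 (.var 2)))
    (.ite (.realLE (.var 2) (.var 0)) .skip (.setReal 0 (.var 2))) ;;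
  pruneProgram

/-- The state of the search for the least feasible value: it lies between the real variables `0` and
`1`, and the stored lines have the lower envelopes `F` there. -/
structure SearchInv (d : ℕ → ℕ → ℝ) (n : ℕ) (F : ℕ → ℝ → ℝ) (s : State) : Prop where
  env : Env n s
  lo : ¬ Feasible d n (s.realVar 0)
  hi : Feasible d n (s.realVar 1)
  envelope : IsEnvelope F (n * n) (s.realVar 0) (s.realVar 1) (s.lines 0 (s.intVar 6))
  count_le : s.intVar 6 ≤ n * n * n

variable {d : ℕ → ℕ → ℝ} {n : ℕ} {F : ℕ → ℝ → ℝ} {s : State}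

theorem lt_of_feasible (hd : IsDistMatrix d n) {lo hi : ℝ} (hlo : ¬ Feasible d n lo)
    (hhi : Feasible d n hi) : lo < hi := by
  by_contra! h
  exact hlo (hhi.mono hd h)

theorem sum_map_range (P : ℕ) (a : ℕ → ℝ) (f : ℝ → ℕ) :
    (((List.range P).map a).map f).sum = ∑ x ∈ Finset.range P, f (a x) := by
  induction P with
  | zero => simp
  | succ P ih => rw [List.range_succ, Finset.sum_range_succ, ← ih]; simp

/-- Two lists are rearrangements of each other if all sums over them agree. -/
theorem perm_of_sum_map_eq {l l' : List ℝ} (h : ∀ f : ℝ → ℕ, (l.map f).sum = (l'.map f).sum) :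
    l.Perm l' := by
  classical
  have key : ∀ (l : List ℝ) (c : ℝ), (l.map fun x => if x = c then 1 else 0).sum = l.count c := by
    intro l c
    induction l with
    | nil => simp
    | cons x l ih => simp [List.count_cons, ih, add_comm]
  exact List.perm_iff_count.2 fun c => by rw [← key, ← key, h]

theorem halts_half {P : ℕ} (hP : s.intVar 7 = P) (h33 : s.intVar 33 = 0) :
    Halts d (.loop (.not (.intLE (.var 7) (.add (.add (.var 33) (.var 33)) (.lit 1))))
      (.setInt 33 (.add (.var 33) (.lit 1)))) s (P * 13 + 9)
      (fun s' => 2 * s'.intVar 33 ≤ P ∧ P ≤ 2 * s'.intVar 33 + 1) := by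
  refine (Halts.loop (fun s' => 2 * s'.intVar 33 ≤ P)
    (fun s' => (P - s'.intVar 33) * 13 + 9) (by omega) ?_ ?_).mono (by simp [h33]) ?_
  · intro s' hu hI hb
    have e7 : s'.intVar 7 = P := (hu.intVar 7 rfl).trans hP
    simp only [Test.Holds, IntExp.eval, e7] at hb
    refine ⟨4, Halts.exec rfl le_rfl ?_⟩
    simp only [Program.exec, IntExp.eval, State.setI_intVar_self, Test.cost, IntExp.cost]
    omega
  · intro s' _ _
    simp [Test.cost, IntExp.cost]
  · rintro s' ⟨hI, hb⟩ hu
    have e7 : s'.intVar 7 = P := (hu.intVar 7 rfl).trans hP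
    simp only [Test.Holds, IntExp.eval, e7] at hb
    omega

/-- A bound for the part of the running time of `roundProgram` that does not depend on the number of
superfluous lines. -/
def roundCost (n K : ℕ) : ℕ :=
  n * n * n * 200 + testCost n + K * (n * n * 103 + 27) + 100

/-- One round keeps the invariant and removes a quarter of the superfluous lines. The cost of
sorting is split into a part for the `n * n` lines that are left in the end and a part proportional
to the number of superfluous ones. -/
theorem halts_roundProgram (hd : IsDistMatrix d n) {K : ℕ} (h : SearchInv d n F s)
    (h3 : s.intVar 3 = K) (hK : n * n * n ≤ 2 ^ K) :
    Halts d roundProgram s (roundCost n K + K * (103 * (s.intVar 6 - n * n))) (fun s' =>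
      SearchInv d n F s' ∧ 4 * (s'.intVar 6 - n * n) ≤ 3 * (s.intVar 6 - n * n)) := by
  obtain ⟨henv, hlo, hhi, hE, hcount⟩ := h
  have hlt := lt_of_feasible hd hlo hhi
  have hG := hE.le_length hlt
  rw [State.length_lines] at hG
  set N := s.intVar 6 with hN
  refine Halts.mono (B := (4 + (N * 60 + 5)) + ((2 + (K * (N * 103 + 27) + 7)) + (2 +
    ((N * 13 + 9) + (3 + (testCost n + (15 + (10 + ((N * 120 + 5) + 2)))))))))
    (R := fun s' => SearchInv d n F s' ∧ 4 * (s'.intVar 6 - n * n) ≤ 3 * (N - n * n)) ?_ ?_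
    fun _ h _ => h
  · refine (halts_crossingsProgram hN.symm).seq fun s1 ⟨hc, h7⟩ hu1 => ?_
    set P := s1.intVar 7 with hP
    refine Halts.seq ((halts_sortProgram (P := P) (K := K) rfl ((hu1.intVar 3 rfl).trans h3)
      (by omega)).mono (B' := 2 + (K * (N * 103 + 27) + 7)) (by gcongr) fun _ h _ => h)
      fun s2 ⟨hsort, hsum⟩ hu2 => ?_
    refine Halts.seq (R := fun s' => s'.intVar 33 = 0) (Halts.exec rfl le_rfl
      (by simp [Program.exec, IntExp.eval])) fun s3 h33 hu3 => ?_
    refine Halts.seq ((halts_half (P := P) ((hu3.intVar 7 rfl).trans (hu2.intVar 7 rfl)) h33).mono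
      (B' := N * 13 + 9) (by gcongr) fun _ h _ => h) fun s4 hhalf hu4 => ?_
    refine Halts.seq (B := 3) (R := fun s' => s'.realVar 2 = s2.realArr 7 (s4.intVar 33))
      (Halts.exec rfl le_rfl ?_) fun s5 h2 hu5 => ?_
    · simp [Program.exec, IntExp.eval, RealExp.eval, hu4.realArr 7 rfl, hu3.realArr 7 rfl]
    have henv5 : Env n s5 :=
      ((((henv.of_unchanged hu1 rfl rfl rfl).of_unchanged hu2 rfl rfl rfl).of_unchanged hu3 rfl
        rfl rfl).of_unchanged hu4 rfl rfl rfl).of_unchanged hu5 rfl rfl rfl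
    refine (halts_testProgram henv5).seq fun s6 ⟨_, hflag⟩ hu6 => ?_
    rw [← feasible_iff_arcClosure hd] at hflag
    set m := s5.realVar 2 with hm
    have e2 : s6.realVar 2 = m := hu6.realVar 2 rfl
    have e0 : s6.realVar 0 = s.realVar 0 :=
      (hu6.realVar 0 rfl).trans <| (hu5.realVar 0 rfl).trans <| (hu4.realVar 0 rfl).trans <|
        (hu3.realVar 0 rfl).trans <| (hu2.realVar 0 rfl).trans (hu1.realVar 0 rfl)
    have e1 : s6.realVar 1 = s.realVar 1 :=
      (hu6.realVar 1 rfl).trans <| (hu5.realVar 1 rfl).trans <| (hu4.realVar 1 rfl).trans <|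
        (hu3.realVar 1 rfl).trans <| (hu2.realVar 1 rfl).trans (hu1.realVar 1 rfl)
    have e6 : s6.intVar 6 = N :=
      (hu6.intVar 6 rfl).trans <| (hu5.intVar 6 rfl).trans <| (hu4.intVar 6 rfl).trans <|
        (hu3.intVar 6 rfl).trans <| (hu2.intVar 6 rfl).trans (hu1.intVar 6 rfl)
    have el : s6.line = s.line :=
      (hu6.lines rfl rfl rfl).trans <| (hu5.lines rfl rfl rfl).trans <|
        (hu4.lines rfl rfl rfl).trans <| (hu3.lines rfl rfl rfl).trans <|
        (hu2.lines rfl rfl rfl).trans (hu1.lines rfl rfl rfl)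
    refine Halts.seq (B := 15) (R := fun s' => s.realVar 0 ≤ s'.realVar 0 ∧
        s'.realVar 1 ≤ s.realVar 1 ∧ ¬ Feasible d n (s'.realVar 0) ∧
        Feasible d n (s'.realVar 1) ∧ (m ≤ s'.realVar 0 ∨ s'.realVar 1 ≤ m))
      (Halts.exec rfl (by decide) ?_) fun s7 ⟨g1, g2, g3, g4, g5⟩ hu7 => ?_
    · simp only [Program.exec, Test.Holds, IntExp.eval, RealExp.eval, e0, e1, e2]
      have hf : (1 ≤ s6.intVar 5 ∧ s6.intVar 5 ≤ 1) ↔ Feasible d n m := by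
        rw [← hflag]; omega
      split_ifs with k1 k2 k2
      · exact ⟨e0.ge, e1.le, e0 ▸ hlo, e1 ▸ hhi, .inr (e1 ▸ k2)⟩
      · simp only [State.setR_realVar_self, ne_eq, Nat.reduceEqDiff, not_false_eq_true,
          State.setR_realVar_of_ne, e0]
        exact ⟨le_rfl, (not_le.1 k2).le, hlo, hf.1 k1, .inr le_rfl⟩
      · exact ⟨e0.ge, e1.le, e0 ▸ hlo, e1 ▸ hhi, .inl (e0 ▸ k2)⟩
      · simp only [State.setR_realVar_self, ne_eq, one_ne_zero, not_false_eq_true,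
          State.setR_realVar_of_ne, e1]
        exact ⟨(not_le.1 k2).le, le_rfl, fun h => k1 (hf.2 h), hhi, .inl le_rfl⟩
    · refine (halts_pruneProgram ((hu7.intVar 6 rfl).trans e6)).mono le_rfl fun s8 h8 hu8 => ?_
      have el7 : s7.lines 0 N = s.lines 0 N := by
        simp only [State.lines, hu7.lines rfl rfl rfl, el]
      rw [el7] at h8
      have f0 : s8.realVar 0 = s7.realVar 0 := hu8.realVar 0 rfl
      have f1 : s8.realVar 1 = s7.realVar 1 := hu8.realVar 1 rfl
      have hlen : s8.intVar 6 =
          (Line.prune (s7.realVar 0) (s7.realVar 1) (s.lines 0 N)).length := by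
        rw [← h8, State.length_lines]
      refine ⟨⟨?_, f0 ▸ g3, f1 ▸ g4, ?_, ?_⟩, ?_⟩
      · exact ((henv5.of_unchanged hu6 rfl rfl rfl).of_unchanged hu7 rfl rfl rfl).of_unchanged hu8
          rfl rfl rfl
      · rw [h8, f0, f1]
        exact hE.prune g1 g2
      · rw [hlen]
        have := (Line.prune_sublist (s7.realVar 0) (s7.realVar 1) (s.lines 0 N)).length_le
        rw [State.length_lines] at this
        omega
      · rw [hlen]
        have hperm : List.Perm (Line.crossings (s.lines 0 N))
            ((List.range P).map (s2.realArr 7)) := by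
          refine perm_of_sum_map_eq fun f => ?_
          rw [← hc, sum_map_range, sum_map_range, hsum f]
        have hmed : (Line.crossings (s.lines 0 N)).length ≤
              2 * (Line.crossings (s.lines 0 N)).countP (fun c => c ≤ m) ∧
            (Line.crossings (s.lines 0 N)).length ≤
              2 * (Line.crossings (s.lines 0 N)).countP (fun c => m ≤ c) := by
          -- Without crossings the tested value is arbitrary, which does no harm.
          rcases Nat.eq_zero_or_pos P with h0 | h0
          · have : (Line.crossings (s.lines 0 N)).length = 0 := by simpa [h0] using hperm.length_eq
            omega
          · rw [h2]
            exact median_of_sorted hperm hsort hhalf.1 hhalf.2 h0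
        have := hE.length_prune_le hlt hmed.1 hmed.2 g5
        rwa [State.length_lines] at this
  · obtain ⟨Q, hQ⟩ := Nat.exists_eq_add_of_le hG
    have e1 : N - n * n = Q := by omega
    have e2 : K * (N * 103 + 27) = K * (n * n * 103 + 27) + K * (103 * Q) := by rw [hQ]; ring
    rw [e1, e2, roundCost]
    omega

/-- Prune until only one line per group is left. -/
def resolveProgram : Program := forLoop 34 4 roundProgram

/-- `8 * L` rounds reduce fewer than `n ^ 3 ≤ 8 ^ L` superfluous lines to none, since
`(3 / 4) ^ 8 < 1 / 8`. -/
theorem rounds_suffice {n L : ℕ} (hn : 2 ≤ n) (hL : n ≤ 2 ^ L) {Q : ℕ}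
    (hQ : 4 ^ (8 * L) * Q ≤ 3 ^ (8 * L) * (n * n * n)) : Q = 0 := by
  have hL0 : L ≠ 0 := by
    rintro rfl
    simp at hL
    omega
  have h1 : n * n * n ≤ 8 ^ L := by
    calc n * n * n ≤ 2 ^ L * 2 ^ L * 2 ^ L := by gcongr
      _ = 8 ^ L := by rw [← mul_pow, ← mul_pow]; norm_num
  have h2 : 3 ^ (8 * L) * (n * n * n) < 4 ^ (8 * L) := by
    calc 3 ^ (8 * L) * (n * n * n) ≤ 3 ^ (8 * L) * 8 ^ L := by gcongr
      _ = (3 ^ 8 * 8) ^ L := by rw [pow_mul, ← mul_pow]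
      _ < (4 ^ 8) ^ L := Nat.pow_lt_pow_left (by norm_num) hL0
      _ = 4 ^ (8 * L) := by rw [pow_mul]
  by_contra h0
  have : 4 ^ (8 * L) * 1 ≤ 4 ^ (8 * L) * Q := by gcongr; omega
  omega

/-- The potential contains four times the sorting cost of the next round for the superfluous lines:
a quarter of it pays for that round, and the rest covers four times the cost of the round after
it. -/
theorem halts_resolveProgram (hd : IsDistMatrix d n) {L : ℕ} (hn : 2 ≤ n) (hL : n ≤ 2 ^ L)
    (h : SearchInv d n F s) (h3 : s.intVar 3 = 3 * L) (h4 : s.intVar 4 = 8 * L) :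
    Halts d resolveProgram s
      (8 * L * (roundCost n (3 * L) + 9) + 3 * L * 412 * (n * n * n) + 7) (fun s' =>
      SearchInv d n F s' ∧ s'.intVar 6 = n * n) := by
  have hK : n * n * n ≤ 2 ^ (3 * L) := by
    calc n * n * n ≤ 2 ^ L * 2 ^ L * 2 ^ L := by gcongr
      _ = 2 ^ (3 * L) := by ring
  have hle : s.intVar 6 - n * n ≤ n * n * n := (Nat.sub_le _ _).trans h.count_le
  refine (Halts.forLoop_potential h4 rfl rfl (by decide)
    (fun k s' => SearchInv d n F s' ∧
      4 ^ k * (s'.intVar 6 - n * n) ≤ 3 ^ k * (n * n * n))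
    (fun k s' => (8 * L - k) * (roundCost n (3 * L) + 9) +
      3 * L * (412 * (s'.intVar 6 - n * n)) + 5) ?_ ?_ ?_).mono ?_ ?_
  · refine ⟨?_, ?_⟩
    · exact ⟨⟨by simpa using h.env.size, by simpa using h.env.sq, h.env.row⟩, h.lo, h.hi,
        by simpa using h.envelope, by simpa using h.count_le⟩
    · simpa using hle
  · rintro k hk s' hu - ⟨hI, hQ⟩
    refine ⟨_, (halts_roundProgram hd hI ((hu.intVar 3 rfl).trans h3) hK).mono le_rfl
      fun s'' ⟨hI', hQ'⟩ _ => ?_⟩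
    have e6 : (s''.setI 34 (k + 1)).intVar 6 = s''.intVar 6 := by simp
    rw [e6]
    refine ⟨⟨⟨⟨by simpa using hI'.env.size, by simpa using hI'.env.sq, hI'.env.row⟩, hI'.lo, hI'.hi,
        by simpa using hI'.envelope, by simpa using hI'.count_le⟩, ?_⟩, ?_⟩
    · calc 4 ^ (k + 1) * (s''.intVar 6 - n * n) = 4 ^ k * (4 * (s''.intVar 6 - n * n)) := by ring
        _ ≤ 4 ^ k * (3 * (s'.intVar 6 - n * n)) := by gcongr
        _ = 3 * (4 ^ k * (s'.intVar 6 - n * n)) := by ring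
        _ ≤ 3 * (3 ^ k * (n * n * n)) := by gcongr
        _ = 3 ^ (k + 1) * (n * n * n) := by ring
    · obtain ⟨m, hm⟩ := Nat.exists_eq_add_of_lt hk
      rw [show 8 * L - (k + 1) = m by omega, show 8 * L - k = m + 1 by omega]
      have : 3 * L * (412 * (s''.intVar 6 - n * n)) ≤ 3 * L * (309 * (s'.intVar 6 - n * n)) := by
        gcongr 3 * L * ?_
        omega
      have e : 3 * L * (412 * (s'.intVar 6 - n * n)) = 3 * L * (309 * (s'.intVar 6 - n * n)) +
        3 * L * (103 * (s'.intVar 6 - n * n)) := by ring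
      rw [e, Nat.succ_mul m]
      omega
  · intro s'
    omega
  · have e6 : (s.setI 34 0).intVar 6 = s.intVar 6 := by simp
    have : 3 * L * (412 * (s.intVar 6 - n * n)) ≤ 3 * L * (412 * (n * n * n)) := by gcongr
    rw [e6, Nat.sub_zero, mul_assoc (3 * L)]
    omega
  · rintro s' ⟨⟨hI, hQ⟩, -⟩ -
    have h0 := rounds_suffice hn hL hQ
    have hG := hI.envelope.le_length (lt_of_feasible hd hI.lo hI.hi)
    rw [State.length_lines] at hG
    exact ⟨hI, by omega⟩

/-! ### Squaring a matrix of linear functions -/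

/-- Append the line with the coefficients in the real variables `3` and `4`, in the group given by
the variable `35`, to the list of lines. -/
def storeLine : Program :=
  .putInt 1 (.var 6) (.var 35) ;; .putReal 5 (.var 6) (.var 3) ;; .putReal 6 (.var 6) (.var 4) ;;
  .setInt 6 (.add (.var 6) (.lit 1))

/-- For each `u, w < n` make a group of lines, one for each `v < n`; the program `q` computes their
coefficients from `u`, `w`, `v`, which are the values of the variables `10`, `11`, `12`. -/
def linesProgram (q : Program) : Program :=
  (.setInt 6 (.lit 0) ;; .setInt 35 (.lit 0)) ;;
  forLoop 10 0 (forLoop 11 0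
    (forLoop 12 0 (q ;; storeLine) ;; .setInt 35 (.add (.var 35) (.lit 1))))

variable {d : ℕ → ℕ → ℝ} {n B : ℕ} {s : State}

theorem exec_storeLine_line (x : ℕ) : (storeLine.exec d s).line x =
    if x = s.intVar 6 then ⟨s.intVar 35, s.realVar 3, s.realVar 4⟩ else s.line x := by
  simp only [storeLine, Program.exec, IntExp.eval, RealExp.eval, State.line, State.setI_intArr,
    State.setI_realArr, State.putR_intArr, State.putR_intVar, State.putI_intVar, ne_eq,
    Nat.reduceEqDiff, not_false_eq_true, State.putR_realArr_self, State.putR_realArr_of_ne,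
    State.putI_realArr, State.putI_intArr_self, State.putR_realVar, State.putI_realVar]
  split_ifs <;> rfl

/-- The line that `linesProgram` puts at the address `x`. -/
def lineAt (n : ℕ) (a b : ℕ → ℕ → ℕ → ℝ) (x : ℕ) : Line :=
  ⟨x / n, a (x / n / n) (x / n % n) (x % n), b (x / n / n) (x / n % n) (x % n)⟩

theorem lineAt_eq {a b : ℕ → ℕ → ℕ → ℝ} {u w v : ℕ} (hw : w < n) (hv : v < n) :
    lineAt n a b ((u * n + w) * n + v) = ⟨u * n + w, a u w v, b u w v⟩ := by
  have hn : 0 < n := by omega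
  have key : ∀ q r, r < n → (q * n + r) / n = q ∧ (q * n + r) % n = r := fun q r hr => by
    rw [Nat.mul_add_mod_self_right, Nat.mod_eq_of_lt hr, add_comm, Nat.add_mul_div_right _ _ hn,
      Nat.div_eq_of_lt hr]
    simp
  simp [lineAt, key _ v hv, key _ w hw]

theorem halts_linesProgram {q : Program} {a b : ℕ → ℕ → ℕ → ℝ} (h : Env n s)
    (hI : ∀ x, q.writesIntVar x = false) (hA : ∀ x, q.writesIntArr x = false)
    (hR : ∀ x, q.writesRealArr x = false)
    (hq : ∀ u < n, ∀ w < n, ∀ v < n, ∀ s', Unchanged (linesProgram q) s s' → s'.intVar 10 = u →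
      s'.intVar 11 = w → s'.intVar 12 = v →
      Halts d q s' B fun s'' => s''.realVar 3 = a u w v ∧ s''.realVar 4 = b u w v) :
    Halts d (linesProgram q) s (4 + (n * (n * (n * (B + 22) + 20) + 16) + 7)) (fun s' =>
      s'.intVar 6 = n * n * n ∧ ∀ x < n * n * n, s'.line x = lineAt n a b x) := by
  have hc : ∀ s', (storeLine.exec d s').intVar 6 = s'.intVar 6 + 1 := fun s' => by
    simp [storeLine, Program.exec, IntExp.eval]
  have hc' : ∀ s', (storeLine.exec d s').intVar 35 = s'.intVar 35 := fun s' => by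
    simp [storeLine, Program.exec]
  refine Halts.seq (R := fun s' => s' = (s.setI 6 0).setI 35 0)
    (Halts.exec rfl le_rfl rfl) fun s1 e hu1 => ?_
  subst e
  have h1 : Env n ((s.setI 6 0).setI 35 0) := h.of_unchanged hu1 rfl rfl rfl
  refine (Halts.forLoop (B := n * (n * (B + 22) + 20) + 7) h1.size ?_ ?_ (by decide)
    (fun u s' => s'.intVar 6 = u * n * n ∧ s'.intVar 35 = u * n ∧
      ∀ x < u * n * n, s'.line x = lineAt n a b x) ?_ ?_).mono le_rfl fun s' h _ => ?_
  · simp [forLoop, Program.writesIntVar, storeLine, hI]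
  · simp [forLoop, Program.writesIntVar, storeLine, hI]
  · simp
  · rintro u hu s2 hu2 h10 ⟨h6, h35, hl⟩
    have h2 : Env n s2 := h1.of_unchanged hu2
      (by simp [forLoop, Program.writesIntVar, storeLine, hI])
      (by simp [forLoop, Program.writesIntVar, storeLine, hI])
      (by simp [forLoop, Program.writesIntArr, storeLine, hA])
    refine (Halts.forLoop (B := n * (B + 22) + 7 + 4) h2.size ?_ ?_ (by decide)
      (fun w s' => s'.intVar 6 = (u * n + w) * n ∧ s'.intVar 35 = u * n + w ∧
        ∀ x < (u * n + w) * n, s'.line x = lineAt n a b x) ?_ ?_).mono le_rfl fun s' h _ => ?_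
    · simp [forLoop, Program.writesIntVar, storeLine, hI]
    · simp [forLoop, Program.writesIntVar, storeLine, hI]
    · exact ⟨by simpa using h6, by simpa using h35, by simpa using hl⟩
    · rintro w hw s3 hu3 h11 ⟨g6, g35, gl⟩
      have h3 : Env n s3 := h2.of_unchanged hu3
        (by simp [forLoop, Program.writesIntVar, storeLine, hI])
        (by simp [forLoop, Program.writesIntVar, storeLine, hI])
        (by simp [forLoop, Program.writesIntArr, storeLine, hA])
      have g10 : s3.intVar 10 = u := by
        rw [hu3.intVar 10 (by simp [forLoop, Program.writesIntVar, storeLine, hI]), h10]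
      refine Halts.seq (Halts.forLoop (B := B + 13) h3.size ?_ ?_ (by decide)
        (fun v s' => s'.intVar 6 = (u * n + w) * n + v ∧ s'.intVar 35 = u * n + w ∧
          ∀ x < (u * n + w) * n + v, s'.line x = lineAt n a b x) ?_ ?_) ?_
      · simp [Program.writesIntVar, storeLine, hI]
      · simp [Program.writesIntVar, storeLine, hI]
      · exact ⟨by simpa using g6, by simpa using g35, by simpa using gl⟩
      · rintro v hv s4 hu4 h12 ⟨k6, k35, kl⟩
        have k10 : s4.intVar 10 = u := by
          rw [hu4.intVar 10 (by simp [forLoop, Program.writesIntVar, storeLine, hI]), g10]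
        have k11 : s4.intVar 11 = w := by
          rw [hu4.intVar 11 (by simp [forLoop, Program.writesIntVar, storeLine, hI]), h11]
        have hun : Unchanged (linesProgram q) s s4 := by
          refine ((hu1.seq hu2).trans (hu3.mono ?_ ?_ ?_ ?_)).trans (hu4.mono ?_ ?_ ?_ ?_) <;>
            simp +contextual [forLoop, Program.writesIntVar, Program.writesRealVar,
              Program.writesIntArr, Program.writesRealArr]
        refine (hq u hu w hw v hv s4 hun k10 k11 h12).seq fun s5 ⟨r3, r4⟩ hu5 =>
          Halts.exec rfl (by decide) ?_
        have j6 : s5.intVar 6 = (u * n + w) * n + v := (hu5.intVar 6 (hI 6)).trans k6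
        have j35 : s5.intVar 35 = u * n + w := (hu5.intVar 35 (hI 35)).trans k35
        have jl : s5.line = s4.line := hu5.lines (hA 1) (hR 5) (hR 6)
        simp only [ne_eq, Nat.reduceEqDiff, not_false_eq_true, State.setI_intVar_of_ne, hc, hc', j6,
          j35]
        refine ⟨by ring, trivial, fun x hx => ?_⟩
        rw [State.line_setI]
        rw [exec_storeLine_line, j6]
        split_ifs with hxe
        · rw [hxe, lineAt_eq hw hv, j35, r3, r4]
        · rw [jl]
          exact kl x (by omega)
      · rintro s4 ⟨⟨k6, k35, kl⟩, -⟩ -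
        refine Halts.exec rfl (by decide) ?_
        have e : (u * n + (w + 1)) * n = (u * n + w) * n + n := by ring
        simp only [Program.exec, IntExp.eval, ne_eq, Nat.reduceEqDiff, not_false_eq_true,
          State.setI_intVar_of_ne, State.setI_intVar_self, k35]
        exact ⟨by rw [k6, e], by ring, by rw [e]; exact kl⟩
    · obtain ⟨⟨g6, g35, gl⟩, -⟩ := h
      have e : (u + 1) * n * n = (u * n + n) * n := by ring
      simp only [ne_eq, Nat.reduceEqDiff, not_false_eq_true, State.setI_intVar_of_ne]
      exact ⟨by rw [g6, e], by rw [g35]; ring, by rw [e]; exact gl⟩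
  · exact ⟨h.1.1, h.1.2.2⟩

/-- Move the coefficients of the lines to the arrays `1` and `2`. -/
def collectProgram : Program :=
  forLoop 13 1 (.putReal 1 (.var 13) (.get 5 (.var 13)) ;;
    .putReal 2 (.var 13) (.get 6 (.var 13)))

theorem halts_collectProgram (h : Env n s) :
    Halts d collectProgram s (n * n * 17 + 7) (fun s' =>
      ∀ x < n * n, s'.realArr 1 x = (s.line x).icept ∧ s'.realArr 2 x = (s.line x).slope) := by
  refine (Halts.forLoop (B := 8) h.sq rfl rfl (by decide)
    (fun k s' => ∀ x < k, s'.realArr 1 x = (s.line x).icept ∧ s'.realArr 2 x = (s.line x).slope)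
    (by simp) ?_).mono le_rfl fun s' h _ => h.1
  intro k hk s' hu hx hI
  refine Halts.exec rfl le_rfl ?_
  have e5 : s'.realArr 5 = s.realArr 5 := hu.realArr 5 rfl
  have e6 : s'.realArr 6 = s.realArr 6 := hu.realArr 6 rfl
  intro x hxk
  simp only [Program.exec, IntExp.eval, RealExp.eval, State.setI_realArr, ne_eq, Nat.reduceEqDiff,
    not_false_eq_true, State.putR_realArr_of_ne, State.putR_realArr_self, State.putR_intVar, hx,
    e5, e6, State.line]
  split_ifs with h
  · subst h
    simp
  · have := hI x (by omega)
    simpa [State.line, h] using this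

/-- Compute the minimum of the lines in each group at the least feasible value, and put the lines
that attain it into the arrays `1` and `2`. -/
def phaseProgram (q : Program) : Program :=
  linesProgram q ;; resolveProgram ;; collectProgram

/-- The least feasible value lies between the real variables `0` and `1`, and there, the matrix `G`
is linear, with the coefficients in the arrays `1` and `2`. -/
structure PhaseInv (d : ℕ → ℕ → ℝ) (n : ℕ) (G : ℝ → ℕ → ℕ → ℝ) (s : State) : Prop where
  env : Env n s
  lo : ¬ Feasible d n (s.realVar 0)
  hi : Feasible d n (s.realVar 1)
  linear : ∀ i < n, ∀ j < n, ∀ t ∈ Set.Ioo (s.realVar 0) (s.realVar 1),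
    G t i j = s.realArr 1 (i * n + j) + s.realArr 2 (i * n + j) * t

theorem isEnvelope_lineAt {a b : ℕ → ℕ → ℕ → ℝ} {G : ℝ → ℕ → ℕ → ℝ} {lo hi : ℝ} (hn : 0 < n)
    (hle : ∀ t ∈ Set.Ioo lo hi, ∀ u < n, ∀ w < n, ∀ v < n, G t u w ≤ a u w v + b u w v * t)
    (heq : ∀ t ∈ Set.Ioo lo hi, ∀ u < n, ∀ w < n, ∃ v < n, G t u w = a u w v + b u w v * t) :
    IsEnvelope (fun g t => G t (g / n) (g % n)) (n * n) lo hi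
      ((List.range' 0 (n * n * n)).map (lineAt n a b)) := by
  have hmem : ∀ x ∈ (List.range' 0 (n * n * n)).map (lineAt n a b),
      ∃ y < n * n * n, x = lineAt n a b y := fun x hx => by
    obtain ⟨y, hy, rfl⟩ := List.mem_map.1 hx
    rw [List.mem_range'_1] at hy
    exact ⟨y, by omega, rfl⟩
  refine ⟨?_, fun x hx => ?_, fun x hx t ht => ?_, fun g hg t ht => ?_⟩
  · refine List.pairwise_map.2 (List.pairwise_le_range'.imp fun {x y} hxy => ?_)
    exact Nat.div_le_div_right hxy
  · obtain ⟨y, hy, rfl⟩ := hmem x hx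
    exact Nat.div_lt_of_lt_mul (by rwa [mul_comm])
  · obtain ⟨y, hy, rfl⟩ := hmem x hx
    refine hle t ht _ ?_ _ (Nat.mod_lt _ hn) _ (Nat.mod_lt _ hn)
    exact Nat.div_lt_of_lt_mul (Nat.div_lt_of_lt_mul (by rwa [mul_comm n]))
  · have h1 : g / n < n := Nat.div_lt_of_lt_mul hg
    have h2 : g % n < n := Nat.mod_lt _ hn
    obtain ⟨v, hv, e⟩ := heq t ht _ h1 _ h2
    have hg' : g / n * n + g % n = g := Nat.div_add_mod' g n
    refine ⟨lineAt n a b ((g / n * n + g % n) * n + v), ?_, ?_, ?_⟩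
    · refine List.mem_map.2 ⟨_, ?_, rfl⟩
      rw [List.mem_range'_1, hg']
      refine ⟨by omega, ?_⟩
      calc g * n + v < (g + 1) * n := by rw [Nat.succ_mul]; omega
        _ ≤ 0 + n * n * n := by rw [zero_add]; gcongr; omega
    · rw [lineAt_eq h2 hv, hg']
    · rw [lineAt_eq h2 hv, Line.val, e]

/-- The running time of `phaseProgram`, for `2 ^ L ≥ n`. -/
def phaseCost (n L B : ℕ) : ℕ :=
  (4 + (n * (n * (n * (B + 22) + 20) + 16) + 7)) +
    ((8 * L * (roundCost n (3 * L) + 9) + 3 * L * 412 * (n * n * n) + 7) + (n * n * 17 + 7))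

/-- If the matrix `G` consists of the minima over `v` of the functions `a u w v + b u w v * t`
between the bounds of the current interval, and `q` computes these coefficients, then
`phaseProgram q` makes `G` linear on a smaller interval. -/
theorem halts_phaseProgram (hd : IsDistMatrix d n) {q : Program} {a b : ℕ → ℕ → ℕ → ℝ}
    {G : ℝ → ℕ → ℕ → ℝ} {L : ℕ} (hn : 2 ≤ n) (hL : n ≤ 2 ^ L) (h : Env n s)
    (h3 : s.intVar 3 = 3 * L) (h4 : s.intVar 4 = 8 * L)
    (hlo : ¬ Feasible d n (s.realVar 0)) (hhi : Feasible d n (s.realVar 1))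
    (hI : ∀ x, q.writesIntVar x = false) (hA : ∀ x, q.writesIntArr x = false)
    (hR : ∀ x, q.writesRealArr x = false) (hq0 : q.writesRealVar 0 = false)
    (hq1 : q.writesRealVar 1 = false)
    (hq : ∀ u < n, ∀ w < n, ∀ v < n, ∀ s', Unchanged (linesProgram q) s s' → s'.intVar 10 = u →
      s'.intVar 11 = w → s'.intVar 12 = v →
      Halts d q s' B fun s'' => s''.realVar 3 = a u w v ∧ s''.realVar 4 = b u w v)
    (hle : ∀ t ∈ Set.Ioo (s.realVar 0) (s.realVar 1), ∀ u < n, ∀ w < n, ∀ v < n,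
      G t u w ≤ a u w v + b u w v * t)
    (heq : ∀ t ∈ Set.Ioo (s.realVar 0) (s.realVar 1), ∀ u < n, ∀ w < n, ∃ v < n,
      G t u w = a u w v + b u w v * t) :
    Halts d (phaseProgram q) s (phaseCost n L B) (PhaseInv d n G) := by
  refine (halts_linesProgram h hI hA hR hq).seq fun s1 ⟨h6, hl⟩ hu1 => ?_
  have e0 : s1.realVar 0 = s.realVar 0 := hu1.realVar 0
    (by simp [linesProgram, forLoop, Program.writesRealVar, storeLine, hq0])
  have e1 : s1.realVar 1 = s.realVar 1 := hu1.realVar 1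
    (by simp [linesProgram, forLoop, Program.writesRealVar, storeLine, hq1])
  have hw : ∀ x, x ∉ [6, 35, 10, 11, 12] → (linesProgram q).writesIntVar x = false := by
    intro x hx
    simp only [List.mem_cons, List.not_mem_nil, or_false, not_or] at hx
    simp [linesProgram, forLoop, Program.writesIntVar, storeLine, hI, hx]
  have h1 : Env n s1 := h.of_unchanged hu1 (hw _ (by decide)) (hw _ (by decide))
    (by simp [linesProgram, forLoop, Program.writesIntArr, storeLine, hA])
  have hlines : s1.lines 0 (s1.intVar 6) =
      (List.range' 0 (n * n * n)).map (lineAt n a b) := by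
    rw [h6]
    refine List.map_congr_left fun x hx => ?_
    rw [List.mem_range'_1] at hx
    exact hl x (by omega)
  have hS : SearchInv d n (fun g t => G t (g / n) (g % n)) s1 := by
    refine ⟨h1, e0 ▸ hlo, e1 ▸ hhi, ?_, h6.le⟩
    rw [hlines, e0, e1]
    exact isEnvelope_lineAt (by omega) hle heq
  refine (halts_resolveProgram hd hn hL hS ((hu1.intVar 3 (hw _ (by decide))).trans h3)
    ((hu1.intVar 4 (hw _ (by decide))).trans h4)).seq fun s2 ⟨hS2, hN⟩ hu2 => ?_
  refine (halts_collectProgram hS2.env).mono le_rfl fun s3 hc hu3 => ?_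
  have f0 : s3.realVar 0 = s2.realVar 0 := hu3.realVar 0 rfl
  have f1 : s3.realVar 1 = s2.realVar 1 := hu3.realVar 1 rfl
  refine ⟨hS2.env.of_unchanged hu3 rfl rfl rfl, f0 ▸ hS2.lo, f1 ▸ hS2.hi, fun i hi j hj t ht => ?_⟩
  rw [f0, f1] at ht
  have hx : i * n + j < n * n := by nlinarith
  have hlen : i * n + j < (s2.lines 0 (s2.intVar 6)).length := by
    rwa [State.length_lines, hN]
  have := hS2.envelope.eq_of_length (lt_of_feasible hd hS2.lo hS2.hi)
    (by rw [State.length_lines, hN]) hlen t ht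
  have hdiv : (i * n + j) / n = i := by
    rw [add_comm, Nat.add_mul_div_right _ _ (by omega), Nat.div_eq_of_lt hj, zero_add]
  have hmod : (i * n + j) % n = j := by
    rw [Nat.mul_add_mod_self_right, Nat.mod_eq_of_lt hj]
  simp only [hdiv, hmod] at this
  rw [this, (hc _ hx).1, (hc _ hx).2]
  simp [State.lines, Line.val]

/-- The coefficients, as functions of the parameter, of the terms `arcVia`. -/
def arcCoeffProgram : Program :=
  .ite (eqTest 12 11) (.setReal 3 (.lit 0) ;; .setReal 4 (.query (.var 11) (.var 10)))
    (.setReal 3 (.sub (.lit 0) (.query (.var 12) (.var 10))) ;;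
      .setReal 4 (.query (.var 11) (.var 12)))

/-- The coefficients of the sums whose minima form the square of the matrix in the arrays
`1` and `2`. -/
def squareCoeffProgram : Program :=
  .setReal 3 (.add (.get 1 (cellAddr 10 12)) (.get 1 (cellAddr 12 11))) ;;
  .setReal 4 (.add (.get 2 (cellAddr 10 12)) (.get 2 (cellAddr 12 11)))

theorem halts_arcPhase (hd : IsDistMatrix d n) {L : ℕ} (hn : 2 ≤ n) (hL : n ≤ 2 ^ L) (h : Env n s)
    (h3 : s.intVar 3 = 3 * L) (h4 : s.intVar 4 = 8 * L)
    (hlo : ¬ Feasible d n (s.realVar 0)) (hhi : Feasible d n (s.realVar 1)) :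
    Halts d (phaseProgram arcCoeffProgram) s (phaseCost n L 24)
      (PhaseInv d n fun t => squared d n t 0) := by
  have hval : ∀ t u w v : _, arcVia d t u w v =
      (if v = w then 0 else - d v u) + (if v = w then d w u else d w v) * t := fun t u w v => by
    unfold arcVia
    split_ifs <;> ring
  refine halts_phaseProgram hd hn hL h h3 h4 hlo hhi (fun _ => rfl) (fun _ => rfl) (fun _ => rfl)
    rfl rfl (a := fun u w v => if v = w then 0 else - d v u)
    (b := fun u w v => if v = w then d w u else d w v) ?_ ?_ ?_
  · intro u hu w hw v hv s' _ h10 h11 h12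
    refine Halts.exec rfl (by decide) ?_
    simp only [arcCoeffProgram, Program.exec, eqTest, Test.Holds, IntExp.eval, h11, h12,
      ← le_antisymm_iff, RealExp.eval]
    split_ifs <;> simp [h10, h11, h12]
  · intro t _ u _ w _ v hv
    rw [← hval]
    exact minFrom_le _ _ hv
  · intro t _ u _ w hw
    simp only [← hval]
    exact arc_eq hw

theorem halts_squarePhase (hd : IsDistMatrix d n) {L k : ℕ} (hn : 2 ≤ n) (hL : n ≤ 2 ^ L)
    (h3 : s.intVar 3 = 3 * L) (h4 : s.intVar 4 = 8 * L)
    (h : PhaseInv d n (fun t => squared d n t k) s) :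
    Halts d (phaseProgram squareCoeffProgram) s (phaseCost n L 24)
      (PhaseInv d n fun t => squared d n t (k + 1)) := by
  have hval : ∀ t ∈ Set.Ioo (s.realVar 0) (s.realVar 1), ∀ u < n, ∀ w < n, ∀ v < n,
      squared d n t k u v + squared d n t k v w =
        (s.realArr 1 (u * n + v) + s.realArr 1 (v * n + w)) +
          (s.realArr 2 (u * n + v) + s.realArr 2 (v * n + w)) * t := by
    intro t ht u hu w hw v hv
    rw [h.linear u hu v hv t ht, h.linear v hv w hw t ht]
    ring
  refine halts_phaseProgram hd hn hL h.env h3 h4 h.lo h.hi (fun _ => rfl) (fun _ => rfl)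
    (fun _ => rfl) rfl rfl
    (a := fun u w v => s.realArr 1 (u * n + v) + s.realArr 1 (v * n + w))
    (b := fun u w v => s.realArr 2 (u * n + v) + s.realArr 2 (v * n + w)) ?_ ?_ ?_
  · intro u hu w hw v hv s' hun h10 h11 h12
    refine Halts.exec rfl (by decide) ?_
    have h' : Env n s' := h.env.of_unchanged hun rfl rfl rfl
    have e1 : s'.realArr 1 = s.realArr 1 := hun.realArr 1 rfl
    have e2 : s'.realArr 2 = s.realArr 2 := hun.realArr 2 rfl
    simp [squareCoeffProgram, Program.exec, IntExp.eval, cellAddr, RealExp.eval, h10, h11, h12,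
      e1, e2, h'.row u hu, h'.row v hv]
  · intro t ht u hu w hw v hv
    rw [← hval t ht u hu w hw v hv]
    exact squared_succ_le k hv
  · intro t ht u hu w hw
    obtain ⟨v, hv, e⟩ := squared_succ_eq (d := d) (t := t) k (w := w) hu
    exact ⟨v, hv, e.trans (hval t ht u hu w hw v hv)⟩

/-! ### The complete program -/

/-- Compute the constants of `Env`, and put the logarithm `L` of `n`, rounded up, into the variable
`2`, and the numbers `3 * L` and `8 * L` into the variables `3` and `4`. -/
def setupProgram : Program :=
  .setInt 1 (.lit 0) ;;
  forLoop 10 0 (.putInt 0 (.var 10) (.var 1) ;; .setInt 1 (.add (.var 1) (.var 0))) ;;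
  (.setInt 2 (.lit 0) ;; .setInt 16 (.lit 1)) ;;
  .loop (ltTest 16 0) (.setInt 2 (.add (.var 2) (.lit 1)) ;; .setInt 16 (.add (.var 16) (.var 16))) ;;
  .setInt 3 (.add (.var 2) (.add (.var 2) (.var 2))) ;;
  .setInt 4 (.add (.add (.var 2) (.var 3)) (.add (.var 2) (.var 3)))

/-- Add the values of `e`, for all values below `n` of the variables `10` and `11`, to the real
variable `r`. -/
def sumProgram (r : ℕ) (e : RealExp) : Program :=
  forLoop 10 0 (forLoop 11 0 (.setReal r (.add (.var r) e)))

/-- Put `0` and `trivialBound` into the real variables `0` and `1`. -/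
def boundProgram : Program :=
  (.setReal 0 (.lit 0) ;; .setReal 1 (.lit 0) ;; .setReal 3 (.lit 0)) ;;
  sumProgram 3 (.query (.var 10) (.var 11)) ;;
  sumProgram 1 (.div (.mul (.lit 2) (.var 3)) (.query (.var 10) (.var 11)))

/-- The program that computes the optimal star. -/
def optimalStarProgram : Program :=
  .ite (.intLE (.var 0) (.lit 1)) .skip
    (setupProgram ;; boundProgram ;; phaseProgram arcCoeffProgram ;;
      forLoop 36 2 (phaseProgram squareCoeffProgram) ;;
      .setReal 2 (.var 1) ;; testProgram ;; starProgram)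

variable {d : ℕ → ℕ → ℝ} {n : ℕ} {s : State}

theorem halts_setupProgram (hn : s.intVar 0 = n) :
    Halts d setupProgram s (2 + ((n * 17 + 7) + (4 + ((Nat.clog 2 n * 13 + 5) + (6 + 8)))))
      (fun s' => Env n s' ∧ s'.intVar 2 = Nat.clog 2 n ∧ s'.intVar 3 = 3 * Nat.clog 2 n ∧
        s'.intVar 4 = 8 * Nat.clog 2 n) := by
  refine Halts.seq (R := fun s' => s' = s.setI 1 0) (Halts.exec rfl le_rfl rfl) fun s1 e hu1 => ?_
  subst e
  refine Halts.seq (Halts.forLoop (B := 8) (by simpa using hn) rfl rfl (by decide)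
    (fun k s' => s'.intVar 1 = k * n ∧ ∀ i < k, s'.intArr 0 i = i * n) (by simp) ?_)
    fun s2 ⟨⟨h1, hrow⟩, _⟩ hu2 => ?_
  · rintro k hk s2 hu2 h10 ⟨h1, hrow⟩
    have h0 : s2.intVar 0 = n := (hu2.intVar 0 rfl).trans (by simpa using hn)
    refine Halts.exec rfl (by decide) ?_
    refine ⟨by simp [Program.exec, IntExp.eval, h0, h1, Nat.succ_mul], fun i hi => ?_⟩
    simp only [Program.exec, IntExp.eval, h10, h1, State.setI_intArr, State.putI_intArr_self]
    split_ifs with h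
    · rw [h]
    · exact hrow i (by omega)
  have h0 : s2.intVar 0 = n := (hu2.intVar 0 rfl).trans (by simpa using hn)
  refine Halts.seq (R := fun s' => s'.intVar 2 = 0 ∧ s'.intVar 16 = 1)
    (Halts.exec rfl le_rfl (by simp [Program.exec, IntExp.eval])) fun s3 ⟨h2, h16⟩ hu3 => ?_
  have h0' : s3.intVar 0 = n := (hu3.intVar 0 rfl).trans h0
  refine Halts.seq (R := fun s' => s'.intVar 2 = Nat.clog 2 n) ((Halts.loop
    (fun s' => s'.intVar 2 ≤ Nat.clog 2 n ∧ s'.intVar 16 = 2 ^ s'.intVar 2)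
    (fun s' => (Nat.clog 2 n - s'.intVar 2) * 13 + 5) ?_ ?_ ?_).mono ?_ ?_) fun s4 h2 hu4 => ?_
  · simp [h2, h16]
  · rintro s4 hu4 ⟨hle, hpow⟩ hlt
    rw [holds_ltTest, hpow, (hu4.intVar 0 rfl).trans h0', ← Nat.lt_clog_iff_pow_lt one_lt_two] at hlt
    refine ⟨8, Halts.exec rfl (by decide) ?_⟩
    simp only [Program.exec, IntExp.eval, ne_eq, Nat.reduceEqDiff, not_false_eq_true,
      State.setI_intVar_self, State.setI_intVar_of_ne, hpow, ltTest, Test.cost, IntExp.cost]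
    refine ⟨⟨by omega, by ring⟩, by omega⟩
  · intro s4 _ _
    simp [ltTest, Test.cost, IntExp.cost]
  · rw [h2]
    omega
  · rintro s4 ⟨⟨hle, hpow⟩, hlt⟩ hu4
    rw [holds_ltTest, hpow, (hu4.intVar 0 rfl).trans h0', ← Nat.lt_clog_iff_pow_lt one_lt_two] at hlt
    omega
  · have k0 : s4.intVar 0 = n := (hu4.intVar 0 rfl).trans h0'
    have k1 : s4.intVar 1 = n * n :=
      (hu4.intVar 1 rfl).trans ((hu3.intVar 1 rfl).trans h1)
    have kr : s4.intArr 0 = s2.intArr 0 := (hu4.intArr 0 rfl).trans (hu3.intArr 0 rfl)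
    refine Halts.exec rfl (by decide) ?_
    refine ⟨⟨?_, ?_, fun i hi => ?_⟩, ?_, ?_, ?_⟩
    · simpa [Program.exec] using k0
    · simpa [Program.exec] using k1
    · simpa [Program.exec, kr] using hrow i hi
    · simpa [Program.exec] using h2
    · simp only [Program.exec, IntExp.eval, ne_eq, Nat.reduceEqDiff, not_false_eq_true,
        State.setI_intVar_self, State.setI_intVar_of_ne, h2]
      omega
    · simp only [Program.exec, IntExp.eval, ne_eq, Nat.reduceEqDiff, not_false_eq_true,
        State.setI_intVar_self, State.setI_intVar_of_ne, h2]
      omega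

theorem halts_sumProgram {r : ℕ} {e : RealExp} {f : ℕ → ℕ → ℝ} (h : Env n s)
    (he : ∀ i < n, ∀ j < n, ∀ s', Unchanged (sumProgram r e) s s' → s'.intVar 10 = i →
      s'.intVar 11 = j → e.eval d s' = f i j) :
    Halts d (sumProgram r e) s (n * (n * (e.cost + 12) + 16) + 7) (fun s' =>
      s'.realVar r = s.realVar r + ∑ i ∈ Finset.range n, ∑ j ∈ Finset.range n, f i j) := by
  refine (Halts.forLoop (B := n * (e.cost + 12) + 7) h.size rfl rfl (by decide)
    (fun k s' => s'.realVar r = s.realVar r + ∑ i ∈ Finset.range k, ∑ j ∈ Finset.range n, f i j)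
    (by simp) ?_).mono le_rfl fun s' h _ => h.1
  intro i hi s1 hu1 h10 hI
  have h1 : Env n s1 := h.of_unchanged hu1 rfl rfl rfl
  refine (Halts.forLoop (B := e.cost + 3) h1.size rfl rfl (by decide)
    (fun k s' => s'.realVar r = s.realVar r +
      ∑ i ∈ Finset.range i, ∑ j ∈ Finset.range n, f i j + ∑ j ∈ Finset.range k, f i j)
    (by simpa using hI) ?_).mono le_rfl fun s' h _ => ?_
  · intro j hj s2 hu2 h11 hI2
    have hu : Unchanged (sumProgram r e) s s2 :=
      hu1.trans (hu2.mono (by simp +contextual [forLoop, Program.writesIntVar])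
        (by simp [forLoop, Program.writesRealVar]) (by simp [forLoop, Program.writesIntArr])
        (by simp [forLoop, Program.writesRealArr]))
    refine Halts.exec rfl (by simp [Program.maxCost, RealExp.cost]; omega) ?_
    simp only [Program.exec, RealExp.eval, hI2, State.setI_realVar, State.setR_realVar_self,
      he i hi j hj s2 hu ((hu2.intVar 10 rfl).trans h10) h11, Finset.sum_range_succ]
    ring
  · simp only [State.setI_realVar, h.1, Finset.sum_range_succ]
    ring

theorem halts_boundProgram (h : Env n s) :
    Halts d boundProgram s (6 + ((n * (n * 15 + 16) + 7) + (n * (n * 19 + 16) + 7)))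
      (fun s' => s'.realVar 0 = 0 ∧ s'.realVar 1 = trivialBound d n) := by
  refine Halts.seq (R := fun s' => s'.realVar 0 = 0 ∧ s'.realVar 1 = 0 ∧ s'.realVar 3 = 0)
    (Halts.exec rfl le_rfl (by simp [Program.exec, RealExp.eval])) fun s1 ⟨h0, h1, h3⟩ hu1 => ?_
  have e1 : Env n s1 := h.of_unchanged hu1 rfl rfl rfl
  refine (halts_sumProgram (f := d) e1 ?_).seq fun s2 hs2 hu2 => ?_
  · intro i _ j _ s2 _ h10 h11
    simp [RealExp.eval, IntExp.eval, h10, h11]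
  have e2 : Env n s2 := e1.of_unchanged hu2 rfl rfl rfl
  rw [h3, zero_add] at hs2
  refine (halts_sumProgram (f := fun i j => 2 * s2.realVar 3 / d i j) e2 ?_).mono le_rfl
    fun s3 hs3 hu3 => ?_
  · intro i _ j _ s3 hu3 h10 h11
    simp [RealExp.eval, IntExp.eval, h10, h11, hu3.realVar 3 rfl]
  · rw [hu2.realVar 1 rfl, h1, zero_add, hs2] at hs3
    exact ⟨(hu3.realVar 0 rfl).trans ((hu2.realVar 0 rfl).trans h0), hs3⟩

/-- A bound for the running time of `optimalStarProgram`. -/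
def timeBound (n : ℕ) : ℕ := 10000 * ((n ^ 3 + 1) * (Nat.clog 2 n + 1) ^ 2)

theorem testCost_le (hn : 0 < n) : testCost n ≤ 210 * (n * n * n) := by
  have h1 : n ≤ n * n := Nat.le_mul_of_pos_left n hn
  have h2 : n * n ≤ n * n * n := Nat.le_mul_of_pos_right _ hn
  calc testCost n = 85 * (n * n * n) + 44 * (n * n) + 58 * n + 23 := by unfold testCost; ring
    _ ≤ 210 * (n * n * n) := by omega

theorem phaseCost_le {L : ℕ} (hn : 0 < n) (hL : 0 < L) (hLn : L ≤ n) :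
    phaseCost n L 24 ≤ 8800 * (L * (n * n * n)) := by
  have h1 : n ≤ n * n := Nat.le_mul_of_pos_left n hn
  have h2 : n * n ≤ n * n * n := Nat.le_mul_of_pos_right _ hn
  have h3 : n * n * n ≤ L * (n * n * n) := Nat.le_mul_of_pos_left _ hL
  have h4 : L * (n * n) ≤ n * n * n := by
    calc L * (n * n) ≤ n * (n * n) := by gcongr
      _ = n * n * n := by ring
  have h5 : roundCost n (3 * L) + 9 ≤ 920 * (n * n * n) := by
    calc roundCost n (3 * L) + 9 =
        200 * (n * n * n) + testCost n + 309 * (L * (n * n)) + 81 * L + 109 := by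
          unfold roundCost; ring
      _ ≤ 920 * (n * n * n) := by have := testCost_le hn; omega
  calc phaseCost n L 24 = 46 * (n * n * n) + 37 * (n * n) + 16 * n + 25 +
        8 * (L * (roundCost n (3 * L) + 9)) + 1236 * (L * (n * n * n)) := by
        unfold phaseCost; ring
    _ ≤ 46 * (n * n * n) + 37 * (n * n) + 16 * n + 25 +
        8 * (L * (920 * (n * n * n))) + 1236 * (L * (n * n * n)) := by gcongr
    _ = 46 * (n * n * n) + 37 * (n * n) + 16 * n + 25 + 8596 * (L * (n * n * n)) := by ring
    _ ≤ 8800 * (L * (n * n * n)) := by omega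

/-- The weights are those of a star of dilation at most `t`, where `t` is a lower bound for all
feasible values. -/
theorem halts_optimalStarProgram (hd : IsDistMatrix d n) (hn : 2 ≤ n) :
    Halts d optimalStarProgram (initial n) (timeBound n) (fun s' =>
      ∃ t, IsStarWeight d n t (s'.realArr 0) ∧ ∀ t' < t, ¬ Feasible d n t') := by
  set L := Nat.clog 2 n with hL
  have hLpos : 0 < L := Nat.clog_pos one_lt_two hn
  have hLn : L ≤ n := Nat.clog_le_of_le_pow n.lt_two_pow_self.le
  have hpow : n ≤ 2 ^ L := Nat.le_pow_clog one_lt_two n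
  refine Halts.mono (B := 3 + 1 + ((2 + ((n * 17 + 7) + (4 + ((L * 13 + 5) + (6 + 8))))) +
    ((6 + ((n * (n * 15 + 16) + 7) + (n * (n * 19 + 16) + 7))) + (phaseCost n L 24 +
      ((L * (phaseCost n L 24 + 9) + 7) + (2 + (testCost n +
        (2 + (n * ((10 + ((n * 25 + 7) + 11)) + 9) + 7))))))))) ?_ ?_ fun _ h _ => h
  · refine Halts.ite (fun h => ?_) (fun _ => ?_)
    · simp only [Test.Holds, IntExp.eval, initial, update, if_true] at h
      omega
    refine (halts_setupProgram (n := n) rfl).seq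
      fun s1 ⟨e1, h2, h3, h4⟩ hu1 => ?_
    refine (halts_boundProgram e1).seq fun s2 ⟨hlo, hhi⟩ hu2 => ?_
    refine (halts_arcPhase hd hn hpow (e1.of_unchanged hu2 rfl rfl rfl)
      ((hu2.intVar 3 rfl).trans h3) ((hu2.intVar 4 rfl).trans h4)
      (hlo ▸ not_feasible_zero hd hn) (hhi ▸ feasible_trivialBound hd)).seq fun s3 hP hu3 => ?_
    refine Halts.seq (Halts.forLoop (B := phaseCost n L 24) (N := L)
      ((hu3.intVar 2 rfl).trans ((hu2.intVar 2 rfl).trans h2)) rfl rfl (by decide)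
      (fun k s' => PhaseInv d n (fun t => squared d n t k) s') ?_ ?_) fun s4 ⟨hP4, _⟩ hu4 => ?_
    · exact ⟨hP.env.of_unchanged (p := .setInt 36 (.lit 0)) (Runs.setInt s3 36 (.lit 0)
        (d := d)).unchanged rfl rfl rfl, hP.lo, hP.hi, hP.linear⟩
    · intro k hk s4 hu4 _ hI
      refine (halts_squarePhase hd hn hpow ?_ ?_ hI).mono le_rfl fun s5 h5 _ => ?_
      · exact (hu4.intVar 3 rfl).trans <| (hu3.intVar 3 rfl).trans <| (hu2.intVar 3 rfl).trans h3
      · exact (hu4.intVar 4 rfl).trans <| (hu3.intVar 4 rfl).trans <| (hu2.intVar 4 rfl).trans h4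
      · exact ⟨⟨by simpa using h5.env.size, by simpa using h5.env.sq, h5.env.row⟩, h5.lo, h5.hi,
          h5.linear⟩
    refine Halts.seq (B := 2) (R := fun s' => s'.realVar 2 = s4.realVar 1)
      (Halts.exec rfl le_rfl (by simp [Program.exec, RealExp.eval])) fun s5 h5 hu5 => ?_
    have e5 : Env n s5 := hP4.env.of_unchanged hu5 rfl rfl rfl
    refine (halts_testProgram e5).seq fun s6 ⟨hM, _⟩ hu6 => ?_
    rw [h5] at hM
    refine (halts_starProgram (e5.of_unchanged hu6 rfl rfl rfl) (by omega) hM).mono le_rfl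
      fun s7 h7 _ => ⟨s4.realVar 1, ?_, fun t ht => ?_⟩
    · have hw := isStarWeight_starOfArcClosure hd ((feasible_iff_arcClosure hd).1 hP4.hi)
      refine ⟨fun u hu => ?_, fun u hu v hv huv => ?_⟩
      · rw [h7 u hu]
        exact hw.1 u hu
      · rw [h7 u hu, h7 v hv]
        exact hw.2 u hu v hv huv
    · -- There is no feasible value below the upper end of the final interval.
      exact not_feasible_of_linear hd hpow hP4.lo
        (fun i hi => ⟨_, _, hP4.linear i hi i hi⟩) ht
  · have hn0 : 0 < n := by omega
    have h1 : n ≤ n * n := Nat.le_mul_of_pos_left n hn0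
    have h2 : n * n ≤ n * n * n := Nat.le_mul_of_pos_right _ hn0
    have h3 : n * n * n ≤ L * (n * n * n) := Nat.le_mul_of_pos_left _ hLpos
    have h4 : L * (n * n * n) ≤ L * (L * (n * n * n)) := Nat.le_mul_of_pos_left _ hLpos
    have hp := phaseCost_le hn0 hLpos hLn
    have ht := testCost_le hn0
    have hLp : L * (phaseCost n L 24 + 9) ≤ L * (8800 * (L * (n * n * n)) + 9) := by gcongr
    have e1 : L * (8800 * (L * (n * n * n)) + 9) = 8800 * (L * (L * (n * n * n))) + 9 * L := by ring
    have e2 : timeBound n = 10000 * (L * (L * (n * n * n))) + 20000 * (L * (n * n * n)) +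
        10000 * (n * n * n) + 10000 * (L + 1) ^ 2 := by
      unfold timeBound
      ring
    have e3 : n * (n * 15 + 16) = 15 * (n * n) + 16 * n := by ring
    have e4 : n * (n * 19 + 16) = 19 * (n * n) + 16 * n := by ring
    have e5 : n * ((10 + ((n * 25 + 7) + 11)) + 9) = 25 * (n * n) + 37 * n := by ring
    rw [e2, e3, e4, e5]
    omega

theorem isBigO_timeBound : (fun n : ℕ => (timeBound n : ℝ)) =O[Filter.atTop]
    (fun n : ℕ => (n : ℝ) ^ 3 * Real.log n ^ 2) := by
  refine Asymptotics.IsBigO.of_bound (20000 * (3 / Real.log 2) ^ 2) ?_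
  filter_upwards [Filter.eventually_ge_atTop 2] with n hn
  have hlog2 : 0 < Real.log 2 := Real.log_pos one_lt_two
  have hn' : (2 : ℝ) ≤ n := by exact_mod_cast hn
  have hlog : Real.log 2 ≤ Real.log n := Real.log_le_log two_pos hn'
  set L := Nat.clog 2 n with hL
  have hpred : (2 : ℝ) ^ (L - 1) < n := by
    exact_mod_cast Nat.pow_pred_clog_lt_self one_lt_two (by omega)
  have h1 : ((L - 1 : ℕ) : ℝ) * Real.log 2 ≤ Real.log n := by
    rw [← Real.log_pow]
    exact Real.log_le_log (by positivity) hpred.le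
  have hLpos : 0 < L := Nat.clog_pos one_lt_two hn
  rw [Nat.cast_sub hLpos, Nat.cast_one] at h1
  have h2 : (L : ℝ) + 1 ≤ 3 / Real.log 2 * Real.log n := by
    rw [div_mul_eq_mul_div, le_div_iff₀ hlog2]
    linarith
  have h3 : (n : ℝ) ^ 3 + 1 ≤ 2 * (n : ℝ) ^ 3 := by
    have : (1 : ℝ) ≤ (n : ℝ) ^ 3 := one_le_pow₀ (by linarith)
    linarith
  rw [Real.norm_of_nonneg (by positivity), Real.norm_of_nonneg (by positivity)]
  calc (timeBound n : ℝ) = 10000 * (((n : ℝ) ^ 3 + 1) * ((L : ℝ) + 1) ^ 2) := by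
        rw [timeBound]; push_cast; rfl
    _ ≤ 10000 * ((2 * (n : ℝ) ^ 3) * (3 / Real.log 2 * Real.log n) ^ 2) := by gcongr
    _ = 20000 * (3 / Real.log 2) ^ 2 * ((n : ℝ) ^ 3 * Real.log n ^ 2) := by ring

theorem isDistMatrix_distMatrix {X : Type*} [MetricSpace X] {n : ℕ} {p : Fin n → X}
    (hp : Function.Injective p) : IsDistMatrix (distMatrix p) n := by
  refine ⟨fun i hi => ?_, fun i hi j hj => ?_, fun i hi j hj hij => ?_⟩
  · simp [distMatrix, hi]
  · simp only [distMatrix, hi, hj, and_self, dite_true]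
    exact dist_comm _ _
  · simp only [distMatrix, hi, hj, and_self, dite_true]
    refine dist_pos.2 fun h => hij ?_
    simpa using hp h

end RealRAM

theorem mainTheorem1 :
    ∃ (P : RealRAM.Program) (T : ℕ → ℕ),
      (fun n : ℕ => (T n : ℝ)) =O[Filter.atTop] (fun n : ℕ => (n : ℝ) ^ 3 * Real.log n ^ 2) ∧
      ∀ (X : Type*) [MetricSpace X] (S : Finset X) (n : ℕ) (e : Fin n ≃ {x : X // x ∈ S}),
        ∃ (s : RealRAM.State) (t : ℕ),
          RealRAM.Runs (RealRAM.distMatrix e) P (RealRAM.initial n) s t ∧ t ≤ T n ∧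
          IsOptimalStar (fun v : {x : X // x ∈ S} => s.realArr 0 (e.symm v)) := by
  refine ⟨RealRAM.optimalStarProgram, RealRAM.timeBound, RealRAM.isBigO_timeBound,
    fun X _ S n e => ?_⟩
  rcases lt_or_ge n 2 with hn | hn
  · -- With fewer than two sites the program stops at once, and all weights are `0`.
    refine ⟨_, _, .iteTrue ?_ (.skip _), ?_, ?_⟩
    · simp only [RealRAM.Test.Holds, RealRAM.IntExp.eval, RealRAM.initial, RealRAM.update, if_true]
      omega
    · have h1 : 1 ≤ (n ^ 3 + 1) * (Nat.clog 2 n + 1) ^ 2 := Nat.one_le_iff_ne_zero.2 (by positivity)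
      simp only [RealRAM.Test.cost, RealRAM.IntExp.cost, RealRAM.timeBound]
      omega
    · have hsub : Subsingleton {x : X // x ∈ S} := by
        refine ⟨fun x y => e.symm.injective (Fin.ext ?_)⟩
        have := (e.symm x).isLt
        have := (e.symm y).isLt
        omega
      refine ⟨(isAdmissibleStar_iff _).2 ⟨fun v => le_rfl, fun u v huv => ?_⟩, fun c' _ => ?_⟩
      · exact absurd (Subsingleton.elim u v) huv
      · rw [dilation_weightedStar_of_subsingleton, dilation_weightedStar_of_subsingleton]
  · have hd := RealRAM.isDistMatrix_distMatrix e.injective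
    obtain ⟨s, t, hrun, ht, r, hw, hopt⟩ := RealRAM.halts_optimalStarProgram hd hn
    have hdist : ∀ u v : {x : X // x ∈ S},
        RealRAM.distMatrix e (e.symm u) (e.symm v) = dist u v := fun u v => by
      simp [RealRAM.distMatrix]
    have hne : ∀ u v : {x : X // x ∈ S}, u ≠ v → (e.symm u : ℕ) ≠ e.symm v := fun u v huv h =>
      huv (e.symm.injective (Fin.ext h))
    have hpair := fun (u v : {x : X // x ∈ S}) (huv : u ≠ v) =>
      hw.2 _ (e.symm u).isLt _ (e.symm v).isLt (hne u v huv)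
    simp only [hdist] at hpair
    refine ⟨s, t, hrun, ht, (isAdmissibleStar_iff _).2
      ⟨fun v => hw.1 _ (e.symm v).isLt, fun u v huv => (hpair u v huv).1⟩, fun c' hc' => ?_⟩
    obtain ⟨hc0, hc1⟩ := (isAdmissibleStar_iff _).1 hc'
    -- The weights of an admissible star witness that its dilation is a feasible value.
    have hfeas : Feasible (RealRAM.distMatrix e) n (dilation (weightedStar c') some) := by
      refine ⟨fun i => if h : i < n then c' (e ⟨i, h⟩) else 0, fun u hu => ?_,
        fun u hu v hv huv => ?_⟩
      · simp only [hu, dite_true]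
        exact hc0 _
      · have huv' : e ⟨u, hu⟩ ≠ e ⟨v, hv⟩ := fun h => huv (by simpa using e.injective h)
        simp only [hu, hv, dite_true, RealRAM.distMatrix, and_self]
        exact ⟨hc1 _ _ huv', le_dilation_weightedStar c' huv'⟩
    have hle : r ≤ dilation (weightedStar c') some := not_lt.1 fun h => hopt _ h hfeas
    have hr : 0 ≤ r := not_lt.1 fun h =>
      (RealRAM.lt_of_feasible hd (not_feasible_zero hd hn) ⟨_, hw⟩).not_gt h
    exact (dilation_weightedStar_le _ r hr fun u v huv => (hpair u v huv).2).trans hle
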